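/- \textbf{Setting.} Let $\mathcal U$ be a nonempty finite set, $n=|\mathcal U|$, and let $f:2^{\mathcal U}\to\mathbb R_{\ge 0}$ be submodular. Write $\Delta(A\mid B)=f(A\cup B)-f(B)$ and $M=\max_{x\in\mathcal U}\Delta(\{x\}\mid\emptyset)$. Let $m\ge 1$ and $\ell\ge 1$ be integers, $\varepsilon\in(0,1)$ and $\tau_{\min}>0$. Queries to $f$ are made in adaptive rounds: the sets queried in one round depend only on the answers of earlier rounds (and on the random choices); parallel computations share rounds. \textbf{The algorithm} $\mathrm{PIG}(f,m,\ell,\tau_{\min},\varepsilon)$. Start with $I=[\ell]$, $m_0=m$, and $A_j=A_j'=\emptyset$, $\tau_j=M$, $V_j=\mathcal U$ for all $j\in[\ell]$. The operation $\mathrm{Update}(j)$ is the following, with $W=\mathcal U\setminus\bigcup_{l\in[\ell]}A_l$: replace $V_j$ by $\{x\in V_j\cap W:\Delta(x\mid A_j)\ge\tau_j\}$; then, while $V_j=\emptyset$ and $\tau_j\ge\tau_{\min}$, replace $\tau_j$ by $(1-\varepsilon)\tau_j$ and $V_j$ by $\{x\in W:\Delta(x\mid A_j)\ge\tau_j\}$.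 While $I\ne\emptyset$ and $m_0>0$, do: \begin{enumerate} \item Perform $\mathrm{Update}(j)$ for all $j\in I$ in parallel and remove from $I$ every $j$ with $\tau_j<\tau_{\min}$. If $I=\emptyset$, stop. \item If $|V_i|<2\ell$ for some $i\in I$: for the $j\in I$ in increasing order, perform $\mathrm{Update}(j)$ if $V_j=\emptyset$; then, if $\tau_j<\tau_{\min}$, remove $j$ from $I$, and otherwise choose $x\in V_j$ uniformly at random, add $x$ to $A_j$ and to $A_j'$, and delete $x$ from all $V_l$. Then decrease $m_0$ by $1$. \item Otherwise: for the $j\in I$ in increasing order of $|V_j|$, choose uniformly at random a set $\mathcal V_j$ of $\lfloor |V_j|/\ell\rfloor$ elements of $V_j$ outside the sets $\mathcal V_l$ already chosen. Let $s=\min\{m_0,\min_{l\in I}|\mathcal V_l|\}$. For all $j\in I$ in parallel, order $\mathcal V_j$ by an independent uniform random permutation $v_1,v_2,\dots$, and for $i\le s$ mark $v_i$ \emph{true} if $\Delta(v_i\mid A_j\cup\{v_1,\dots,v_{i-1}\})\ge\tau_j$, \emph{false} if this marginal gain is negative, and \emph{none} otherwise; let $i_j^*$ be the largest $i\le s$ such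 that at least $(1-\varepsilon)i$ of $v_1,\dots,v_i$ are marked true. Put $i^*=\min_{j\in I}i_j^*$. For each $j\in I$, let $S_j$ consist of $i^*$ elements of $\{v_1,\dots,v_{i_j^*}\}$, taking first (in order) those marked true, then those marked none, then those marked false; let $S_j'$ be the elements of $S_j$ not marked false; replace $A_j$ by $A_j\cup S_j$ and $A_j'$ by $A_j'\cup S_j'$. Then decrease $m_0$ by $i^*$. \end{enumerate} The output is the family of pairs $(A_l,A_l')$, $l\in[\ell]$. \textbf{Lemma.} (Complexity) For every fixed $R>1$ there is a constant $C$, depending only on $R$, such that for all inputs as above with $M\ge R\,\tau_{\min}$, with probability at least $1-1/n$ the algorithm uses at most $$C\,\ell^2\varepsilon^{-2}\log(n)\log\!\Big(\frac{M}{\tau_{\min}}\Big)\ \text{ adaptive rounds and at most }\ C\,\ell^3\varepsilon^{-2}\,n\log(n)\log\!\Big(\frac{M}{\tau_{\min}}\Big)\ \text{ queries.}$$ (Guarantees) For all inputs as above, the algorithm always terminates, and every possible outcome $\{(A_l,A_l'):l\in[\ell]\}$ satisfies: \begin{enumerate} \item $A_l'\subseteq A_l$ and $\Delta(A_l'\mid\emptyset)\ge\Delta(A_l\mid\emptyset)$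 for all $l\in[\ell]$, and the sets $A_1,\dots,A_\ell$ are pairwise disjoint. \item For all sets $O_1,\dots,O_\ell\subseteq\mathcal U$ with $|O_l|\le m$ for all $l$, and $O_l\cap A_j=\emptyset$ for all $j\ne l$: $$\Delta(O_l\mid A_l)\le\frac{\Delta(A_l'\mid\emptyset)}{(1-\varepsilon)^2}+\frac{m\,\tau_{\min}}{1-\varepsilon}\qquad\text{for all } l\in[\ell].$$ \item For the same $O_1,\dots,O_\ell$ and all $1\le l_1<l_2\le\ell$: $$\Delta(O_{l_2}\mid A_{l_1})+\Delta(O_{l_1}\mid A_{l_2})\le\frac{1+\frac1m}{(1-\varepsilon)^2}\Big(\Delta(A_{l_1}'\mid\emptyset)+\Delta(A_{l_2}'\mid\emptyset)\Big)+\frac{2m\,\tau_{\min}}{1-\varepsilon}.$$ \item If $\ell=2$, then for every $S\subseteq\mathcal U$ with $|S|\le m$: $$\Delta(S\mid A_1)+\Delta(S\mid A_2)\le\frac{1}{(1-\varepsilon)^2}\Big(\Delta(A_1'\mid\emptyset)+\Delta(A_2'\mid\emptyset)\Big)+\frac{2m\,\tau_{\min}}{1-\varepsilon}.$$ \end{enumerate}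 -/

import Mathlib

/-!
ParallelInterlaceGreedy over an explicit value oracle.  The algorithm is a probability mass
function on final states; every state carries the transcript of the oracle queries made so far,
divided into adaptive rounds.
-/

noncomputable section

namespace PIG

/-- The marginal gain `Δ(A | B) = f (A ∪ B) - f B`. -/
def gain {U : Type*} [DecidableEq U] (f : Finset U → ℝ) (A B : Finset U) : ℝ :=
  f (A ∪ B) - f B

/-- Submodularity of a set function. -/
def Submodular {U : Type*} [DecidableEq U] (f : Finset U → ℝ) : Prop :=
  ∀ A B : Finset U, f (A ∪ B) + f (A ∩ B) ≤ f A + f B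

/-- `M`, the largest marginal gain of a single element over the empty set. -/
def maxGain {U : Type*} [Fintype U] [DecidableEq U] [Nonempty U] (f : Finset U → ℝ) : ℝ :=
  Finset.univ.sup' Finset.univ_nonempty fun x => gain f {x} ∅

/-- The uniform distribution on `s` (a point mass when `s` is empty). -/
def unif {α : Type*} [Nonempty α] (s : Finset α) : PMF α :=
  if h : s.Nonempty then PMF.uniformOfFinset s h else PMF.pure (Classical.arbitrary α)

/-- A query transcript: the list of the adaptive rounds, each one being the multiset of the sets
at which `f` is evaluated in that round. -/
abbrev Transcript (U : Type*) := List (Multiset (Finset U))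

/-- The number of adaptive rounds of a transcript. -/
def Transcript.rounds {U : Type*} (t : Transcript U) : ℕ := t.length

/-- The number of queries of a transcript, counted with multiplicity. -/
def Transcript.queries {U : Type*} (t : Transcript U) : ℕ := (t.map Multiset.card).sum

/-- Parallel execution: round `r` collects the queries of the `r`-th rounds of all branches. -/
def parallel {U : Type*} {ℓ : ℕ} (J : Finset (Fin ℓ)) (t : Fin ℓ → Transcript U) :
    Transcript U :=
  (List.range (J.sup fun j => (t j).length)).map fun r => ∑ j ∈ J, (t j).getD r 0

/-- The queries needed for the marginal gains over `A` of all the elements of `W`. -/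
def gainQueries {U : Type*} [DecidableEq U] (A W : Finset U) : Multiset (Finset U) :=
  A ::ₘ W.val.map fun x => {x} ∪ A

/-! ### The subroutine Update

It is run with the function `S ↦ f (A ∪ S)` restricted to the ground set `W`: first `V` is
filtered by the threshold `τ`; then, while `V = ∅` (and the threshold is still at least `τmin`),
the threshold is multiplied by `1 - ε` and `V` is recomputed from the whole of `W`. -/

/-- The candidate set of Update after `k` passes through its while loop. -/
def updateSet {U : Type*} [DecidableEq U] (f : Finset U → ℝ) (A W V : Finset U)
    (τ ε : ℝ) (k : ℕ) : Finset U :=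
  if k = 0 then (V ∩ W).filter fun x => τ ≤ gain f {x} A
  else W.filter fun x => (1 - ε) ^ k * τ ≤ gain f {x} A

/-- The number of passes through the while loop of Update: the first `k` at which the loop
condition fails. -/
def updateSteps {U : Type*} [DecidableEq U] (f : Finset U → ℝ) (A W V : Finset U)
    (τ τmin ε : ℝ) : ℕ :=
  sInf {k : ℕ | ¬ (updateSet f A W V τ ε k = ∅ ∧ τmin ≤ (1 - ε) ^ k * τ)}

/-- The queries of Update: one round for the filtering, one for each pass of its loop. -/
def updateTranscript {U : Type*} [DecidableEq U] (A W V : Finset U) (k : ℕ) : Transcript U :=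
  gainQueries A (V ∩ W) :: List.replicate k (gainQueries A W)

/-! ### The state of the algorithm -/

/-- The variables of the algorithm, and the transcript of its queries. -/
structure State (U : Type*) (ℓ : ℕ) where
  /-- indices of the solutions that are still active -/
  I : Finset (Fin ℓ)
  /-- the solutions `A_j` -/
  A : Fin ℓ → Finset U
  /-- the subsets `A_j'` -/
  A' : Fin ℓ → Finset U
  /-- the candidate sets `V_j` -/
  V : Fin ℓ → Finset U
  /-- the thresholds `τ_j` -/
  τ : Fin ℓ → ℝ
  /-- the remaining budget -/
  m₀ : ℕ
  /-- the queries made so far -/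
  log : Transcript U

/-- The elements outside all the solutions. -/
def State.outside {U : Type*} [Fintype U] [DecidableEq U] {ℓ : ℕ} (s : State U ℓ) : Finset U :=
  Finset.univ \ Finset.univ.biUnion s.A

/-- Run Update for all `j ∈ J` in parallel. -/
def runUpdate {U : Type*} [Fintype U] [DecidableEq U] {ℓ : ℕ} (f : Finset U → ℝ) (τmin ε : ℝ)
    (J : Finset (Fin ℓ)) (s : State U ℓ) : State U ℓ :=
  let W := s.outside
  let K : Fin ℓ → ℕ := fun j => updateSteps f (s.A j) W (s.V j) (s.τ j) τmin ε
  { s with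
    V := fun j => if j ∈ J then updateSet f (s.A j) W (s.V j) (s.τ j) ε (K j) else s.V j
    τ := fun j => if j ∈ J then (1 - ε) ^ K j * s.τ j else s.τ j
    log := s.log ++ parallel J fun j => updateTranscript (s.A j) W (s.V j) (K j) }

/-- First phase of an iteration: update all the active candidate sets, and deactivate the
solutions whose threshold fell below `τmin`. -/
def refresh {U : Type*} [Fintype U] [DecidableEq U] {ℓ : ℕ} (f : Finset U → ℝ) (τmin ε : ℝ)
    (s : State U ℓ) : State U ℓ :=
  let s₁ := runUpdate f τmin ε s.I s
  { s₁ with I := s₁.I.filter fun j => τmin ≤ s₁.τ j }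

/-! ### Adding one element to each solution, in turn -/

/-- The turn of solution `j`. -/
def addOne {U : Type*} [Fintype U] [DecidableEq U] [Nonempty U] {ℓ : ℕ} (f : Finset U → ℝ)
    (τmin ε : ℝ) (j : Fin ℓ) (s : State U ℓ) : PMF (State U ℓ) :=
  let s₁ := if s.V j = ∅ then runUpdate f τmin ε {j} s else s
  if s₁.τ j < τmin then PMF.pure { s₁ with I := s₁.I.erase j }
  else (unif (s₁.V j)).map fun x =>
    { s₁ with
      A := Function.update s₁.A j (insert x (s₁.A j))
      A' := Function.update s₁.A' j (insert x (s₁.A' j))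
      V := fun l => (s₁.V l).erase x }

/-- The turns of the solutions in the given list, in sequence. -/
def addInTurn {U : Type*} [Fintype U] [DecidableEq U] [Nonempty U] {ℓ : ℕ} (f : Finset U → ℝ)
    (τmin ε : ℝ) : List (Fin ℓ) → State U ℓ → PMF (State U ℓ)
  | [], s => PMF.pure s
  | j :: js, s => (addOne f τmin ε j s).bind (addInTurn f τmin ε js)

/-! ### Adding a block of elements to each solution -/

/-- The loop of Distribute: for each `j` in the list, choose uniformly a set of `⌊|V_j| / ℓ⌋`
elements of `V_j` outside all the sets `D_l` chosen so far, and call it `D_j`. -/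
def distributeAux {U : Type*} [DecidableEq U] {ℓ : ℕ} (V : Fin ℓ → Finset U) :
    List (Fin ℓ) → (Fin ℓ → Finset U) → PMF (Fin ℓ → Finset U)
  | [], D => PMF.pure D
  | j :: js, D =>
    (unif (Finset.powersetCard ((V j).card / ℓ) (V j \ Finset.univ.biUnion D))).bind
      fun W => distributeAux V js (Function.update D j W)

/-- The subroutine Distribute: the indices in `I` are treated in increasing order of `|V_j|`. -/
def distribute {U : Type*} [DecidableEq U] {ℓ : ℕ} (V : Fin ℓ → Finset U) (I : Finset (Fin ℓ)) :
    PMF (Fin ℓ → Finset U) :=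
  distributeAux V (I.sort.insertionSort fun i j => (V i).card ≤ (V j).card) fun _ => ∅

/-- All the orderings of the elements of `D`. -/
def orderings {U : Type*} [DecidableEq U] (D : Finset U) : Finset (List U) :=
  D.toList.permutations.toFinset

/-- The marks `B` of Prefix-Selection for the function `S ↦ f (A ∪ S)`: the element `v` at position
`i` of the list is marked by comparing its marginal gain over `A` and the elements before it
with `τ` and `0`. -/
def marks {U : Type*} [DecidableEq U] (f : Finset U → ℝ) (A : Finset U) (τ : ℝ) (L : List U) :
    List (U × Option Bool) :=
  L.mapIdx fun i v =>
    (v, if τ ≤ gain f {v} (A ∪ (L.take i).toFinset) then some true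
        else if gain f {v} (A ∪ (L.take i).toFinset) < 0 then some false
        else none)

/-- The prefix length of Prefix-Selection: the largest `i ≤ s` such that at least `(1 - ε) i` of
the first `i` marks are `true`. -/
def prefixLength {U : Type*} (ε : ℝ) (s : ℕ) (P : List (U × Option Bool)) : ℕ :=
  Nat.findGreatest
    (fun i => (1 - ε) * (i : ℝ) ≤ (((P.take i).countP fun p => p.2 = some true : ℕ) : ℝ)) s

/-- The queries of Prefix-Selection: `A` together with the prefixes of lengths `0, …, s`. -/
def prefixQueries {U : Type*} [DecidableEq U] (A : Finset U) (L : List U) (s : ℕ) :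
    Multiset (Finset U) :=
  (Multiset.range (s + 1)).map fun i => A ∪ (L.take i).toFinset

/-- Choose `i` elements of a marked list in three passes: first the marks `true`, then `none`,
then `false`. -/
def threePass {U : Type*} (i : ℕ) (P : List (U × Option Bool)) : List (U × Option Bool) :=
  ((P.filter fun p => p.2 = some true) ++ (P.filter fun p => p.2 = none) ++
    (P.filter fun p => p.2 = some false)).take i

/-- Add blocks of equal size to all the active solutions.  The permutations of the pairwise
disjoint sets `D_j` are uniform and independent: a uniform point of the product. -/
def addBlocks {U : Type*} [DecidableEq U] {ℓ : ℕ} (f : Finset U → ℝ) (ε : ℝ) (s : State U ℓ)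
    (h : s.I.Nonempty) : PMF (State U ℓ) :=
  (distribute s.V s.I).bind fun D =>
    (unif (Fintype.piFinset fun j => orderings (D j))).map fun L =>
      let size : ℕ := min s.m₀ (s.I.inf' h fun l => (D l).card)
      let P : Fin ℓ → List (U × Option Bool) :=
        fun j => marks f (s.A j) (s.τ j) ((L j).take size)
      let i : ℕ := s.I.inf' h fun j => prefixLength ε size (P j)
      let S : Fin ℓ → List (U × Option Bool) :=
        fun j => threePass i ((P j).take (prefixLength ε size (P j)))
      { s with
        A := fun j => if j ∈ s.I then s.A j ∪ ((S j).map Prod.fst).toFinset else s.A j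
        A' := fun j => if j ∈ s.I then
            s.A' j ∪ (((S j).filter fun p => p.2 ≠ some false).map Prod.fst).toFinset
          else s.A' j
        m₀ := s.m₀ - i
        log := s.log ++ [∑ j ∈ s.I, prefixQueries (s.A j) (L j) size] }

/-! ### The main loop -/

/-- One iteration of the while loop. -/
def iteration {U : Type*} [Fintype U] [DecidableEq U] [Nonempty U] {ℓ : ℕ} (f : Finset U → ℝ)
    (τmin ε : ℝ) (s : State U ℓ) : PMF (State U ℓ) :=
  let s₁ := refresh f τmin ε s
  if h : s₁.I.Nonempty then
    if ∃ i ∈ s₁.I, (s₁.V i).card < 2 * ℓ then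
      (addInTurn f τmin ε s₁.I.sort s₁).map fun t => { t with m₀ := t.m₀ - 1 }
    else addBlocks f ε s₁ h
  else PMF.pure s₁

/-- The exit condition of the while loop. -/
def State.Halted {U : Type*} {ℓ : ℕ} (s : State U ℓ) : Prop :=
  s.I = ∅ ∨ s.m₀ = 0

instance {U : Type*} {ℓ : ℕ} (s : State U ℓ) : Decidable s.Halted :=
  inferInstanceAs (Decidable (s.I = ∅ ∨ s.m₀ = 0))

/-- The while loop, cut off after the given number of iterations. -/
def whileLoop {U : Type*} [Fintype U] [DecidableEq U] [Nonempty U] {ℓ : ℕ} (f : Finset U → ℝ)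
    (τmin ε : ℝ) : ℕ → State U ℓ → PMF (State U ℓ)
  | 0, s => PMF.pure s
  | k + 1, s => if s.Halted then PMF.pure s
      else (iteration f τmin ε s).bind (whileLoop f τmin ε k)

/-- The initial state.  The first round of queries computes `M`. -/
def initial {U : Type*} [Fintype U] [DecidableEq U] [Nonempty U] (f : Finset U → ℝ) (m ℓ : ℕ) :
    State U ℓ where
  I := Finset.univ
  A := fun _ => ∅
  A' := fun _ => ∅
  V := fun _ => Finset.univ
  τ := fun _ => maxGain f
  m₀ := m
  log := [gainQueries ∅ Finset.univ]

/-- The algorithm, as the distribution of its final state.  Each iteration that does not empty `I`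
lowers the budget `m₀`, so the cut-off after `m` iterations is harmless (that every outcome is
halted is a conclusion of the theorem). -/
def parallelInterlaceGreedy {U : Type*} [Fintype U] [DecidableEq U] [Nonempty U]
    (f : Finset U → ℝ) (m ℓ : ℕ) (τmin ε : ℝ) : PMF (State U ℓ) :=
  whileLoop f τmin ε m (initial f m ℓ)

end PIG

end

/-! ### Random orderings and initial parts with too many bad elements. -/

noncomputable section
namespace PIG

/-! ### Uniformly random orderings -/

/-! Guarantees. They hold along every run. `Core` is preserved by iterations and says two things: no
unused element has gain over `A_l` above `max τ_l τmin / (1 - ε)`, and `A_l'` has earned at least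
`(1 - ε) * max τ_l τmin` for each element of `A_l`. At exit an active solution has `m` elements and
an inactive one has a threshold below `τmin`; this settles a single solution (`gain_le_of_outcome`).
For two solutions `i < k`, each chosen element of `O₁ ∩ A_i` is charged to the threshold of `k`, and
each of `O₂ ∩ A_k` to that of `i`, while both solutions earn their thresholds for every element
added. Elements outside the sets are not charged, and this surplus is a reserve for the members of
the sets that are never chosen. The difficulty is that, when elements are added in turn, `i` picks
before `k` has lowered its threshold, so the charge is at the old threshold of `k`. `PairInv`
therefore keeps at least one unit of reserve at that threshold. No reserve is needed while both
solutions lie inside their sets, since the gain of `A_i` over `A_k` is then at most the gain of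
`A_i'`; the unit is set aside when an element first falls outside (`PairInv.extends`). If `i` has
chosen an element of `O₁`, one unit may be missing at the end at the threshold of `i`, which is the
source of `1 + 1/m`. For `ℓ = 2` the sets are `S \ A_k` and `S \ A_i`, and a chosen element of the
first is absent from the second, so nothing is missing.

Complexity. The exponential of `total` (one eighth of the rounds plus `potential`) is a
supermartingale (`expect_iteration_le`), and Markov's inequality bounds the number of rounds. The
potential counts the remaining threshold levels and the logarithms of the candidate sets. A pass of
Update uses up a level; a turn with few candidates shrinks their logarithm noticeably. When blocks
are added, prefix selection stops because the budget is spent, because a whole `D_j` is used up, or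
because an initial part has too many elements below the threshold. In the last case, unless the
random orderings behave atypically, many candidates leave. The atypical event `Fails` has
probability at most `a * e`, uniformly in the number of solutions (`sum_fails_le`). For one ordering
an exponential moment bound controls the excess of bad elements (`sum_crosses_le`). For several
orderings, splitting by the first bad element gives each solution a factor equal to its own bad
ratio, and these ratios have a small sum. Queries follow from rounds, since a round has at most `ℓ *
(n + 1)` of them. -/

theorem mem_orderings {U : Type*} [DecidableEq U] {D : Finset U} {L : List U} :
    L ∈ orderings D ↔ L.Nodup ∧ L.toFinset = D := by
  unfold orderings
  rw [List.mem_toFinset, List.mem_permutations]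
  constructor
  · intro h
    refine ⟨h.nodup_iff.2 D.nodup_toList, ?_⟩
    rw [List.toFinset_eq_of_perm _ _ h, Finset.toList_toFinset]
  · rintro ⟨h1, rfl⟩
    exact (List.toFinset_toList h1).symm

theorem length_of_mem_orderings {U : Type*} [DecidableEq U] {D : Finset U} {L : List U}
    (h : L ∈ orderings D) : L.length = D.card := by
  obtain ⟨h1, rfl⟩ := mem_orderings.1 h
  exact (List.toFinset_card_of_nodup h1).symm

theorem orderings_empty {U : Type*} [DecidableEq U] : orderings (∅ : Finset U) = {[]} := by
  ext L
  rw [mem_orderings, Finset.mem_singleton]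
  constructor
  · rintro ⟨-, h⟩
    simpa using h
  · rintro rfl
    simp

theorem cons_mem_orderings {U : Type*} [DecidableEq U] {D : Finset U} {x : U} {L : List U} :
    x :: L ∈ orderings D ↔ x ∈ D ∧ L ∈ orderings (D.erase x) := by
  simp only [mem_orderings, List.nodup_cons, List.toFinset_cons]
  constructor
  · rintro ⟨⟨h1, h2⟩, rfl⟩
    refine ⟨Finset.mem_insert_self _ _, h2, ?_⟩
    rw [Finset.erase_insert (by simpa using h1)]
  · rintro ⟨hx, h2, h3⟩
    refine ⟨⟨fun h => ?_, h2⟩, ?_⟩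
    · have : x ∈ D.erase x := h3 ▸ List.mem_toFinset.2 h
      simp at this
    · rw [h3, Finset.insert_erase hx]

/-- Conditioning on the first element; probabilities over orderings are handled as sums throughout.
-/
theorem sum_orderings {U : Type*} [DecidableEq U] {D : Finset U} (hD : D.Nonempty)
    (g : List U → ℝ) :
    ∑ L ∈ orderings D, g L = ∑ x ∈ D, ∑ L ∈ orderings (D.erase x), g (x :: L) := by
  rw [Finset.sum_sigma']
  symm
  refine Finset.sum_bij (fun p _ => p.1 :: p.2) ?_ ?_ ?_ ?_
  · rintro ⟨x, L⟩ h
    rw [Finset.mem_sigma] at h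
    exact cons_mem_orderings.2 h
  · rintro ⟨x, L⟩ _ ⟨y, L'⟩ _ h
    simp only [List.cons.injEq] at h
    obtain ⟨rfl, rfl⟩ := h
    rfl
  · intro L hL
    cases L with
    | nil =>
      exfalso
      have := (mem_orderings.1 hL).2
      simp at this
      exact hD.ne_empty this.symm
    | cons x L =>
      exact ⟨⟨x, L⟩, Finset.mem_sigma.2 (cons_mem_orderings.1 hL), rfl⟩
  · intro _ _
    rfl

theorem card_orderings {U : Type*} [DecidableEq U] (D : Finset U) :
    (orderings D).card = D.card.factorial := by
  unfold orderings
  rw [List.toFinset_card_of_nodup (List.nodup_permutations _ D.nodup_toList),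
    List.length_permutations, Finset.length_toList]

theorem orderings_nonempty {U : Type*} [DecidableEq U] (D : Finset U) : (orderings D).Nonempty :=
  Finset.card_pos.1 (card_orderings D ▸ D.card.factorial_pos)

/-- The number of bad elements of a list, badness being judged after the elements of `T` and the
earlier elements of the list. -/
def badCount {U : Type*} [DecidableEq U] (bad : Finset U → U → Prop) : Finset U → List U → ℕ
  | _, [] => 0
  | T, x :: L => (open Classical in if bad T x then 1 else 0) + badCount bad (insert x T) L

/-- Starting after the set `T` with `b` bad elements, the bad elements of some initial part of the
list exceed the proportion `ε`, the sets before the excess being `small`. -/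
def Crosses {U : Type*} [DecidableEq U] (bad : Finset U → U → Prop) (small : Finset U → Prop)
    (ε : ℝ) : Finset U → ℕ → List U → Prop
  | _, _, [] => False
  | T, b, x :: L => small T ∧
      (ε * ((T.card : ℝ) + 1) < (b : ℝ) + (open Classical in if bad T x then (1 : ℝ) else 0) ∨
        Crosses bad small ε (insert x T) (b + (open Classical in if bad T x then 1 else 0)) L)

-- Exponential moment argument with weight `exp (b - ε |T|)`. While `T` is small, a proportion of at
-- most `a ε` of the remaining elements is bad, so one more element multiplies `exp b` on average by
-- at most `1 + (e - 1) a ε ≤ 1 + ε ≤ exp ε`, which the growth of `T` cancels. At a crossing the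
-- weight is at least one. The factorial counts the orderings of `R`.
open Classical in
theorem sum_crosses_le {U : Type*} [DecidableEq U] (bad : Finset U → U → Prop)
    (small : Finset U → Prop) {ε a : ℝ} (hε : 0 < ε)
    (ha1 : a * (Real.exp 1 - 1) ≤ 1) (D : Finset U)
    (hz : ∀ T ⊆ D, small T →
      (((D \ T).filter (bad T)).card : ℝ) ≤ a * ε * ((D \ T).card : ℝ)) :
    ∀ (R T : Finset U), T ⊆ D → R = D \ T → ∀ b : ℕ,
      ∑ L ∈ orderings R, (if Crosses bad small ε T b L then (1 : ℝ) else 0) ≤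
        Real.exp ((b : ℝ) - ε * T.card) * R.card.factorial := by
  intro R
  induction R using Finset.strongInduction with
  | H R ih =>
  intro T hT hR b
  rcases R.eq_empty_or_nonempty with h0 | hne
  · rw [h0, orderings_empty, Finset.sum_singleton, if_neg (by simp [Crosses])]
    positivity
  by_cases hs : small T
  · rw [sum_orderings hne]
    have key : ∀ x ∈ R, ∑ L ∈ orderings (R.erase x),
        (if Crosses bad small ε T b (x :: L) then (1 : ℝ) else 0) ≤
          (Real.exp ((b : ℝ) - ε * (T.card + 1)) * (R.card - 1).factorial) *
            (1 + (Real.exp 1 - 1) * if bad T x then 1 else 0) := by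
      intro x hx
      have hxT : x ∉ T := by
        rw [hR, Finset.mem_sdiff] at hx; exact hx.2
      have hxD : x ∈ D := by
        rw [hR, Finset.mem_sdiff] at hx; exact hx.1
      have e1 : Real.exp ((b : ℝ) - ε * (T.card + 1)) * (R.card - 1).factorial *
            (1 + (Real.exp 1 - 1) * if bad T x then 1 else 0) =
          Real.exp ((b + (if bad T x then 1 else 0) : ℕ) - ε * (insert x T).card) *
            (R.erase x).card.factorial := by
        rw [Finset.card_insert_of_notMem hxT, Finset.card_erase_of_mem hx]
        split_ifs
        · push_cast
          rw [show ((b : ℝ) + 1 - ε * (T.card + 1)) = (b - ε * (T.card + 1)) + 1 by ring,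
            Real.exp_add]
          ring
        · push_cast
          ring_nf
      rw [e1]
      -- If `x` itself causes the crossing, the exponent is positive and counting all orderings
      -- suffices; otherwise induction applies.
      by_cases hc : ε * ((T.card : ℝ) + 1) < (b : ℝ) + (if bad T x then (1 : ℝ) else 0)
      · calc _ ≤ ∑ L ∈ orderings (R.erase x), (1 : ℝ) := by
              apply Finset.sum_le_sum
              intro L _
              split_ifs <;> norm_num
          _ = 1 * (R.erase x).card.factorial := by
              simp [card_orderings]
          _ ≤ _ := by
              apply mul_le_mul_of_nonneg_right _ (by positivity)
              apply Real.one_le_exp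
              rw [Finset.card_insert_of_notMem hxT]
              push_cast
              linarith
      · have := ih (R.erase x) (Finset.erase_ssubset hx) (insert x T)
          (Finset.insert_subset hxD hT) (by rw [hR, Finset.sdiff_insert])
          (b + if bad T x then 1 else 0)
        refine le_trans (Finset.sum_le_sum fun L _ => ?_) this
        simp only [Crosses, hs, hc, true_and, false_or]
        exact le_rfl
    refine (Finset.sum_le_sum key).trans ?_
    rw [← Finset.mul_sum, Finset.sum_add_distrib, ← Finset.mul_sum, Finset.sum_boole,
      Finset.sum_const, nsmul_eq_mul, mul_one]
    have hz' := hz T hT hs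
    rw [← hR] at hz'
    have hcard : 0 < R.card := Finset.card_pos.2 hne
    have hRpos : (0 : ℝ) < R.card := by exact_mod_cast hcard
    have he1 : 0 ≤ Real.exp 1 - 1 := by
      have := Real.add_one_le_exp (1 : ℝ); linarith
    have h1 : (R.card : ℝ) + (Real.exp 1 - 1) * ((R.filter (bad T)).card : ℝ) ≤
        Real.exp ε * R.card := by
      have h2 : (Real.exp 1 - 1) * ((R.filter (bad T)).card : ℝ) ≤
          (Real.exp 1 - 1) * (a * ε * R.card) := mul_le_mul_of_nonneg_left hz' he1
      have h3 : (Real.exp 1 - 1) * (a * ε * R.card) ≤ ε * R.card := by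
        have : a * (Real.exp 1 - 1) * (ε * R.card) ≤ 1 * (ε * R.card) :=
          mul_le_mul_of_nonneg_right ha1 (by positivity)
        linarith
      have h4 : (ε + 1) * (R.card : ℝ) ≤ Real.exp ε * R.card :=
        mul_le_mul_of_nonneg_right (Real.add_one_le_exp ε) hRpos.le
      linarith
    calc _ ≤ (Real.exp ((b : ℝ) - ε * (T.card + 1)) * (R.card - 1).factorial) *
          (Real.exp ε * R.card) := mul_le_mul_of_nonneg_left h1 (by positivity)
      _ = Real.exp ((b : ℝ) - ε * T.card) * R.card.factorial := by
        rw [show ((b : ℝ) - ε * T.card) = (b - ε * (T.card + 1)) + ε by ring, Real.exp_add,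
          ← Nat.mul_factorial_pred hcard.ne']
        push_cast
        ring
  · have : ∀ L ∈ orderings R, (if Crosses bad small ε T b L then (1 : ℝ) else 0) = 0 := by
      intro L _
      cases L with
      | nil => simp [Crosses]
      | cons x L => simp [Crosses, hs]
    rw [Finset.sum_eq_zero this]
    positivity

/-- The proportion of the elements of `D` that are bad after `T`. -/
def badRatio {U : Type*} (bad : Finset U → U → Prop) (D T : Finset U) : ℝ :=
  open Classical in ((D.filter (bad T)).card : ℝ) / D.card

theorem badRatio_mono {U : Type*} {bad : Finset U → U → Prop}
    (hmono : ∀ T T' x, T ⊆ T' → bad T x → bad T' x) (D : Finset U) {T T' : Finset U}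
    (h : T ⊆ T') : badRatio bad D T ≤ badRatio bad D T' := by
  classical
  unfold badRatio
  apply div_le_div_of_nonneg_right _ (by positivity)
  exact_mod_cast Finset.card_le_card
    (Finset.monotone_filter_right D fun x (_ : x ∈ D) hx => hmono _ _ _ h hx)

theorem badRatio_nonneg {U : Type*} (bad : Finset U → U → Prop) (D T : Finset U) :
    0 ≤ badRatio bad D T := by
  unfold badRatio
  positivity

-- All elements of `T` are bad after `T`, so removing them from `D` can only lower the proportion of
-- bad elements.
open Classical in
theorem card_filter_sdiff_le {U : Type*} [DecidableEq U] {bad : Finset U → U → Prop}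
    (hself : ∀ T x, x ∈ T → bad T x) {D T : Finset U} (hT : T ⊆ D) :
    (((D \ T).filter (bad T)).card : ℝ) ≤ badRatio bad D T * ((D \ T).card : ℝ) := by
  rcases D.eq_empty_or_nonempty with rfl | hne
  · simp
  have hGsplit : ((D.filter (bad T)).card : ℝ) = T.card + ((D \ T).filter (bad T)).card := by
    have : D.filter (bad T) = T ∪ (D \ T).filter (bad T) := by
      ext x
      simp only [Finset.mem_filter, Finset.mem_union, Finset.mem_sdiff]
      constructor
      · rintro ⟨h1, h2⟩
        by_cases hx : x ∈ T
        · exact Or.inl hx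
        · exact Or.inr ⟨⟨h1, hx⟩, h2⟩
      · rintro (h | h)
        · exact ⟨hT h, hself _ _ h⟩
        · exact ⟨h.1.1, h.2⟩
    rw [this, Finset.card_union_of_disjoint, Nat.cast_add]
    refine Finset.disjoint_left.2 fun x hx hx' => ?_
    exact (Finset.mem_sdiff.1 (Finset.mem_filter.1 hx').1).2 hx
  have hDsplit : (D.card : ℝ) = T.card + (D \ T).card := by
    rw [Finset.card_sdiff_of_subset hT, Nat.cast_sub (Finset.card_le_card hT)]
    ring
  have hle : (((D \ T).filter (bad T)).card : ℝ) ≤ (D \ T).card := by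
    exact_mod_cast Finset.card_filter_le _ _
  have hDpos : (0 : ℝ) < D.card := by exact_mod_cast Finset.card_pos.2 hne
  rw [badRatio, div_mul_eq_mul_div, le_div_iff₀ hDpos, hGsplit, hDsplit]
  have : (0 : ℝ) ≤ T.card := by positivity
  nlinarith

/-- The next element is bad, and then the bad elements exceed the proportion `ε`. -/
def FirstBad {U : Type*} [DecidableEq U] (bad : Finset U → U → Prop) (small : Finset U → Prop)
    (ε : ℝ) (T : Finset U) : List U → Prop
  | [] => False
  | x :: L => bad T x ∧ Crosses bad small ε T 0 (x :: L)

-- The first element is bad with probability at most `badRatio`; then `sum_crosses_le` applies with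
-- one bad element already counted. The actual ratio is kept, not its bound `a ε`, so that
-- contributions of different solutions can later be added.
open Classical in
theorem sum_firstBad_le {U : Type*} [DecidableEq U] (bad : Finset U → U → Prop)
    (small : Finset U → Prop) {ε a : ℝ} (hε : 0 < ε)
    (ha1 : a * (Real.exp 1 - 1) ≤ 1) (D : Finset U)
    (hself : ∀ T x, x ∈ T → bad T x)
    (hz : ∀ T ⊆ D, small T →
      (((D \ T).filter (bad T)).card : ℝ) ≤ a * ε * ((D \ T).card : ℝ))
    (Q : Prop) [Decidable Q] (T : Finset U) (hT : T ⊆ D) :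
      ∑ L ∈ orderings (D \ T), (if Q ∧ FirstBad bad small ε T L then (1 : ℝ) else 0) ≤
        ∑ _L ∈ orderings (D \ T), (if Q then Real.exp (1 - ε * (T.card + 1)) *
          badRatio bad D T else 0) := by
  by_cases hQ : Q
  swap
  · simp [hQ]
  simp only [hQ, true_and, if_true]
  rw [Finset.sum_const, nsmul_eq_mul, card_orderings]
  rcases (D \ T).eq_empty_or_nonempty with h0 | hne
  · rw [h0, orderings_empty]
    simp [FirstBad]
    exact mul_nonneg (Real.exp_pos _).le (badRatio_nonneg _ _ _)
  set R := D \ T with hR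
  rw [sum_orderings hne]
  have key : ∀ x ∈ R, ∑ L ∈ orderings (R.erase x),
        (if FirstBad bad small ε T (x :: L) then (1 : ℝ) else 0) ≤
          (Real.exp (1 - ε * (T.card + 1)) * (R.card - 1).factorial) *
            (if bad T x then 1 else 0) := by
    intro x hx
    obtain ⟨hxD, hxT⟩ := Finset.mem_sdiff.1 hx
    by_cases hb : bad T x
    swap
    · simp [FirstBad, hb]
    simp only [hb, if_true, mul_one, FirstBad, true_and]
    have e1 : Real.exp (1 - ε * (T.card + 1)) * (R.card - 1).factorial =
          Real.exp ((1 : ℕ) - ε * (insert x T).card) * (R.erase x).card.factorial := by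
      rw [Finset.card_insert_of_notMem hxT, Finset.card_erase_of_mem hx]
      push_cast
      rfl
    rw [e1]
    by_cases hc : ε * ((T.card : ℝ) + 1) < 1
    · calc _ ≤ ∑ L ∈ orderings (R.erase x), (1 : ℝ) := by
              apply Finset.sum_le_sum
              intro L _
              split_ifs <;> norm_num
          _ = 1 * (R.erase x).card.factorial := by
              simp [card_orderings]
          _ ≤ _ := by
              apply mul_le_mul_of_nonneg_right _ (by positivity)
              apply Real.one_le_exp
              rw [Finset.card_insert_of_notMem hxT]
              push_cast
              linarith
    · have := sum_crosses_le bad small hε ha1 D hz (R.erase x) (insert x T)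
          (Finset.insert_subset hxD hT) (by rw [hR, Finset.sdiff_insert]) 1
      refine le_trans (Finset.sum_le_sum fun L _ => ?_) this
      simp only [Crosses, hb, if_true, Nat.cast_zero, zero_add, hc, false_or]
      split_ifs <;> first | (norm_num; done) | tauto
  refine (Finset.sum_le_sum key).trans ?_
  rw [← Finset.mul_sum, Finset.sum_boole]
  have hcard : 0 < R.card := Finset.card_pos.2 hne
  have hr := card_filter_sdiff_le hself hT
  rw [← hR] at hr
  calc _ ≤ (Real.exp (1 - ε * (T.card + 1)) * (R.card - 1).factorial) *
        (badRatio bad D T * R.card) :=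
        mul_le_mul_of_nonneg_left hr (by positivity)
    _ = _ := by
      rw [← Nat.mul_factorial_pred hcard.ne']
      push_cast
      ring

/-- Conditioning on the first `i` elements: given the initial part `p`, the rest is a uniform
ordering of what remains of `D`, so a bound valid for every `p` survives averaging. -/
theorem sum_orderings_split_le {U : Type*} [DecidableEq U] (D : Finset U)
    (h₁ h₂ : List U → List U → ℝ)
    (hle : ∀ p : List U, p.toFinset ⊆ D → ∑ L ∈ orderings (D \ p.toFinset), h₁ p L ≤
      ∑ L ∈ orderings (D \ p.toFinset), h₂ p L) (i : ℕ) :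
    ∀ p : List U, p.toFinset ⊆ D →
      ∑ L ∈ orderings (D \ p.toFinset), h₁ (p ++ L.take i) (L.drop i) ≤
      ∑ L ∈ orderings (D \ p.toFinset), h₂ (p ++ L.take i) (L.drop i) := by
  induction i with
  | zero =>
    intro p hp
    simpa using hle p hp
  | succ i ih =>
    intro p hp
    rcases (D \ p.toFinset).eq_empty_or_nonempty with h0 | hne
    · have := hle p hp
      rw [h0, orderings_empty] at this ⊢
      simpa using this
    · rw [sum_orderings hne, sum_orderings hne]
      apply Finset.sum_le_sum
      intro x hx
      have e : (p ++ [x]).toFinset = insert x p.toFinset := by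
        ext; simp
      have := ih (p ++ [x])
        (by rw [e]; exact Finset.insert_subset (Finset.mem_sdiff.1 hx).1 hp)
      rw [e, Finset.sdiff_insert] at this
      simpa using this

/-- Resampling one coordinate: exchanging `L j` with `y` is an involution. This is how the
independence of the orderings enters. -/
theorem sum_piFinset_update {ι : Type*} [Fintype ι] [DecidableEq ι] {κ : ι → Type*}
    [∀ i, DecidableEq (κ i)]
    (s : ∀ i, Finset (κ i)) (j : ι) (F : (∀ i, κ i) → ℝ) :
    ∑ L ∈ Fintype.piFinset s, ∑ y ∈ s j, F (Function.update L j y) =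
      (s j).card * ∑ L ∈ Fintype.piFinset s, F L := by
  have : ((s j).card : ℝ) * ∑ L ∈ Fintype.piFinset s, F L =
      ∑ L ∈ Fintype.piFinset s, ∑ _y ∈ s j, F L := by
    simp [Finset.mul_sum]
  rw [this, ← Finset.sum_product', ← Finset.sum_product']
  refine Finset.sum_nbij' (fun p => (Function.update p.1 j p.2, p.1 j))
    (fun p => (Function.update p.1 j p.2, p.1 j)) ?_ ?_ ?_ ?_ ?_
  · rintro ⟨L, y⟩ h
    rw [Finset.mem_product, Fintype.mem_piFinset] at h ⊢
    refine ⟨fun i => ?_, h.1 j⟩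
    by_cases hi : i = j
    · subst hi; simpa using h.2
    · simpa [hi] using h.1 i
  · rintro ⟨L, y⟩ h
    rw [Finset.mem_product, Fintype.mem_piFinset] at h ⊢
    refine ⟨fun i => ?_, h.1 j⟩
    by_cases hi : i = j
    · subst hi; simpa using h.2
    · simpa [hi] using h.1 i
  · rintro ⟨L, y⟩ _
    simp
  · rintro ⟨L, y⟩ _
    simp
  · rintro ⟨L, y⟩ _
    simp

theorem sum_piFinset_le_of_update {ι : Type*} [Fintype ι] [DecidableEq ι] {κ : ι → Type*}
    [∀ i, DecidableEq (κ i)]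
    (s : ∀ i, Finset (κ i)) (j : ι) (hj : (s j).Nonempty) (F F' : (∀ i, κ i) → ℝ)
    (h : ∀ L ∈ Fintype.piFinset s, ∑ y ∈ s j, F (Function.update L j y) ≤
      ∑ y ∈ s j, F' (Function.update L j y)) :
    ∑ L ∈ Fintype.piFinset s, F L ≤ ∑ L ∈ Fintype.piFinset s, F' L := by
  have h1 := Finset.sum_le_sum h
  rw [sum_piFinset_update, sum_piFinset_update] at h1
  exact le_of_mul_le_mul_left h1 (by exact_mod_cast Finset.card_pos.2 hj)

/-- `Crosses` demands smallness before every inspected element; as smallness passes to subsets, it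
is enough to have it at the moment of the excess. -/
theorem crosses_of_lt_badCount {U : Type*} [DecidableEq U] {bad : Finset U → U → Prop}
    {small : Finset U → Prop} {ε : ℝ} (hs : ∀ T T', T ⊆ T' → small T' → small T)
    (L : List U) : ∀ (T : Finset U) (b t : ℕ), L.Nodup → (∀ x ∈ L, x ∉ T) → t < L.length →
      small (T ∪ (L.take t).toFinset) →
      ε * ((T.card : ℝ) + t + 1) < (b : ℝ) + badCount bad T (L.take (t + 1)) →
      Crosses bad small ε T b L := by
  induction L with
  | nil => intro T b t _ _ h; simp at h
  | cons x L ih =>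
    intro T b t hnd hdis ht hsm hlt
    refine ⟨hs _ _ Finset.subset_union_left hsm, ?_⟩
    cases t with
    | zero =>
      left
      simp only [List.take_succ_cons, List.take_zero, badCount] at hlt
      simp only [Nat.cast_zero, add_zero] at hlt
      refine hlt.trans_le ?_
      split_ifs <;> simp
    | succ t =>
      right
      rw [List.nodup_cons] at hnd
      have hxT : x ∉ T := hdis x (by simp)
      refine ih (insert x T) _ t hnd.2 ?_ ?_ ?_ ?_
      · intro y hy
        rw [Finset.mem_insert, not_or]
        exact ⟨fun h => hnd.1 (h ▸ hy), hdis y (by simp [hy])⟩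
      · simpa using ht
      · simpa using hsm
      · rw [Finset.card_insert_of_notMem hxT]
        rw [List.take_succ_cons, badCount] at hlt
        push_cast at hlt ⊢
        linarith

end PIG
end

/-! ### The failure event for several independent orderings. -/

noncomputable section
namespace PIG

/-- The length of the longest initial part, of length at most `i`, without bad elements. -/
def cleanLength {U : Type*} [DecidableEq U] (bad : Finset U → U → Prop) (i : ℕ) (L : List U) :
    ℕ :=
  Nat.findGreatest (fun t => badCount bad ∅ (L.take t) = 0) i

/-- Some list has too many bad elements in an initial part of length `t + 1`, although the
proportions of bad elements are all small at time `t`. -/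
def Fails {U : Type*} [DecidableEq U] {ι : Type*} (J : Finset ι) (D : ι → Finset U)
    (bad : ι → Finset U → U → Prop) (ε a : ℝ) (s : ℕ) (L : ι → List U) : Prop :=
  ∃ j ∈ J, ∃ t < s, badRatio (bad j) (D j) ((L j).take t).toFinset < a * ε ∧
    ε * ((t : ℝ) + 1) < (badCount (bad j) ∅ ((L j).take (t + 1)) : ℝ) ∧
    ∑ k ∈ J, badRatio (bad k) (D k) ((L k).take (cleanLength (bad k) t (L k))).toFinset < a * ε

theorem badCount_append {U : Type*} [DecidableEq U] (bad : Finset U → U → Prop) (L L' : List U) :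
    ∀ T, badCount bad T (L ++ L') = badCount bad T L + badCount bad (T ∪ L.toFinset) L' := by
  induction L with
  | nil => simp [badCount]
  | cons x L ih =>
    intro T
    rw [List.cons_append, badCount, badCount, ih]
    simp [add_assoc]

/-- A telescoping form of `1 + ε ≤ exp ε`; it replaces the summation of a geometric series. -/
theorem exp_mul_le_sub {ε : ℝ} (x : ℝ) :
    ε * Real.exp (-(ε * (x + 1))) ≤ Real.exp (-(ε * x)) - Real.exp (-(ε * (x + 1))) := by
  have h : Real.exp (-(ε * x)) = Real.exp ε * Real.exp (-(ε * (x + 1))) := by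
    rw [← Real.exp_add]
    ring_nf
  have h1 := Real.add_one_le_exp ε
  have h2 := Real.exp_pos (-(ε * (x + 1)))
  rw [h]
  nlinarith

theorem sum_exp_le (ε : ℝ) (s : ℕ) :
    ∑ i ∈ Finset.range s, ε * Real.exp (-(ε * ((i : ℝ) + 1))) ≤ 1 := by
  have : ∀ s : ℕ, ∑ i ∈ Finset.range s, ε * Real.exp (-(ε * ((i : ℝ) + 1))) ≤
      1 - Real.exp (-(ε * s)) := by
    intro s
    induction s with
    | zero => simp
    | succ s ih =>
      rw [Finset.sum_range_succ]
      have := exp_mul_le_sub (ε := ε) (s : ℝ)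
      push_cast
      linarith
  have h := this s
  have := Real.exp_pos (-(ε * s))
  linarith

-- There is no factor for the number of solutions. A failure is split by the solution `j` with the
-- excess and the position `i` of its first bad element. Given the clean part before it, this has
-- probability at most `exp (1 - ε (i + 1))` times the bad ratio of `j`. The ratios of all solutions
-- at their clean parts sum to less than `a ε`, so the terms with the same `i` contribute at most `a
-- ε exp (1 - ε (i + 1))` together, and the sum over `i` telescopes.
open Classical in
theorem sum_fails_le {U : Type*} [DecidableEq U] {ι : Type*} [Fintype ι] [DecidableEq ι]
    (J : Finset ι) (D : ι → Finset U) (bad : ι → Finset U → U → Prop) {ε a : ℝ} (hε : 0 < ε)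
    (ha : 0 ≤ a) (ha1 : a * (Real.exp 1 - 1) ≤ 1)
    (hself : ∀ j ∈ J, ∀ T x, x ∈ T → bad j T x)
    (hmono : ∀ j ∈ J, ∀ T T' x, T ⊆ T' → bad j T x → bad j T' x) (s : ℕ)
    (hs : ∀ j ∈ J, s ≤ (D j).card) :
    ∑ L ∈ Fintype.piFinset (fun j => orderings (D j)),
      (if Fails J D bad ε a s L then (1 : ℝ) else 0) ≤
        a * Real.exp 1 * (Fintype.piFinset (fun j => orderings (D j))).card := by
  set Ω := Fintype.piFinset (fun j => orderings (D j)) with hΩ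
  set r : ι → List U → ℝ := fun j p => badRatio (bad j) (D j) p.toFinset with hr
  set ρ : ℕ → (ι → List U) → ι → ℝ := fun i L k =>
    r k ((L k).take (cleanLength (bad k) i (L k))) with hρ
  set small : ι → Finset U → Prop := fun j T => badRatio (bad j) (D j) T < a * ε with hsmall
  -- Besides the revealed part `p`, this reads only the orderings other than `L j`, so the rest of
  -- `L j` remains uniform.
  set Q : ι → ℕ → (ι → List U) → List U → Prop := fun j i L p =>
    badCount (bad j) ∅ p = 0 ∧ ∑ k ∈ J.erase j, ρ i L k + r j p < a * ε with hQ
  have hQu : ∀ j i L y p, Q j i (Function.update L j y) p ↔ Q j i L p := by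
    intro j i L y p
    simp only [hQ]
    have : ∑ k ∈ J.erase j, ρ i (Function.update L j y) k = ∑ k ∈ J.erase j, ρ i L k := by
      apply Finset.sum_congr rfl
      intro k hk
      simp only [hρ]
      rw [Function.update_of_ne (Finset.ne_of_mem_erase hk)]
    rw [this]
  have hz : ∀ j ∈ J, ∀ T ⊆ D j, small j T →
      (((D j \ T).filter (bad j T)).card : ℝ) ≤ a * ε * ((D j \ T).card : ℝ) := by
    intro j hj T hT hsm
    refine (card_filter_sdiff_le (hself j hj) hT).trans ?_
    exact mul_le_mul_of_nonneg_right (le_of_lt hsm) (by positivity)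
  have hρmono : ∀ L : ι → List U, ∀ k ∈ J, ∀ {i t : ℕ}, i ≤ t → ρ i L k ≤ ρ t L k := by
    intro L k hk i t hit
    apply badRatio_mono (hmono k hk)
    intro x hx
    rw [List.mem_toFinset] at hx ⊢
    exact (List.take_prefix_take_left (Nat.findGreatest_mono_right _ hit)).subset hx
  have step1 : ∀ L ∈ Ω, (if Fails J D bad ε a s L then (1 : ℝ) else 0) ≤
      ∑ i ∈ Finset.range s, ∑ j ∈ J,
        if Q j i L ((L j).take i) ∧
          FirstBad (bad j) (small j) ε ((L j).take i).toFinset ((L j).drop i)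
        then (1 : ℝ) else 0 := by
    intro L hL
    have hnn : ∀ i ∈ Finset.range s, 0 ≤ ∑ j ∈ J, if Q j i L ((L j).take i) ∧
          FirstBad (bad j) (small j) ε ((L j).take i).toFinset ((L j).drop i)
        then (1 : ℝ) else 0 := fun i _ => Finset.sum_nonneg fun j _ => by split_ifs <;> norm_num
    by_cases hF : Fails J D bad ε a s L
    swap
    · rw [if_neg hF]
      exact Finset.sum_nonneg hnn
    rw [if_pos hF]
    obtain ⟨j, hj, t, hts, h1, h2, h3⟩ := hF
    -- With `i` the length of the clean part of `j`, the element at position `i` is the first bad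
    -- one of `L j`.
    set i := cleanLength (bad j) t (L j) with hi
    have hit : i ≤ t := Nat.findGreatest_le t
    have hclean : badCount (bad j) ∅ ((L j).take i) = 0 :=
      Nat.findGreatest_spec (P := fun t => badCount (bad j) ∅ ((L j).take t) = 0)
        (Nat.zero_le t) (by simp [badCount])
    have hLj : L j ∈ orderings (D j) := Fintype.mem_piFinset.1 hL j
    have hlen : (L j).length = (D j).card := length_of_mem_orderings hLj
    have hnd := (mem_orderings.1 hLj).1
    have hil : i < (L j).length := by
      have := hs j hj
      omega
    have hcl : cleanLength (bad j) i (L j) = i := by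
      apply le_antisymm (Nat.findGreatest_le i)
      exact Nat.le_findGreatest le_rfl hclean
    have hcount : ∀ n, badCount (bad j) ∅ ((L j).take (i + n)) =
        badCount (bad j) ((L j).take i).toFinset (((L j).drop i).take n) := by
      intro n
      rw [List.take_add, badCount_append, hclean, zero_add, Finset.empty_union]
    -- By maximality of the clean part if `i < t`, and by the excess itself if `i = t`.
    have hpos : badCount (bad j) ∅ ((L j).take (i + 1)) ≠ 0 := by
      rcases hit.lt_or_eq with hlt | heq
      · exact Nat.findGreatest_is_greatest
          (P := fun t => badCount (bad j) ∅ ((L j).take t) = 0) (Nat.lt_succ_self _) hlt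
      · rw [heq]
        intro h0
        rw [h0] at h2
        have : 0 < ε * ((t : ℝ) + 1) := by positivity
        simp at h2
        linarith
    have hfb : FirstBad (bad j) (small j) ε ((L j).take i).toFinset ((L j).drop i) := by
      have hcross : Crosses (bad j) (small j) ε ((L j).take i).toFinset 0 ((L j).drop i) := by
        refine crosses_of_lt_badCount (t := t - i) ?_ _ _ _ ?_ ?_ ?_ ?_ ?_
        · intro T T' hTT hT'
          exact lt_of_le_of_lt (badRatio_mono (hmono j hj) _ hTT) hT'
        · exact hnd.sublist (List.drop_sublist _ _)
        · intro x hx hx'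
          rw [List.mem_toFinset] at hx'
          exact (List.disjoint_take_drop hnd le_rfl) hx' hx
        · rw [List.length_drop]
          have := hs j hj
          omega
        · have : ((L j).take i).toFinset ∪ (((L j).drop i).take (t - i)).toFinset =
              ((L j).take t).toFinset := by
            rw [← List.toFinset_append, ← List.take_add, Nat.add_sub_cancel' hit]
          simp only [hsmall]
          rw [this]
          exact h1
        · rw [← hcount, List.toFinset_card_of_nodup (hnd.sublist (List.take_sublist _ _)),
            List.length_take, min_eq_left hil.le]
          have e : i + (t - i + 1) = t + 1 := by omega
          rw [e]
          have e2 : ((i : ℝ) + ((t - i : ℕ) : ℝ) + 1) = t + 1 := by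
            rw [Nat.cast_sub hit]; ring
          rw [e2, Nat.cast_zero, zero_add]
          exact h2
      have h1' := hcount 1
      cases hd : (L j).drop i with
      | nil =>
        rw [List.drop_eq_nil_iff] at hd
        omega
      | cons x L' =>
        rw [hd] at hcross h1'
        refine ⟨?_, hcross⟩
        by_contra hb
        apply hpos
        rw [h1']
        simp [badCount, hb]
    have hQj : Q j i L ((L j).take i) := by
      refine ⟨hclean, ?_⟩
      have : ρ i L j = r j ((L j).take i) := by
        simp only [hρ]
        rw [hcl]
      rw [← this, Finset.sum_erase_add _ _ hj]
      exact lt_of_le_of_lt (Finset.sum_le_sum fun k hk => hρmono L k hk hit) h3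
    have hi' : i ∈ Finset.range s := Finset.mem_range.2 (by omega)
    refine le_trans ?_ (Finset.single_le_sum hnn hi')
    refine le_trans ?_ (Finset.single_le_sum (f := fun j => if Q j i L ((L j).take i) ∧
          FirstBad (bad j) (small j) ε ((L j).take i).toFinset ((L j).drop i)
        then (1 : ℝ) else 0) (fun j _ => by split_ifs <;> norm_num) hj)
    simp only [hQj, hfb, and_self, if_true, le_refl]
  have step2 : ∀ i ∈ Finset.range s, ∀ j ∈ J,
      ∑ L ∈ Ω, (if Q j i L ((L j).take i) ∧
          FirstBad (bad j) (small j) ε ((L j).take i).toFinset ((L j).drop i)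
        then (1 : ℝ) else 0) ≤
      ∑ L ∈ Ω, (if Q j i L ((L j).take i) then
        Real.exp (1 - ε * ((i : ℝ) + 1)) * r j ((L j).take i) else 0) := by
    intro i hi j hj
    apply sum_piFinset_le_of_update _ j (orderings_nonempty _)
    intro L _
    simp only [hQu, Function.update_self]
    have := sum_orderings_split_le (D j)
      (fun p L' => if Q j i L p ∧ FirstBad (bad j) (small j) ε p.toFinset L'
        then (1 : ℝ) else 0)
      (fun p _ => if Q j i L p then Real.exp (1 - ε * (p.toFinset.card + 1)) * r j p else 0)
      (fun p hp => sum_firstBad_le (bad j) (small j) hε ha1 (D j) (hself j hj) (hz j hj)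
        (Q j i L p) p.toFinset hp) i [] (by simp)
    simp only [List.toFinset_nil, Finset.sdiff_empty, List.nil_append] at this
    refine this.trans (le_of_eq (Finset.sum_congr rfl fun y hy => ?_))
    rw [List.toFinset_card_of_nodup ((mem_orderings.1 hy).1.sublist (List.take_sublist _ _)),
      List.length_take, length_of_mem_orderings hy, min_eq_left]
    exact (Finset.mem_range.1 hi).le.trans (hs j hj)
  -- Where `Q` holds for `j`, the ratio of `j` is its clean ratio, and a single instance of `Q`
  -- already bounds the sum of all clean ratios by `a ε`.
  have step3 : ∀ i ∈ Finset.range s, ∀ L ∈ Ω, ∑ j ∈ J, (if Q j i L ((L j).take i) then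
        Real.exp (1 - ε * ((i : ℝ) + 1)) * r j ((L j).take i) else 0) ≤
      Real.exp (1 - ε * ((i : ℝ) + 1)) * (a * ε) := by
    intro i _ L _
    have hrn : ∀ j p, 0 ≤ r j p := fun j p => badRatio_nonneg _ _ _
    have hQρ : ∀ j, Q j i L ((L j).take i) → ρ i L j = r j ((L j).take i) := by
      intro j hq
      simp only [hρ]
      have : cleanLength (bad j) i (L j) = i :=
        le_antisymm (Nat.findGreatest_le i) (Nat.le_findGreatest le_rfl hq.1)
      rw [this]
    by_cases hex : ∃ j ∈ J, Q j i L ((L j).take i)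
    · obtain ⟨j, hj, hq⟩ := hex
      have hsum : ∑ k ∈ J, ρ i L k < a * ε := by
        have := hq.2
        rw [← hQρ j hq, Finset.sum_erase_add _ _ hj] at this
        exact this
      calc _ ≤ ∑ k ∈ J, Real.exp (1 - ε * ((i : ℝ) + 1)) * ρ i L k := by
            apply Finset.sum_le_sum
            intro k _
            split_ifs with hk
            · rw [hQρ k hk]
            · exact mul_nonneg (Real.exp_pos _).le (hrn _ _)
        _ = Real.exp (1 - ε * ((i : ℝ) + 1)) * ∑ k ∈ J, ρ i L k := by rw [Finset.mul_sum]
        _ ≤ _ := mul_le_mul_of_nonneg_left hsum.le (Real.exp_pos _).le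
    · push Not at hex
      rw [Finset.sum_eq_zero fun j hj => if_neg (hex j hj)]
      positivity
  calc _ ≤ ∑ L ∈ Ω, ∑ i ∈ Finset.range s, ∑ j ∈ J,
        (if Q j i L ((L j).take i) ∧
          FirstBad (bad j) (small j) ε ((L j).take i).toFinset ((L j).drop i)
        then (1 : ℝ) else 0) := Finset.sum_le_sum step1
    _ = ∑ i ∈ Finset.range s, ∑ j ∈ J, ∑ L ∈ Ω,
        (if Q j i L ((L j).take i) ∧
          FirstBad (bad j) (small j) ε ((L j).take i).toFinset ((L j).drop i)
        then (1 : ℝ) else 0) := by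
        rw [Finset.sum_comm]
        exact Finset.sum_congr rfl fun i _ => Finset.sum_comm
    _ ≤ ∑ i ∈ Finset.range s, ∑ j ∈ J, ∑ L ∈ Ω, (if Q j i L ((L j).take i) then
        Real.exp (1 - ε * ((i : ℝ) + 1)) * r j ((L j).take i) else 0) :=
        Finset.sum_le_sum fun i hi => Finset.sum_le_sum fun j hj => step2 i hi j hj
    _ = ∑ i ∈ Finset.range s, ∑ L ∈ Ω, ∑ j ∈ J, (if Q j i L ((L j).take i) then
        Real.exp (1 - ε * ((i : ℝ) + 1)) * r j ((L j).take i) else 0) :=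
        Finset.sum_congr rfl fun i _ => Finset.sum_comm
    _ ≤ ∑ i ∈ Finset.range s, ∑ L ∈ Ω, Real.exp (1 - ε * ((i : ℝ) + 1)) * (a * ε) :=
        Finset.sum_le_sum fun i hi => Finset.sum_le_sum fun L hL => step3 i hi L hL
    _ = a * Real.exp 1 * Ω.card *
        ∑ i ∈ Finset.range s, ε * Real.exp (-(ε * ((i : ℝ) + 1))) := by
        rw [Finset.mul_sum]
        apply Finset.sum_congr rfl
        intro i _
        rw [Finset.sum_const, nsmul_eq_mul, sub_eq_add_neg, Real.exp_add]
        ring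
    _ ≤ a * Real.exp 1 * Ω.card * 1 :=
        mul_le_mul_of_nonneg_left (sum_exp_le ε s) (by positivity)
    _ = _ := mul_one _

end PIG
end

/-! ### Submodular gains, supports of uniform choices, and the loop of Update. -/

noncomputable section
namespace PIG

/-! ### Marginal gains of submodular functions -/

section Gain

variable {U : Type*} [DecidableEq U] {f : Finset U → ℝ}

theorem gain_of_subset {S A : Finset U} (h : S ⊆ A) : gain f S A = 0 := by
  rw [gain, Finset.union_eq_right.2 h, sub_self]

/-- Submodularity for `S ∪ B` and `A`; the condition on `S ∩ A` makes their intersection equal to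
`B`. -/
theorem Submodular.gain_anti (hf : Submodular f) {S A B : Finset U} (hBA : B ⊆ A)
    (hS : S ∩ A ⊆ B) : gain f S A ≤ gain f S B := by
  have h := hf (S ∪ B) A
  have h1 : S ∪ B ∪ A = S ∪ A := by
    rw [Finset.union_assoc, Finset.union_eq_right.2 hBA]
  have h2 : (S ∪ B) ∩ A = B := by
    ext x
    simp only [Finset.mem_inter, Finset.mem_union]
    constructor
    · rintro ⟨h1 | h1, h2⟩
      · exact hS (Finset.mem_inter.2 ⟨h1, h2⟩)
      · exact h1
    · intro h
      exact ⟨Or.inr h, hBA h⟩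
  rw [h1, h2] at h
  unfold gain
  linarith

theorem Submodular.gain_singleton_anti (hf : Submodular f) {x : U} {A B : Finset U} (hBA : B ⊆ A)
    (hx : x ∉ A) : gain f {x} A ≤ gain f {x} B := by
  apply hf.gain_anti hBA
  rw [Finset.singleton_inter_of_notMem hx]
  exact Finset.empty_subset _

/-- Positivity of `τ` covers the case `x ∈ A`, where the gain is zero and submodularity gives
nothing. -/
theorem Submodular.gain_lt_mono (hf : Submodular f) {x : U} {A B : Finset U} {τ : ℝ} (hτ : 0 < τ)
    (hBA : B ⊆ A) (h : gain f {x} B < τ) : gain f {x} A < τ := by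
  by_cases hx : x ∈ A
  · rwa [gain_of_subset (Finset.singleton_subset_iff.2 hx)]
  · exact (hf.gain_singleton_anti hBA hx).trans_lt h

theorem Submodular.gain_union_le (hf : Submodular f) {S T A : Finset U} (h : S ∩ T ⊆ A) :
    gain f (S ∪ T) A ≤ gain f S A + gain f T A := by
  have h0 := hf (S ∪ A) (T ∪ A)
  have h1 : S ∪ A ∪ (T ∪ A) = S ∪ T ∪ A := by
    ext x; simp only [Finset.mem_union]; tauto
  have h2 : (S ∪ A) ∩ (T ∪ A) = A := by
    rw [← Finset.inter_union_distrib_right, Finset.union_eq_right.2 h]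
  rw [h1, h2] at h0
  unfold gain
  linarith

theorem Submodular.gain_le_sum (hf : Submodular f) (S A : Finset U) :
    gain f S A ≤ ∑ x ∈ S, gain f {x} A := by
  induction S using Finset.induction_on with
  | empty => simp [gain]
  | insert x S hx ih =>
    rw [Finset.sum_insert hx, Finset.insert_eq]
    refine (hf.gain_union_le ?_).trans (by linarith)
    rw [Finset.singleton_inter_of_notMem hx]
    exact Finset.empty_subset _

theorem gain_sdiff (S A : Finset U) : gain f (S \ A) A = gain f S A := by
  rw [gain, gain, Finset.sdiff_union_self_eq_union]

theorem gain_singleton_le_maxGain {U : Type*} [Fintype U] [DecidableEq U] [Nonempty U]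
    (f : Finset U → ℝ) (x : U) : gain f {x} ∅ ≤ maxGain f :=
  Finset.le_sup' (fun x => gain f {x} ∅) (Finset.mem_univ x)

end Gain

/-! ### Uniform distributions -/

theorem mem_support_unif {α : Type*} [Nonempty α] {s : Finset α} (hs : s.Nonempty) {a : α} :
    a ∈ (unif s).support ↔ a ∈ s := by
  rw [unif, dif_pos hs, PMF.mem_support_uniformOfFinset_iff]

/-! ### The number of passes of Update -/

section Update

variable {U : Type*} [DecidableEq U] {f : Finset U → ℝ} {A W V : Finset U} {τ τmin ε : ℝ}

theorem exists_pow_mul_lt (hε : 0 < ε) (hmin : 0 < τmin) (τ : ℝ) :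
    ∃ k : ℕ, (1 - ε) ^ k * τ < τmin := by
  rcases le_or_gt τ 0 with h | h
  · exact ⟨0, by simpa using h.trans_lt hmin⟩
  · obtain ⟨k, hk⟩ := exists_pow_lt_of_lt_one (div_pos hmin h) (by linarith : 1 - ε < 1)
    exact ⟨k, (lt_div_iff₀ h).1 hk⟩

/-- The thresholds eventually fall below `τmin`, so the infimum is over a nonempty set and is
attained rather than being the default value `0`. -/
theorem updateSteps_spec (f : Finset U → ℝ) (A W V : Finset U) (τ : ℝ)
    (hε : 0 < ε) (hmin : 0 < τmin) :
    ¬ (updateSet f A W V τ ε (updateSteps f A W V τ τmin ε) = ∅ ∧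
      τmin ≤ (1 - ε) ^ (updateSteps f A W V τ τmin ε) * τ) := by
  obtain ⟨k, hk⟩ := exists_pow_mul_lt hε hmin τ
  have : k ∈ {k : ℕ | ¬ (updateSet f A W V τ ε k = ∅ ∧ τmin ≤ (1 - ε) ^ k * τ)} := by
    intro h
    linarith [h.2]
  exact Nat.sInf_mem ⟨k, this⟩

theorem of_lt_updateSteps {k : ℕ} (h : k < updateSteps f A W V τ τmin ε) :
    updateSet f A W V τ ε k = ∅ ∧ τmin ≤ (1 - ε) ^ k * τ := by
  have := Nat.notMem_of_lt_sInf h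
  simpa using this

theorem updateSet_subset (k : ℕ) : updateSet f A W V τ ε k ⊆ W := by
  unfold updateSet
  split_ifs
  · exact (Finset.filter_subset _ _).trans Finset.inter_subset_right
  · exact Finset.filter_subset _ _

theorem le_gain_of_mem_updateSet {k : ℕ} {x : U} (h : x ∈ updateSet f A W V τ ε k) :
    (1 - ε) ^ k * τ ≤ gain f {x} A := by
  unfold updateSet at h
  split_ifs at h with h0
  · subst h0
    simpa using (Finset.mem_filter.1 h).2
  · exact (Finset.mem_filter.1 h).2

/-- Before the first pass only `V` is filtered, not all of `W`; `hcover` guarantees that nothing is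
overlooked. -/
theorem mem_updateSet (hcover : ∀ x ∈ W, τ ≤ gain f {x} A → x ∈ V) {k : ℕ} {x : U} (hx : x ∈ W)
    (h : (1 - ε) ^ k * τ ≤ gain f {x} A) : x ∈ updateSet f A W V τ ε k := by
  unfold updateSet
  split_ifs with h0
  · subst h0
    have h' : τ ≤ gain f {x} A := by simpa using h
    exact Finset.mem_filter.2 ⟨Finset.mem_inter.2 ⟨hcover x hx h', hx⟩, h'⟩
  · exact Finset.mem_filter.2 ⟨hx, h⟩

/-- After Update with at least one pass, no gain exceeds the threshold by more than the factor
`1 / (1 - ε)`. -/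
theorem gain_le_of_updateSteps_pos (hε1 : ε < 1)
    (hcover : ∀ x ∈ W, τ ≤ gain f {x} A → x ∈ V)
    (hK : updateSteps f A W V τ τmin ε ≠ 0) {x : U} (hx : x ∈ W) :
    (1 - ε) * gain f {x} A ≤ (1 - ε) ^ (updateSteps f A W V τ τmin ε) * τ := by
  -- The candidate set was still empty before the last pass, so every gain lies below the preceding
  -- threshold, which is the final one divided by `1 - ε`.
  obtain ⟨k, hk⟩ := Nat.exists_eq_succ_of_ne_zero hK
  have h := (of_lt_updateSteps (f := f) (A := A) (W := W) (V := V) (τ := τ) (τmin := τmin)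
    (ε := ε) (k := k) (by omega)).1
  have h1 : gain f {x} A < (1 - ε) ^ k * τ := by
    by_contra hc
    have := mem_updateSet (ε := ε) hcover hx (not_lt.1 hc)
    rw [h] at this
    simp at this
  rw [hk, pow_succ']
  have : 0 < 1 - ε := by linarith
  nlinarith

theorem pow_updateSteps_mul_le (hε : 0 < ε) (hε1 : ε < 1) (hmin : 0 < τmin) :
    (1 - ε) ^ (updateSteps f A W V τ τmin ε) * τ ≤ τ := by
  rcases Nat.eq_zero_or_pos (updateSteps f A W V τ τmin ε) with h | h
  · rw [h]; simp
  · have h1 := (of_lt_updateSteps h).2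
    have h2 : 0 < τ := by
      have : τmin ≤ τ := by simpa using h1
      linarith
    have h3 : (1 - ε) ^ (updateSteps f A W V τ τmin ε) ≤ 1 :=
      pow_le_one₀ (by linarith) (by linarith)
    nlinarith

end Update

end PIG
end

/-! ### Marks, the three passes, and the value gained by a block. -/

noncomputable section
namespace PIG

/-! ### Marked lists -/

section Marks

variable {U : Type*} [DecidableEq U] {f : Finset U → ℝ}

/-- The mark of a single element. -/
def mark (f : Finset U → ℝ) (A : Finset U) (τ : ℝ) (v : U) : Option Bool :=
  if τ ≤ gain f {v} A then some true else if gain f {v} A < 0 then some false else none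

theorem mark_eq_true_iff {A : Finset U} {τ : ℝ} {v : U} :
    mark f A τ v = some true ↔ τ ≤ gain f {v} A := by
  unfold mark
  split_ifs <;> simp_all

theorem gain_neg_of_mark {A : Finset U} {τ : ℝ} {v : U} (h : mark f A τ v = some false) :
    gain f {v} A < 0 := by
  unfold mark at h
  split_ifs at h <;> simp_all

theorem gain_nonneg_of_mark {A : Finset U} {τ : ℝ} (hτ : 0 ≤ τ) {v : U}
    (h : mark f A τ v ≠ some false) : 0 ≤ gain f {v} A := by
  unfold mark at h
  split_ifs at h with h1 h2
  · exact hτ.trans h1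
  · simp at h
  · exact not_lt.1 h2

theorem marks_nil (A : Finset U) (τ : ℝ) : marks f A τ [] = [] := rfl

theorem marks_cons (A : Finset U) (τ : ℝ) (x : U) (L : List U) :
    marks f A τ (x :: L) = (x, mark f A τ x) :: marks f (A ∪ {x}) τ L := by
  unfold marks mark
  rw [List.mapIdx_cons]
  simp only [List.take_succ_cons, List.toFinset_cons, List.take_zero, List.toFinset_nil,
    Finset.union_empty, Finset.insert_eq, Finset.union_assoc]

theorem map_fst_marks (τ : ℝ) (L : List U) : ∀ A, (marks f A τ L).map Prod.fst = L := by
  induction L with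
  | nil => intro A; rfl
  | cons x L ih => intro A; rw [marks_cons, List.map_cons, ih]

theorem length_marks (A : Finset U) (τ : ℝ) (L : List U) : (marks f A τ L).length = L.length := by
  simp [marks]

theorem take_marks (τ : ℝ) (L : List U) : ∀ A i, (marks f A τ L).take i =
    marks f A τ (L.take i) := by
  induction L with
  | nil => intro A i; simp [marks_nil]
  | cons x L ih =>
    intro A i
    cases i with
    | zero => simp [marks_nil]
    | succ i => rw [marks_cons, List.take_succ_cons, List.take_succ_cons, marks_cons, ih]

/-- The elements marked false may be dropped in order, once all the others are present. -/
theorem le_of_take_false (hf : Submodular f) (τ : ℝ) (L : List U) :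
    ∀ (A B : Finset U) (k : ℕ), A ⊆ B →
      (∀ p ∈ marks f A τ L, p.2 ≠ some false → p.1 ∈ B) →
      f (B ∪ ((((marks f A τ L).filter fun p => p.2 = some false).take k).map
        Prod.fst).toFinset) ≤ f B := by
  induction L with
  | nil => intro A B k _ _; simp [marks_nil]
  | cons x L ih =>
    intro A B k hAB hB
    rw [marks_cons] at hB ⊢
    by_cases hx : mark f A τ x = some false
    · rw [List.filter_cons_of_pos (by simpa using hx)]
      cases k with
      | zero => simp
      | succ k =>
        have h1 := ih (A ∪ {x}) (B ∪ {x}) k (Finset.union_subset_union hAB subset_rfl)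
          (fun p hp hp' => Finset.mem_union_left _ (hB p (List.mem_cons_of_mem _ hp) hp'))
        have h2 : f (B ∪ {x}) ≤ f B := by
          by_cases hxB : x ∈ B
          · rw [Finset.union_eq_left.2 (Finset.singleton_subset_iff.2 hxB)]
          · have h3 := hf.gain_singleton_anti hAB hxB
            have h4 := gain_neg_of_mark hx
            rw [gain, Finset.union_comm] at h3
            linarith
        rw [List.take_succ_cons, List.map_cons, List.toFinset_cons, Finset.insert_eq,
          ← Finset.union_assoc]
        exact h1.trans h2
    · rw [List.filter_cons_of_neg (by simpa using hx)]
      have hxB : x ∈ B := hB (x, mark f A τ x) (by simp) hx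
      exact ih (A ∪ {x}) B k (Finset.union_subset hAB (Finset.singleton_subset_iff.2 hxB))
        (fun p hp hp' => hB p (List.mem_cons_of_mem _ hp) hp')

/-- The gain of a set of elements not marked false is at least `τ` for every element marked
true. -/
theorem mul_count_true_le (hf : Submodular f) {τ : ℝ} (hτ : 0 ≤ τ) (L : List U) :
    ∀ (A B X : Finset U), B ⊆ A → L.Nodup → (∀ x ∈ L, x ∉ A) → X ⊆ L.toFinset →
      (∀ p ∈ marks f A τ L, p.1 ∈ X → p.2 ≠ some false) →
      τ * ((marks f A τ L).countP fun p => p.2 = some true ∧ p.1 ∈ X : ℕ) ≤ f (B ∪ X) - f B := by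
  induction L with
  | nil =>
    intro A B X _ _ _ hX _
    have : X = ∅ := by simpa using hX
    subst this
    simp [marks_nil]
  | cons x L ih =>
    intro A B X hBA hnd hLA hX hm
    rw [List.nodup_cons] at hnd
    have hxA : x ∉ A := hLA x (by simp)
    have hL' : ∀ y ∈ L, y ∉ A ∪ {x} := by
      intro y hy h
      rcases Finset.mem_union.1 h with h | h
      · exact hLA y (by simp [hy]) h
      · rw [Finset.mem_singleton] at h
        exact hnd.1 (h ▸ hy)
    rw [marks_cons] at hm ⊢
    -- `A` absorbs every inspected element because marks refer to whole prefixes, while `B` absorbs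
    -- only the members of `X`. So `B ⊆ A` persists, and gains over `B` dominate the marked gains.
    by_cases hxX : x ∈ X
    · have h1 := ih (A ∪ {x}) (B ∪ {x}) (X.erase x) (Finset.union_subset_union hBA subset_rfl)
        hnd.2 hL' (by
          intro y hy
          have := hX (Finset.mem_of_mem_erase hy)
          rw [List.toFinset_cons, Finset.mem_insert] at this
          exact this.resolve_left (Finset.ne_of_mem_erase hy))
        (fun p hp hp' => hm p (List.mem_cons_of_mem _ hp) (Finset.mem_of_mem_erase hp'))
      have e : B ∪ {x} ∪ X.erase x = B ∪ X := by
        rw [Finset.union_assoc, ← Finset.insert_eq, Finset.insert_erase hxX]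
      rw [e] at h1
      have hmx : mark f A τ x ≠ some false := hm (x, mark f A τ x) (by simp) hxX
      have h2 : gain f {x} A ≤ f (B ∪ {x}) - f B := by
        rw [Finset.union_comm B]
        exact hf.gain_singleton_anti hBA hxA
      have h3 : ((marks f (A ∪ {x}) τ L).countP fun p => p.2 = some true ∧ p.1 ∈ X) =
          (marks f (A ∪ {x}) τ L).countP fun p => p.2 = some true ∧ p.1 ∈ X.erase x := by
        apply List.countP_congr
        intro p hp
        have hp1 : p.1 ∈ L := by
          rw [← map_fst_marks (f := f) τ L (A ∪ {x})]
          exact List.mem_map_of_mem hp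
        have : p.1 ≠ x := fun h => hnd.1 (h ▸ hp1)
        simp [this]
      rw [List.countP_cons, h3]
      by_cases ht : mark f A τ x = some true
      · have := mark_eq_true_iff.1 ht
        simp only [ht, hxX]
        push_cast
        simp only [and_self, decide_true, if_true]
        linarith
      · have := gain_nonneg_of_mark hτ hmx
        simp only [ht, false_and, decide_false, Bool.false_eq_true, if_false, add_zero]
        linarith
    · rw [List.countP_cons_of_neg (by simp [hxX])]
      refine ih (A ∪ {x}) B X (hBA.trans Finset.subset_union_left) hnd.2 hL' ?_
        (fun p hp hp' => hm p (List.mem_cons_of_mem _ hp) hp')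
      intro y hy
      have := hX hy
      rw [List.toFinset_cons, Finset.mem_insert] at this
      exact this.resolve_left fun h => hxX (h ▸ hy)

/-! ### The three passes -/

theorem perm_threePass {U : Type*} (P : List (U × Option Bool)) :
    (P.filter fun p => p.2 = some true) ++ (P.filter fun p => p.2 = none) ++
      (P.filter fun p => p.2 = some false) |>.Perm P := by
  induction P with
  | nil => simp
  | cons p P ih =>
    obtain ⟨v, b⟩ := p
    rcases b with - | b | b
    · rw [List.filter_cons_of_neg (by simp), List.filter_cons_of_pos (by simp),
        List.filter_cons_of_neg (by simp), List.append_assoc, List.cons_append]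
      refine List.perm_middle.trans ?_
      rw [List.append_assoc] at ih
      exact ih.cons _
    · rw [List.filter_cons_of_neg (by simp), List.filter_cons_of_neg (by simp),
        List.filter_cons_of_pos (by simp)]
      exact List.perm_middle.trans (ih.cons _)
    · rw [List.filter_cons_of_pos (by simp), List.filter_cons_of_neg (by simp),
        List.filter_cons_of_neg (by simp), List.cons_append, List.cons_append]
      exact ih.cons _

theorem length_threePass {U : Type*} {P : List (U × Option Bool)} {i : ℕ} (h : i ≤ P.length) :
    (threePass i P).length = i := by
  rw [threePass, List.length_take, (perm_threePass P).length_eq, min_eq_left h]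

theorem threePass_subset {U : Type*} (i : ℕ) (P : List (U × Option Bool)) : threePass i P ⊆ P := by
  intro p hp
  exact (perm_threePass P).subset (List.mem_of_mem_take hp)

theorem nodup_threePass {U : Type*} {P : List (U × Option Bool)} (h : (P.map Prod.fst).Nodup) (i : ℕ) :
    ((threePass i P).map Prod.fst).Nodup := by
  have h1 := ((perm_threePass P).map Prod.fst).nodup_iff.2 h
  exact h1.sublist ((List.take_sublist _ _).map _)

theorem threePass_length_perm {U : Type*} (P : List (U × Option Bool)) :
    (threePass P.length P).Perm P := by
  rw [threePass, List.take_of_length_le (perm_threePass P).length_eq.le]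
  exact perm_threePass P

/-- An initial part consisting of elements marked true is chosen. -/
theorem take_subset_threePass {U : Type*} {P : List (U × Option Bool)} {t i : ℕ} (hti : t ≤ i)
    (h : ∀ p ∈ P.take t, p.2 = some true) : P.take t ⊆ threePass i P := by
  have h1 : (P.filter fun p => p.2 = some true) =
      P.take t ++ ((P.drop t).filter fun p => p.2 = some true) := by
    conv_lhs => rw [← List.take_append_drop t P]
    rw [List.filter_append, List.filter_eq_self.2 (by simpa using h)]
  intro p hp
  rw [threePass, h1, List.append_assoc, List.append_assoc, List.take_append,
    List.take_of_length_le ((List.length_take_le _ _).trans hti)]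
  exact List.mem_append_left _ hp

/-- An element marked false is taken only after all the others are in, so each one, added in order,
lowers the value or is already present. -/
theorem le_of_threePass (hf : Submodular f) (A : Finset U) (τ : ℝ) (L : List U) (i : ℕ) :
    f (A ∪ ((threePass i (marks f A τ L)).map Prod.fst).toFinset) ≤
      f (A ∪ (((threePass i (marks f A τ L)).filter fun p => p.2 ≠ some false).map
        Prod.fst).toFinset) := by
  set P := marks f A τ L with hP
  set X := (P.filter fun p => p.2 = some true) ++ (P.filter fun p => p.2 = none) with hX
  have hXn : ∀ p ∈ X, p.2 ≠ some false := by
    intro p hp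
    rcases List.mem_append.1 hp with h | h
    · have := (List.mem_filter.1 h).2
      simp at this
      simp [this]
    · have := (List.mem_filter.1 h).2
      simp at this
      simp [this]
  have e : threePass i P = X.take i ++
      (P.filter fun p => p.2 = some false).take (i - X.length) := by
    rw [threePass, List.take_append]
  have hfil : (threePass i P).filter (fun p => p.2 ≠ some false) = X.take i := by
    rw [e, List.filter_append, List.filter_eq_self.2, List.filter_eq_nil_iff.2, List.append_nil]
    · intro p hp
      have := (List.mem_filter.1 (List.mem_of_mem_take hp)).2
      simpa using this
    · intro p hp
      simpa using hXn p (List.mem_of_mem_take hp)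
  rw [hfil, e]
  rcases le_or_gt i X.length with h | h
  · simp [Nat.sub_eq_zero_of_le h]
  · rw [List.take_of_length_le h.le, List.map_append, List.toFinset_append, ← Finset.union_assoc]
    apply le_of_take_false hf τ L A
    · exact Finset.subset_union_left
    · intro p hp hp'
      apply Finset.mem_union_right
      rw [List.mem_toFinset]
      apply List.mem_map_of_mem
      rcases hb : p.2 with - | b | b
      · exact List.mem_append_right _ (List.mem_filter.2 ⟨hp, by simp [hb]⟩)
      · exact absurd hb hp'
      · exact List.mem_append_left _ (List.mem_filter.2 ⟨hp, by simp [hb]⟩)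

/-- The first pass takes as many true marks as fit, each worth `τ`, and the other retained elements
do not lower the value. It is stated over a subset `B` of `A` so that it applies to `A_j'`. -/
theorem mul_min_count_le (hf : Submodular f) {τ : ℝ} (hτ : 0 ≤ τ) {A B : Finset U} (hBA : B ⊆ A)
    {L : List U} (hnd : L.Nodup) (hLA : ∀ x ∈ L, x ∉ A) (i : ℕ) :
    τ * (min i ((marks f A τ L).countP fun p => p.2 = some true) : ℕ) ≤
      f (B ∪ (((threePass i (marks f A τ L)).filter fun p => p.2 ≠ some false).map
        Prod.fst).toFinset) - f B := by
  set P := marks f A τ L with hP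
  set X := (((threePass i P).filter fun p => p.2 ≠ some false).map Prod.fst).toFinset with hX
  have hfst : P.map Prod.fst = L := map_fst_marks τ L A
  have hinj : ∀ p ∈ P, ∀ q ∈ P, p.1 = q.1 → p = q := by
    have : (P.map Prod.fst).Nodup := hfst ▸ hnd
    intro p hp q hq h
    exact List.inj_on_of_nodup_map this hp hq h
  have hmem : ∀ p ∈ P, p.1 ∈ X → p.2 ≠ some false := by
    intro p hp hpX
    rw [hX, List.mem_toFinset, List.mem_map] at hpX
    obtain ⟨q, hq, hqp⟩ := hpX
    rw [List.mem_filter] at hq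
    have := hinj q (threePass_subset _ _ hq.1) p hp hqp
    subst this
    simpa using hq.2
  have h1 := mul_count_true_le hf hτ L A B X hBA hnd hLA (by
    intro x hx
    rw [hX, List.mem_toFinset, List.mem_map] at hx
    obtain ⟨q, hq, rfl⟩ := hx
    rw [List.mem_toFinset, ← hfst]
    exact List.mem_map_of_mem (threePass_subset _ _ (List.mem_filter.1 hq).1)) hmem
  refine le_trans (mul_le_mul_of_nonneg_left ?_ hτ) h1
  norm_cast
  set T := (P.filter fun p => p.2 = some true) with hT
  have hlen : (T.take i).length = min i (P.countP fun p => p.2 = some true) := by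
    rw [List.length_take, hT, List.countP_eq_length_filter]
  rw [← hlen]
  have hsub : (T.take i).Sublist P := (List.take_sublist _ _).trans List.filter_sublist
  have hin : ∀ p ∈ T.take i, p ∈ threePass i P := by
    intro p hp
    rw [threePass, List.append_assoc, List.take_append]
    exact List.mem_append_left _ hp
  have : (T.take i).countP (fun p => p.2 = some true ∧ p.1 ∈ X) = (T.take i).length := by
    rw [List.countP_eq_length]
    intro p hp
    have hp2 : p.2 = some true := by
      simpa using (List.mem_filter.1 (List.mem_of_mem_take hp)).2
    have hpX : p.1 ∈ X := by
      rw [hX, List.mem_toFinset]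
      apply List.mem_map_of_mem
      exact List.mem_filter.2 ⟨hin p hp, by simp [hp2]⟩
    simp [hp2, hpX]
  rw [← this]
  exact hsub.countP_le

/-! ### Prefix-Selection -/

theorem prefixLength_le {U : Type*} (ε : ℝ) (s : ℕ) (P : List (U × Option Bool)) : prefixLength ε s P ≤ s :=
  Nat.findGreatest_le s

theorem prefixLength_spec {U : Type*} (ε : ℝ) (s : ℕ) (P : List (U × Option Bool)) :
    (1 - ε) * (prefixLength ε s P : ℝ) ≤
      (((P.take (prefixLength ε s P)).countP fun p => p.2 = some true : ℕ) : ℝ) :=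
  Nat.findGreatest_spec (P := fun i => (1 - ε) * (i : ℝ) ≤
    (((P.take i).countP fun p => p.2 = some true : ℕ) : ℝ)) (Nat.zero_le s) (by simp)

/-- The first element is judged over `A` alone and passes as a candidate. Hence every block step
lowers the budget, which gives termination. -/
theorem one_le_prefixLength {ε : ℝ} (hε : 0 < ε) {s : ℕ} (hs : 1 ≤ s) {A : Finset U} {τ : ℝ}
    {L : List U} (hL : L ≠ []) (h : ∀ x ∈ L, τ ≤ gain f {x} A) :
    1 ≤ prefixLength ε s (marks f A τ L) := by
  apply Nat.le_findGreatest hs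
  cases L with
  | nil => exact absurd rfl hL
  | cons x L =>
    rw [marks_cons, List.take_succ_cons, List.take_zero,
      mark_eq_true_iff.2 (h x (by simp))]
    simp [hε.le]

end Marks

end PIG
end

/-! ### Distribute, the invariants of a state, and a single turn. -/

noncomputable section
namespace PIG

/-! ### Distribute -/

/-- Here `k` counts the sets already chosen. As indices come in increasing order of `|V_j|`, those
sets occupy at most `k ⌊|V_j|/ℓ⌋` elements, and `(k + 1) ⌊|V_j|/ℓ⌋ ≤ |V_j|` leaves room for one
more. Thus `unif` is never applied to an empty family. -/
theorem distributeAux_support {U : Type*} [DecidableEq U] {ℓ : ℕ} (V : Fin ℓ → Finset U)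
    (js : List (Fin ℓ)) : ∀ (D₀ D : Fin ℓ → Finset U) (k : ℕ), js.Nodup →
      js.Pairwise (fun i j => (V i).card ≤ (V j).card) → k + js.length ≤ ℓ →
      (∀ j ∈ js, (Finset.univ.biUnion D₀).card ≤ k * ((V j).card / ℓ)) →
      (∀ j ∈ js, D₀ j = ∅) → (∀ i j, i ≠ j → Disjoint (D₀ i) (D₀ j)) →
      D ∈ (distributeAux V js D₀).support →
      (∀ j ∈ js, D j ⊆ V j ∧ (D j).card = (V j).card / ℓ) ∧ (∀ j, j ∉ js → D j = D₀ j) ∧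
        ∀ i j, i ≠ j → Disjoint (D i) (D j) := by
  induction js with
  | nil =>
    intro D₀ D k _ _ _ _ _ hdis hD
    rw [distributeAux, PMF.mem_support_pure_iff] at hD
    subst hD
    simpa using hdis
  | cons j js ih =>
    intro D₀ D k hnd hs hk hcard hemp hdis hD
    rw [distributeAux, PMF.mem_support_bind_iff] at hD
    obtain ⟨W, hW, hD⟩ := hD
    rw [List.nodup_cons] at hnd
    rw [List.pairwise_cons] at hs
    rw [List.length_cons] at hk
    have hpool : (V j).card / ℓ ≤ (V j \ Finset.univ.biUnion D₀).card := by
      have h1 := Finset.le_card_sdiff (Finset.univ.biUnion D₀) (V j)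
      have h2 := hcard j (by simp)
      have h3 : (k + 1) * ((V j).card / ℓ) ≤ (V j).card :=
        (Nat.mul_le_mul_right _ (by omega)).trans (Nat.mul_div_le _ _)
      rw [add_mul] at h3
      omega
    rw [mem_support_unif (Finset.powersetCard_nonempty.2 hpool), Finset.mem_powersetCard] at hW
    have hWV : W ⊆ V j := hW.1.trans Finset.sdiff_subset
    have hWdis : ∀ i, Disjoint W (D₀ i) := by
      intro i
      rw [Finset.disjoint_left]
      intro x hx hx'
      exact (Finset.mem_sdiff.1 (hW.1 hx)).2 (Finset.mem_biUnion.2 ⟨i, Finset.mem_univ _, hx'⟩)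
    have hbi : (Finset.univ.biUnion (Function.update D₀ j W)).card ≤
        (k + 1) * ((V j).card / ℓ) := by
      have : Finset.univ.biUnion (Function.update D₀ j W) ⊆ Finset.univ.biUnion D₀ ∪ W := by
        intro x hx
        obtain ⟨i, -, hi⟩ := Finset.mem_biUnion.1 hx
        by_cases hij : i = j
        · subst hij
          rw [Function.update_self] at hi
          exact Finset.mem_union_right _ hi
        · rw [Function.update_of_ne hij] at hi
          exact Finset.mem_union_left _ (Finset.mem_biUnion.2 ⟨i, Finset.mem_univ _, hi⟩)
      refine (Finset.card_le_card this).trans ((Finset.card_union_le _ _).trans ?_)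
      rw [hW.2, add_mul, one_mul]
      exact Nat.add_le_add_right (hcard j (by simp)) _
    obtain ⟨h1, h2, h3⟩ := ih (Function.update D₀ j W) D (k + 1) hnd.2 hs.2 (by omega)
      (fun i hi => hbi.trans (Nat.mul_le_mul_left _ (Nat.div_le_div_right (hs.1 i hi))))
      (fun i hi => by
        rw [Function.update_of_ne (ne_of_mem_of_not_mem hi hnd.1)]
        exact hemp i (by simp [hi]))
      (fun i i' hii' => by
        by_cases hi : i = j
        · subst hi
          rw [Function.update_self, Function.update_of_ne (Ne.symm hii')]
          exact hWdis i'
        · rw [Function.update_of_ne hi]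
          by_cases hi' : i' = j
          · subst hi'
            rw [Function.update_self]
            exact (hWdis i).symm
          · rw [Function.update_of_ne hi']
            exact hdis i i' hii') hD
    refine ⟨fun i hi => ?_, fun i hi => ?_, h3⟩
    · rcases List.mem_cons.1 hi with rfl | hi
      · rw [h2 i hnd.1, Function.update_self]
        exact ⟨hWV, hW.2⟩
      · exact h1 i hi
    · rw [List.mem_cons, not_or] at hi
      rw [h2 i hi.2, Function.update_of_ne hi.1]

theorem distribute_support {U : Type*} [DecidableEq U] {ℓ : ℕ} {V : Fin ℓ → Finset U}
    {I : Finset (Fin ℓ)} {D : Fin ℓ → Finset U} (hD : D ∈ (distribute V I).support) :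
    (∀ j ∈ I, D j ⊆ V j ∧ (D j).card = (V j).card / ℓ) ∧ (∀ j, j ∉ I → D j = ∅) ∧
      ∀ i j, i ≠ j → Disjoint (D i) (D j) := by
  have hperm := List.perm_insertionSort (fun i j => (V i).card ≤ (V j).card) I.sort
  have hmem : ∀ j, j ∈ (I.sort.insertionSort fun i j => (V i).card ≤ (V j).card) ↔ j ∈ I := by
    intro j
    rw [hperm.mem_iff, Finset.mem_sort]
  have hsorted : (I.sort.insertionSort fun i j => (V i).card ≤ (V j).card).Pairwise
      (fun i j => (V i).card ≤ (V j).card) := by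
    have : Std.Total (fun i j : Fin ℓ => (V i).card ≤ (V j).card) := ⟨fun i j => le_total _ _⟩
    have : IsTrans (Fin ℓ) (fun i j : Fin ℓ => (V i).card ≤ (V j).card) :=
      ⟨fun i j k h h' => le_trans h h'⟩
    exact List.pairwise_insertionSort _ _
  have hempty : (Finset.univ.biUnion fun _ : Fin ℓ => (∅ : Finset U)) = ∅ := by
    ext; simp
  have := distributeAux_support V _ (fun _ => ∅) D 0
    (hperm.nodup_iff.2 (Finset.sort_nodup _ _)) hsorted
    (by
      rw [zero_add, List.length_insertionSort, Finset.length_sort]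
      exact (Finset.card_le_univ I).trans (by simp))
    (fun j _ => by simp [hempty]) (fun j _ => rfl) (fun i j _ => by simp) hD
  simpa only [hmem] using this

/-! ### Invariants of the state -/

section Invariant

variable {U : Type*} [Fintype U] [DecidableEq U] {ℓ : ℕ}

/-- The invariants of the solutions, thresholds and candidate sets. -/
structure Core (f : Finset U → ℝ) (τmin ε : ℝ) (s : State U ℓ) : Prop where
  disj : ∀ i j, i ≠ j → Disjoint (s.A i) (s.A j)
  sub : ∀ l, s.A' l ⊆ s.A l
  mono : ∀ l, gain f (s.A l) ∅ ≤ gain f (s.A' l) ∅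
  frozen : ∀ l, l ∉ s.I → s.τ l < τmin
  cover : ∀ l, ∀ x ∈ s.outside, s.τ l ≤ gain f {x} (s.A l) → x ∈ s.V l
  thr : ∀ l, ∀ x ∈ s.outside, (1 - ε) * gain f {x} (s.A l) ≤ max (s.τ l) τmin
  val : ∀ l, (1 - ε) * ((s.A l).card * max (s.τ l) τmin) ≤ gain f (s.A' l) ∅

/-- The candidates of solution `j` are unused elements of large gain. -/
def Pending (f : Finset U → ℝ) (τmin : ℝ) (s : State U ℓ) (j : Fin ℓ) : Prop :=
  j ∈ s.I ∧ τmin ≤ s.τ j ∧ s.V j ⊆ s.outside ∧ ∀ x ∈ s.V j, s.τ j ≤ gain f {x} (s.A j)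

theorem mem_outside {s : State U ℓ} {x : U} : x ∈ s.outside ↔ ∀ l, x ∉ s.A l := by
  simp [State.outside]

variable {f : Finset U → ℝ} {τmin ε : ℝ} {s : State U ℓ}

theorem runUpdate_τ_le (hε : 0 < ε) (hε1 : ε < 1) (hmin : 0 < τmin) (J : Finset (Fin ℓ))
    (l : Fin ℓ) : (runUpdate f τmin ε J s).τ l ≤ s.τ l := by
  simp only [runUpdate]
  split_ifs
  · exact pow_updateSteps_mul_le hε hε1 hmin
  · exact le_rfl

/-- The solutions do not change. A pass was made only because no candidate met the previous
threshold, which gives `thr`; lowering thresholds only weakens `val`. -/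
theorem Core.runUpdate (hε : 0 < ε) (hε1 : ε < 1) (hmin : 0 < τmin) (h : Core f τmin ε s)
    {J : Finset (Fin ℓ)} (hJ : J ⊆ s.I) : Core f τmin ε (runUpdate f τmin ε J s) := by
  refine ⟨h.disj, h.sub, h.mono, ?_, ?_, ?_, ?_⟩
  · intro l hl
    have : l ∉ J := fun h' => hl (hJ h')
    simp only [PIG.runUpdate, this, if_false]
    exact h.frozen l hl
  · intro l x hx hτ
    simp only [PIG.runUpdate] at hτ ⊢
    split_ifs at hτ ⊢ with hl
    · exact mem_updateSet (h.cover l) hx hτ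
    · exact h.cover l x hx hτ
  · intro l x hx
    simp only [PIG.runUpdate]
    split_ifs with hl
    · by_cases hK : updateSteps f (s.A l) s.outside (s.V l) (s.τ l) τmin ε = 0
      · rw [hK, pow_zero, one_mul]
        exact h.thr l x hx
      · exact (gain_le_of_updateSteps_pos hε1 (h.cover l) hK hx).trans (le_max_left _ _)
    · exact h.thr l x hx
  · intro l
    refine le_trans ?_ (h.val l)
    apply mul_le_mul_of_nonneg_left _ (by linarith)
    apply mul_le_mul_of_nonneg_left _ (by positivity)
    exact max_le_max_right _ (runUpdate_τ_le hε hε1 hmin J l)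

theorem Core.restrict (h : Core f τmin ε s) {I' : Finset (Fin ℓ)}
    (hI : ∀ l, l ∉ I' → l ∈ s.I → s.τ l < τmin) : Core f τmin ε { s with I := I' } := by
  refine ⟨h.disj, h.sub, h.mono, ?_, h.cover, h.thr, h.val⟩
  intro l hl
  by_cases hl' : l ∈ s.I
  · exact hI l hl hl'
  · exact h.frozen l hl'

theorem runUpdate_V_nonempty (hε : 0 < ε) (hmin : 0 < τmin) {J : Finset (Fin ℓ)} {j : Fin ℓ}
    (hj : j ∈ J) (hτ : τmin ≤ (runUpdate f τmin ε J s).τ j) :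
    ((runUpdate f τmin ε J s).V j).Nonempty := by
  simp only [runUpdate, hj, if_true] at hτ ⊢
  rw [Finset.nonempty_iff_ne_empty]
  intro h
  exact updateSteps_spec f (s.A j) s.outside (s.V j) (s.τ j) hε hmin ⟨h, hτ⟩

theorem pending_runUpdate {J : Finset (Fin ℓ)} {j : Fin ℓ} (hjI : j ∈ s.I) (hj : j ∈ J)
    (hτ : τmin ≤ (runUpdate f τmin ε J s).τ j) : Pending f τmin (runUpdate f τmin ε J s) j := by
  refine ⟨hjI, hτ, ?_, ?_⟩
  · simp only [runUpdate, hj, if_true]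
    exact updateSet_subset _
  · intro x hx
    simp only [runUpdate, hj, if_true] at hx ⊢
    exact le_gain_of_mem_updateSet hx

theorem Core.refresh (hε : 0 < ε) (hε1 : ε < 1) (hmin : 0 < τmin) (h : Core f τmin ε s) :
    Core f τmin ε (refresh f τmin ε s) := by
  refine (h.runUpdate hε hε1 hmin subset_rfl).restrict ?_
  intro l hl hl'
  by_contra hc
  exact hl (Finset.mem_filter.2 ⟨hl', not_lt.1 hc⟩)

theorem pending_refresh {j : Fin ℓ} (hj : j ∈ (refresh f τmin ε s).I) :
    Pending f τmin (refresh f τmin ε s) j := by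
  have h := Finset.mem_filter.1 hj
  have := pending_runUpdate (f := f) (ε := ε) (s := s) h.1 h.1 h.2
  exact ⟨hj, this.2.1, this.2.2.1, this.2.2.2⟩

theorem refresh_I_subset : (refresh f τmin ε s).I ⊆ s.I := Finset.filter_subset _ _

/-! ### A turn -/

/-- The conditional Update at the beginning of a turn. -/
def turnUpdate (f : Finset U → ℝ) (τmin ε : ℝ) (j : Fin ℓ) (s : State U ℓ) : State U ℓ :=
  if s.V j = ∅ then runUpdate f τmin ε {j} s else s

/-- Add `x` to solution `j`. -/
def push (j : Fin ℓ) (x : U) (s : State U ℓ) : State U ℓ :=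
  { s with
    A := Function.update s.A j (insert x (s.A j))
    A' := Function.update s.A' j (insert x (s.A' j))
    V := fun l => (s.V l).erase x }

theorem turnUpdate_V_nonempty (hε : 0 < ε) (hmin : 0 < τmin) {j : Fin ℓ}
    (hτ : τmin ≤ (turnUpdate f τmin ε j s).τ j) : ((turnUpdate f τmin ε j s).V j).Nonempty := by
  unfold turnUpdate at hτ ⊢
  split_ifs at hτ ⊢ with h
  · exact runUpdate_V_nonempty hε hmin (Finset.mem_singleton_self j) hτ
  · exact Finset.nonempty_iff_ne_empty.2 h

theorem addOne_eq [Nonempty U] (f : Finset U → ℝ) (τmin ε : ℝ) (j : Fin ℓ) (s : State U ℓ) :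
    addOne f τmin ε j s = if (turnUpdate f τmin ε j s).τ j < τmin then
        PMF.pure { turnUpdate f τmin ε j s with I := (turnUpdate f τmin ε j s).I.erase j }
      else (unif ((turnUpdate f τmin ε j s).V j)).map fun x =>
        push j x (turnUpdate f τmin ε j s) := rfl

theorem mem_support_addOne [Nonempty U] (hε : 0 < ε) (hmin : 0 < τmin) {j : Fin ℓ}
    {t : State U ℓ} (ht : t ∈ (addOne f τmin ε j s).support) :
    ((turnUpdate f τmin ε j s).τ j < τmin ∧
      t = { turnUpdate f τmin ε j s with I := (turnUpdate f τmin ε j s).I.erase j }) ∨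
    (τmin ≤ (turnUpdate f τmin ε j s).τ j ∧ ∃ x ∈ (turnUpdate f τmin ε j s).V j,
      t = push j x (turnUpdate f τmin ε j s)) := by
  rw [addOne_eq] at ht
  split_ifs at ht with h
  · rw [PMF.mem_support_pure_iff] at ht
    exact Or.inl ⟨h, ht⟩
  · rw [PMF.mem_support_map_iff] at ht
    obtain ⟨x, hx, rfl⟩ := ht
    rw [mem_support_unif (turnUpdate_V_nonempty hε hmin (not_lt.1 h))] at hx
    exact Or.inr ⟨not_lt.1 h, x, hx, rfl⟩

theorem Core.turnUpdate (hε : 0 < ε) (hε1 : ε < 1) (hmin : 0 < τmin) (h : Core f τmin ε s)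
    {j : Fin ℓ} (hj : j ∈ s.I) : Core f τmin ε (turnUpdate f τmin ε j s) := by
  unfold PIG.turnUpdate
  split_ifs
  · exact h.runUpdate hε hε1 hmin (Finset.singleton_subset_iff.2 hj)
  · exact h

theorem turnUpdate_A (j : Fin ℓ) : (turnUpdate f τmin ε j s).A = s.A := by
  unfold turnUpdate; split_ifs <;> rfl

theorem turnUpdate_A' (j : Fin ℓ) : (turnUpdate f τmin ε j s).A' = s.A' := by
  unfold turnUpdate; split_ifs <;> rfl

theorem turnUpdate_I (j : Fin ℓ) : (turnUpdate f τmin ε j s).I = s.I := by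
  unfold turnUpdate; split_ifs <;> rfl

theorem turnUpdate_m₀ (j : Fin ℓ) : (turnUpdate f τmin ε j s).m₀ = s.m₀ := by
  unfold turnUpdate; split_ifs <;> rfl

theorem turnUpdate_outside (j : Fin ℓ) : (turnUpdate f τmin ε j s).outside = s.outside := by
  unfold State.outside; rw [turnUpdate_A]

theorem turnUpdate_τ_of_ne {j l : Fin ℓ} (h : l ≠ j) :
    (turnUpdate f τmin ε j s).τ l = s.τ l := by
  unfold turnUpdate
  split_ifs
  · simp [runUpdate, h]
  · rfl

theorem turnUpdate_V_of_ne {j l : Fin ℓ} (h : l ≠ j) :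
    (turnUpdate f τmin ε j s).V l = s.V l := by
  unfold turnUpdate
  split_ifs
  · simp [runUpdate, h]
  · rfl

theorem turnUpdate_τ_le (hε : 0 < ε) (hε1 : ε < 1) (hmin : 0 < τmin) (j l : Fin ℓ) :
    (turnUpdate f τmin ε j s).τ l ≤ s.τ l := by
  unfold turnUpdate
  split_ifs
  · exact runUpdate_τ_le hε hε1 hmin _ _
  · exact le_rfl

theorem Pending.turnUpdate {j : Fin ℓ} (h : Pending f τmin s j)
    (hτ : τmin ≤ (turnUpdate f τmin ε j s).τ j) :
    Pending f τmin (turnUpdate f τmin ε j s) j := by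
  unfold PIG.turnUpdate at hτ ⊢
  split_ifs at hτ ⊢
  · exact pending_runUpdate h.1 (Finset.mem_singleton_self j) hτ
  · exact h

theorem mem_outside_push {j : Fin ℓ} {x y : U} :
    y ∈ (push j x s).outside ↔ y ∈ s.outside ∧ y ≠ x := by
  simp only [mem_outside, push]
  constructor
  · intro h
    refine ⟨fun l => ?_, ?_⟩
    · have := h l
      by_cases hl : l = j
      · subst hl
        rw [Function.update_self, Finset.mem_insert, not_or] at this
        exact this.2
      · rwa [Function.update_of_ne hl] at this
    · have := h j
      rw [Function.update_self, Finset.mem_insert, not_or] at this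
      exact this.1
  · rintro ⟨h, hne⟩ l
    by_cases hl : l = j
    · subst hl
      rw [Function.update_self, Finset.mem_insert, not_or]
      exact ⟨hne, h l⟩
    · rw [Function.update_of_ne hl]
      exact h l

/-- The gain of `x` over `A_j` is at least `τ_j ≥ τmin`, and by submodularity so is its gain over
`A_j'`, which pays for the new element in `val`. Gains of unused elements only decrease. -/
theorem Core.push (hf : Submodular f) (hε : 0 < ε) (hε1 : ε < 1) (hmin : 0 < τmin)
    (h : Core f τmin ε s) {j : Fin ℓ} (hj : Pending f τmin s j) {x : U} (hx : x ∈ s.V j) :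
    Core f τmin ε (push j x s) := by
  have hxo : x ∈ s.outside := hj.2.2.1 hx
  have hxA : ∀ l, x ∉ s.A l := mem_outside.1 hxo
  have hgain : s.τ j ≤ gain f {x} (s.A j) := hj.2.2.2 x hx
  have hins : gain f {x} (s.A j) ≤ gain f (insert x (s.A' j)) ∅ - gain f (s.A' j) ∅ := by
    refine (hf.gain_singleton_anti (h.sub j) (hxA j)).trans (le_of_eq ?_)
    simp only [gain, Finset.union_empty, Finset.insert_eq]
    ring
  have hins2 : gain f (insert x (s.A j)) ∅ = gain f (s.A j) ∅ + gain f {x} (s.A j) := by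
    simp only [gain, Finset.union_empty, Finset.insert_eq]
    ring
  refine ⟨?_, ?_, ?_, h.frozen, ?_, ?_, ?_⟩
  · intro i k hik
    simp only [PIG.push]
    by_cases hi : i = j
    · subst hi
      rw [Function.update_self, Function.update_of_ne (Ne.symm hik), Finset.disjoint_insert_left]
      exact ⟨hxA k, h.disj _ _ hik⟩
    · rw [Function.update_of_ne hi]
      by_cases hk : k = j
      · subst hk
        rw [Function.update_self, Finset.disjoint_insert_right]
        exact ⟨hxA i, h.disj _ _ hik⟩
      · rw [Function.update_of_ne hk]
        exact h.disj _ _ hik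
  · intro l
    simp only [PIG.push]
    by_cases hl : l = j
    · subst hl
      rw [Function.update_self, Function.update_self]
      exact Finset.insert_subset_insert _ (h.sub l)
    · rw [Function.update_of_ne hl, Function.update_of_ne hl]
      exact h.sub l
  · intro l
    simp only [PIG.push]
    by_cases hl : l = j
    · subst hl
      rw [Function.update_self, Function.update_self]
      have := h.mono l
      linarith
    · rw [Function.update_of_ne hl, Function.update_of_ne hl]
      exact h.mono l
  · intro l y hy hτ
    rw [mem_outside_push] at hy
    simp only [PIG.push] at hτ ⊢
    refine Finset.mem_erase.2 ⟨hy.2, h.cover l y hy.1 ?_⟩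
    by_cases hl : l = j
    · subst hl
      rw [Function.update_self] at hτ
      refine hτ.trans (hf.gain_singleton_anti (Finset.subset_insert _ _) ?_)
      rw [Finset.mem_insert, not_or]
      exact ⟨hy.2, mem_outside.1 hy.1 l⟩
    · rwa [Function.update_of_ne hl] at hτ
  · intro l y hy
    rw [mem_outside_push] at hy
    refine le_trans ?_ (h.thr l y hy.1)
    apply mul_le_mul_of_nonneg_left _ (by linarith)
    simp only [PIG.push]
    by_cases hl : l = j
    · subst hl
      rw [Function.update_self]
      refine hf.gain_singleton_anti (Finset.subset_insert _ _) ?_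
      rw [Finset.mem_insert, not_or]
      exact ⟨hy.2, mem_outside.1 hy.1 l⟩
    · rw [Function.update_of_ne hl]
  · intro l
    simp only [PIG.push]
    by_cases hl : l = j
    · subst hl
      rw [Function.update_self, Function.update_self, Finset.card_insert_of_notMem (hxA l)]
      have h1 := h.val l
      have h2 : max (s.τ l) τmin = s.τ l := max_eq_left hj.2.1
      rw [h2] at h1 ⊢
      have h3 := hj.2.1
      push_cast
      nlinarith
    · rw [Function.update_of_ne hl, Function.update_of_ne hl]
      exact h.val l

end Invariant

end PIG
end

/-! ### What one iteration does, by turns or by blocks. -/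

noncomputable section
namespace PIG

section Iteration

variable {U : Type*} [Fintype U] [DecidableEq U] {ℓ : ℕ}
variable {f : Finset U → ℝ} {τmin ε : ℝ} {s t : State U ℓ}

/-! ### The effect of a sequence of turns -/

/-- What the turns of the solutions in the list `js` do to the state. -/
structure Turns (f : Finset U → ℝ) (τmin ε : ℝ) (js : List (Fin ℓ)) (s t : State U ℓ) : Prop where
  core : Core f τmin ε t
  budget : t.m₀ = s.m₀
  I_sub : t.I ⊆ s.I
  τ_le : ∀ l, t.τ l ≤ s.τ l
  A_sub : ∀ l, s.A l ⊆ t.A l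
  new : ∀ l, t.A l \ s.A l ⊆ s.outside
  other : ∀ l, l ∉ js → t.A l = s.A l ∧ t.A' l = s.A' l ∧ t.τ l = s.τ l ∧ (l ∈ t.I ↔ l ∈ s.I)
  idle : ∀ l ∈ js, l ∉ t.I → t.A l = s.A l ∧ t.A' l = s.A' l
  active : ∀ l ∈ js, l ∈ t.I → τmin ≤ t.τ l ∧ (t.A l).card = (s.A l).card + 1 ∧
    gain f (s.A' l) ∅ + t.τ l ≤ gain f (t.A' l) ∅
  charge : ∀ l ∈ js, ∀ x ∈ s.outside, (∀ k ∈ js, k < l → x ∉ t.A k) →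
    (1 - ε) * gain f {x} (s.A l) ≤ max (t.τ l) τmin

/-- The second conclusion keeps the later turns valid: `x` is deleted from every `V_l`, while `A_l`
and `τ_l` are untouched for `l ≠ j`. -/
theorem turns_addOne [Nonempty U] (hf : Submodular f) (hε : 0 < ε) (hε1 : ε < 1)
    (hmin : 0 < τmin) (hs : Core f τmin ε s) {j : Fin ℓ} (hj : Pending f τmin s j)
    (ht : t ∈ (addOne f τmin ε j s).support) :
    Turns f τmin ε [j] s t ∧ ∀ l, l ≠ j → Pending f τmin s l → Pending f τmin t l := by
  have hc := hs.turnUpdate hε hε1 hmin hj.1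
  have hthr : ∀ x ∈ s.outside, (1 - ε) * gain f {x} (s.A j) ≤
      max ((turnUpdate f τmin ε j s).τ j) τmin := by
    intro x hx
    have := hc.thr j x (by rwa [turnUpdate_outside])
    rwa [turnUpdate_A] at this
  rcases mem_support_addOne hε hmin ht with ⟨hτ, rfl⟩ | ⟨hτ, x, hx, rfl⟩
  · refine ⟨⟨hc.restrict ?_, turnUpdate_m₀ j, ?_, turnUpdate_τ_le hε hε1 hmin j, ?_, ?_, ?_, ?_,
      ?_, ?_⟩, ?_⟩
    · intro l hl hl'
      have : l = j := by
        by_contra hne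
        exact hl (Finset.mem_erase.2 ⟨hne, hl'⟩)
      rwa [this]
    · simp only [turnUpdate_I]
      exact Finset.erase_subset _ _
    · intro l
      simp only [turnUpdate_A]
      exact subset_rfl
    · intro l
      simp [turnUpdate_A]
    · intro l hl
      rw [List.mem_singleton] at hl
      simp only [turnUpdate_A, turnUpdate_A', turnUpdate_τ_of_ne hl, turnUpdate_I,
        Finset.mem_erase]
      simp [hl]
    · intro l _ _
      simp [turnUpdate_A, turnUpdate_A']
    · intro l hl hl'
      rw [List.mem_singleton] at hl
      subst hl
      simp at hl'
    · intro l hl x hx _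
      rw [List.mem_singleton] at hl
      subst hl
      exact hthr x hx
    · intro l hl hp
      refine ⟨?_, ?_, ?_, ?_⟩
      · simp only [turnUpdate_I]
        exact Finset.mem_erase.2 ⟨hl, hp.1⟩
      · simp only [turnUpdate_τ_of_ne hl]
        exact hp.2.1
      · simp only [turnUpdate_V_of_ne hl]
        refine hp.2.2.1.trans (le_of_eq ?_)
        exact (turnUpdate_outside (f := f) (τmin := τmin) (ε := ε) (s := s) j).symm
      · simp only [turnUpdate_V_of_ne hl, turnUpdate_τ_of_ne hl, turnUpdate_A]
        exact hp.2.2.2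
  · have hp := hj.turnUpdate hτ
    have hxo := hp.2.2.1 hx
    have hxo' : x ∈ s.outside := by rwa [turnUpdate_outside] at hxo
    have hxA := mem_outside.1 hxo'
    have hA : (push j x (turnUpdate f τmin ε j s)).A =
        Function.update s.A j (insert x (s.A j)) := by
      simp only [push, turnUpdate_A]
    have hA' : (push j x (turnUpdate f τmin ε j s)).A' =
        Function.update s.A' j (insert x (s.A' j)) := by
      simp only [push, turnUpdate_A']
    refine ⟨⟨hc.push hf hε hε1 hmin hp hx, turnUpdate_m₀ j, ?_,
      turnUpdate_τ_le hε hε1 hmin j, ?_, ?_, ?_, ?_, ?_, ?_⟩, ?_⟩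
    · simp only [push, turnUpdate_I]
      exact subset_rfl
    · intro l
      rw [hA]
      by_cases hl : l = j
      · subst hl
        rw [Function.update_self]
        exact Finset.subset_insert _ _
      · rw [Function.update_of_ne hl]
    · intro l y hy
      rw [hA, Finset.mem_sdiff] at hy
      by_cases hl : l = j
      · subst hl
        rw [Function.update_self, Finset.mem_insert] at hy
        rcases hy.1 with rfl | h
        · exact hxo'
        · exact absurd h hy.2
      · rw [Function.update_of_ne hl] at hy
        exact absurd hy.1 hy.2
    · intro l hl
      rw [List.mem_singleton] at hl
      rw [hA, hA', Function.update_of_ne hl, Function.update_of_ne hl]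
      simp [push, turnUpdate_τ_of_ne hl, turnUpdate_I]
    · intro l hl hl'
      rw [List.mem_singleton] at hl
      subst hl
      exact absurd hp.1 hl'
    · intro l hl _
      rw [List.mem_singleton] at hl
      subst hl
      refine ⟨hτ, ?_, ?_⟩
      · rw [hA, Function.update_self, Finset.card_insert_of_notMem (hxA l)]
      · rw [hA', Function.update_self]
        have h1 := hp.2.2.2 x hx
        rw [turnUpdate_A] at h1
        have h2 := hf.gain_singleton_anti (hs.sub l) (hxA l)
        have h3 : gain f (insert x (s.A' l)) ∅ = gain f (s.A' l) ∅ + gain f {x} (s.A' l) := by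
          simp only [gain, Finset.union_empty, Finset.insert_eq]
          ring
        simp only [push]
        linarith
    · intro l hl y hy _
      rw [List.mem_singleton] at hl
      subst hl
      exact hthr y hy
    · intro l hl hpl
      have hτl : (push j x (turnUpdate f τmin ε j s)).τ l = s.τ l := turnUpdate_τ_of_ne hl
      have hVl : (push j x (turnUpdate f τmin ε j s)).V l = (s.V l).erase x := by
        simp only [push, turnUpdate_V_of_ne hl]
      refine ⟨?_, ?_, ?_, ?_⟩
      · simp only [push, turnUpdate_I]
        exact hpl.1
      · rw [hτl]
        exact hpl.2.1
      · rw [hVl]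
        intro y hy
        rw [mem_outside_push, turnUpdate_outside]
        exact ⟨hpl.2.2.1 (Finset.mem_of_mem_erase hy), Finset.ne_of_mem_erase hy⟩
      · rw [hVl, hτl, hA, Function.update_of_ne hl]
        intro y hy
        exact hpl.2.2.2 y (Finset.mem_of_mem_erase hy)

theorem outside_subset_of_A_sub (h : ∀ l, s.A l ⊆ t.A l) : t.outside ⊆ s.outside := by
  intro x hx
  rw [mem_outside] at hx ⊢
  exact fun l hl => hx l (h l hl)

/-- For `charge`, an element that escapes the earlier solutions is still unused at the turn of `l`,
so it obeys the threshold of `l` after that turn. Elements taken by earlier solutions obey only the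
older threshold. -/
theorem turns_addInTurn [Nonempty U] (hf : Submodular f) (hε : 0 < ε) (hε1 : ε < 1)
    (hmin : 0 < τmin) (js : List (Fin ℓ)) : ∀ (s t : State U ℓ), js.Pairwise (· < ·) →
      Core f τmin ε s → (∀ j ∈ js, Pending f τmin s j) →
      t ∈ (addInTurn f τmin ε js s).support → Turns f τmin ε js s t := by
  induction js with
  | nil =>
    intro s t _ hs _ ht
    rw [addInTurn, PMF.mem_support_pure_iff] at ht
    subst ht
    exact ⟨hs, rfl, subset_rfl, fun _ => le_rfl, fun _ => subset_rfl, fun _ => by simp,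
      fun l _ => ⟨rfl, rfl, rfl, Iff.rfl⟩, by simp, by simp, by simp⟩
  | cons j js ih =>
    intro s t hsort hs hp ht
    rw [addInTurn, PMF.mem_support_bind_iff] at ht
    obtain ⟨u, hu, ht⟩ := ht
    rw [List.pairwise_cons] at hsort
    have hjs : j ∉ js := fun h => lt_irrefl _ (hsort.1 j h)
    obtain ⟨h1, hpu⟩ := turns_addOne hf hε hε1 hmin hs (hp j (by simp)) hu
    have h2 := ih u t hsort.2 h1.core
      (fun k hk => hpu k (ne_of_mem_of_not_mem hk hjs) (hp k (by simp [hk]))) ht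
    have hother : ∀ l, l ≠ j → u.A l = s.A l ∧ u.A' l = s.A' l ∧ u.τ l = s.τ l ∧
        (l ∈ u.I ↔ l ∈ s.I) := fun l hl => h1.other l (by simpa using hl)
    refine ⟨h2.core, h2.budget.trans h1.budget, h2.I_sub.trans h1.I_sub,
      fun l => (h2.τ_le l).trans (h1.τ_le l), fun l => (h1.A_sub l).trans (h2.A_sub l),
      ?_, ?_, ?_, ?_, ?_⟩
    · intro l x hx
      rw [Finset.mem_sdiff] at hx
      by_cases hxu : x ∈ u.A l
      · exact h1.new l (Finset.mem_sdiff.2 ⟨hxu, hx.2⟩)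
      · exact outside_subset_of_A_sub h1.A_sub (h2.new l (Finset.mem_sdiff.2 ⟨hx.1, hxu⟩))
    · intro l hl
      rw [List.mem_cons, not_or] at hl
      obtain ⟨a1, a2, a3, a4⟩ := hother l hl.1
      obtain ⟨b1, b2, b3, b4⟩ := h2.other l hl.2
      exact ⟨b1.trans a1, b2.trans a2, b3.trans a3, b4.trans a4⟩
    · intro l hl hlt
      rcases List.mem_cons.1 hl with rfl | hl
      · obtain ⟨b1, b2, b3, b4⟩ := h2.other l hjs
        obtain ⟨a1, a2⟩ := h1.idle l (by simp) (fun h => hlt (b4.2 h))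
        exact ⟨b1.trans a1, b2.trans a2⟩
      · obtain ⟨a1, a2, -, -⟩ := hother l (ne_of_mem_of_not_mem hl hjs)
        obtain ⟨b1, b2⟩ := h2.idle l hl hlt
        exact ⟨b1.trans a1, b2.trans a2⟩
    · intro l hl hlt
      rcases List.mem_cons.1 hl with rfl | hl
      · obtain ⟨b1, b2, b3, b4⟩ := h2.other l hjs
        rw [b1, b2, b3]
        exact h1.active l (by simp) (b4.1 hlt)
      · obtain ⟨a1, a2, -, -⟩ := hother l (ne_of_mem_of_not_mem hl hjs)
        rw [← a1, ← a2]
        exact h2.active l hl hlt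
    · intro l hl x hx hk
      rcases List.mem_cons.1 hl with rfl | hl
      · rw [(h2.other l hjs).2.2.1]
        refine h1.charge l (by simp) x hx ?_
        intro k hk' hkl
        rw [List.mem_singleton] at hk'
        subst hk'
        exact absurd hkl (lt_irrefl _)
      · have hlj : l ≠ j := ne_of_mem_of_not_mem hl hjs
        rw [← (hother l hlj).1]
        refine h2.charge l hl x ?_ fun k hk' hkl => hk k (by simp [hk']) hkl
        have hxt : x ∉ t.A j := hk j (by simp) (hsort.1 l hl)
        rw [mem_outside] at hx ⊢
        intro k
        by_cases hkj : k = j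
        · subst hkj
          exact fun h => hxt (h2.A_sub k h)
        · rw [(hother k hkj).1]
          exact hx k

/-! ### The effect of an iteration -/

/-- What an iteration does to the solutions and thresholds, after its first phase; `w` is the
number of elements added to each active solution. -/
structure Extends (f : Finset U → ℝ) (τmin ε : ℝ) (w : ℕ) (s t : State U ℓ) : Prop where
  core : Core f τmin ε t
  pos : 1 ≤ w
  budget : t.m₀ + w = s.m₀
  I_sub : t.I ⊆ s.I
  threshold : ∀ l ∈ t.I, τmin ≤ t.τ l
  τ_le : ∀ l, t.τ l ≤ s.τ l
  A_sub : ∀ l, s.A l ⊆ t.A l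
  new : ∀ l, t.A l \ s.A l ⊆ s.outside
  card : ∀ l ∈ t.I, (t.A l).card = (s.A l).card + w
  idle : ∀ l, l ∉ t.I → t.A l = s.A l ∧ t.A' l = s.A' l
  val : ∀ l ∈ t.I, gain f (s.A' l) ∅ + (1 - ε) * (w * t.τ l) ≤ gain f (t.A' l) ∅
  charge : (∀ l, ∀ x ∈ s.outside, (1 - ε) * gain f {x} (s.A l) ≤ max (t.τ l) τmin) ∨
    (w = 1 ∧ ∀ l, ∀ x ∈ s.outside, (∀ k, k < l → x ∉ t.A k) →
      (1 - ε) * gain f {x} (s.A l) ≤ max (t.τ l) τmin)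

theorem extends_of_turns (hε : 0 < ε) (hmin : 0 < τmin) (hm : s.m₀ ≠ 0)
    (hs : Core f τmin ε s) (h : Turns f τmin ε s.I.sort s t) :
    Extends f τmin ε 1 s { t with m₀ := t.m₀ - 1 } := by
  have hmem : ∀ l, l ∈ s.I.sort ↔ l ∈ s.I := fun l => Finset.mem_sort _
  refine ⟨⟨h.core.disj, h.core.sub, h.core.mono, h.core.frozen, h.core.cover, h.core.thr,
    h.core.val⟩, le_rfl, ?_, h.I_sub, ?_, h.τ_le, h.A_sub, h.new, ?_, ?_, ?_, Or.inr ⟨rfl, ?_⟩⟩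
  · have := h.budget
    simp only
    omega
  · intro l hl
    exact (h.active l ((hmem l).2 (h.I_sub hl)) hl).1
  · intro l hl
    exact (h.active l ((hmem l).2 (h.I_sub hl)) hl).2.1
  · intro l hl
    by_cases hl' : l ∈ s.I
    · exact h.idle l ((hmem l).2 hl') hl
    · have := h.other l (fun h' => hl' ((hmem l).1 h'))
      exact ⟨this.1, this.2.1⟩
  · intro l hl
    obtain ⟨h1, -, h2⟩ := h.active l ((hmem l).2 (h.I_sub hl)) hl
    simp only [Nat.cast_one, one_mul]
    have h1' : τmin ≤ t.τ l := h1
    have : 0 ≤ ε * t.τ l := mul_nonneg hε.le (by linarith)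
    linarith
  · intro l x hx hk
    by_cases hl' : l ∈ s.I
    · exact h.charge l ((hmem l).2 hl') x hx fun k _ hkl => hk k hkl
    · rw [show t.τ l = s.τ l from (h.other l (fun h' => hl' ((hmem l).1 h'))).2.2.1]
      exact hs.thr l x hx

/-! ### The effect of adding blocks -/

/-- The number of elements of each block that are inspected. -/
def blockSize (s : State U ℓ) (h : s.I.Nonempty) (D : Fin ℓ → Finset U) : ℕ :=
  min s.m₀ (s.I.inf' h fun l => (D l).card)

/-- The marked elements that are inspected. -/
def blockMarks (f : Finset U → ℝ) (s : State U ℓ) (size : ℕ) (L : Fin ℓ → List U) (j : Fin ℓ) :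
    List (U × Option Bool) :=
  marks f (s.A j) (s.τ j) ((L j).take size)

/-- The common length of the blocks. -/
def blockLength (f : Finset U → ℝ) (ε : ℝ) (s : State U ℓ) (h : s.I.Nonempty) (size : ℕ)
    (L : Fin ℓ → List U) : ℕ :=
  s.I.inf' h fun j => prefixLength ε size (blockMarks f s size L j)

/-- The block of marked elements that is added to solution `j`. -/
def block (f : Finset U → ℝ) (ε : ℝ) (s : State U ℓ) (h : s.I.Nonempty) (size : ℕ)
    (L : Fin ℓ → List U) (j : Fin ℓ) : List (U × Option Bool) :=
  threePass (blockLength f ε s h size L)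
    ((blockMarks f s size L j).take (prefixLength ε size (blockMarks f s size L j)))

/-- The state after the blocks are added, when the blocks are taken from the lists `L`. -/
def blockStep (f : Finset U → ℝ) (ε : ℝ) (s : State U ℓ) (h : s.I.Nonempty) (size : ℕ)
    (L : Fin ℓ → List U) : State U ℓ :=
  { s with
    A := fun j => if j ∈ s.I then
      s.A j ∪ ((block f ε s h size L j).map Prod.fst).toFinset else s.A j
    A' := fun j => if j ∈ s.I then
        s.A' j ∪ (((block f ε s h size L j).filter fun p => p.2 ≠ some false).map
          Prod.fst).toFinset
      else s.A' j
    m₀ := s.m₀ - blockLength f ε s h size L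
    log := s.log ++ [∑ j ∈ s.I, prefixQueries (s.A j) (L j) size] }

theorem addBlocks_eq {U : Type*} [DecidableEq U] (f : Finset U → ℝ) (ε : ℝ) (s : State U ℓ) (h : s.I.Nonempty) :
    addBlocks f ε s h = (distribute s.V s.I).bind fun D =>
      (unif (Fintype.piFinset fun j => orderings (D j))).map
        (blockStep f ε s h (blockSize s h D)) := rfl

/-- Thresholds do not move when blocks are added, so `thr` before the step is the stronger form of
`charge`. -/
theorem extends_blockStep (hf : Submodular f) (hε : 0 < ε) (hε1 : ε < 1) (hmin : 0 < τmin)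
    (hs : Core f τmin ε s) (hp : ∀ j ∈ s.I, Pending f τmin s j)
    (h : s.I.Nonempty) {size : ℕ} (hsize : 1 ≤ size) (hsm : size ≤ s.m₀) {L : Fin ℓ → List U}
    (hnd : ∀ j ∈ s.I, (L j).Nodup) (hLV : ∀ j ∈ s.I, (L j).toFinset ⊆ s.V j)
    (hlen : ∀ j ∈ s.I, size ≤ (L j).length)
    (hdis : ∀ i ∈ s.I, ∀ j ∈ s.I, i ≠ j → Disjoint (L i).toFinset (L j).toFinset) :
    Extends f τmin ε (blockLength f ε s h size L) s (blockStep f ε s h size L) := by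
  set w := blockLength f ε s h size L with hw
  have hη : 0 ≤ 1 - ε := by linarith
  set q : Fin ℓ → ℕ := fun j => prefixLength ε size (blockMarks f s size L j) with hq
  have hwq : ∀ j ∈ s.I, w ≤ q j := fun j hj => Finset.inf'_le _ hj
  have hqs : ∀ j, q j ≤ size := fun j => prefixLength_le _ _ _
  have hw1 : 1 ≤ w := by
    rw [hw, blockLength, Finset.le_inf'_iff]
    intro j hj
    apply one_le_prefixLength hε hsize
    · intro h0
      have := congrArg List.length h0
      rw [List.length_take, List.length_nil] at this
      have := hlen j hj
      omega
    · intro x hx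
      exact (hp j hj).2.2.2 x (hLV j hj (List.mem_toFinset.2 (List.mem_of_mem_take hx)))
  have hwm : w ≤ s.m₀ := by
    obtain ⟨j, hj⟩ := h
    exact (hwq j hj).trans ((hqs j).trans hsm)
  set P : Fin ℓ → List (U × Option Bool) := fun j => (blockMarks f s size L j).take (q j) with hP
  have hPm : ∀ j, P j = marks f (s.A j) (s.τ j) (((L j).take size).take (q j)) := fun j =>
    take_marks _ _ _ _
  have hPfst : ∀ j, (P j).map Prod.fst = ((L j).take size).take (q j) := by
    intro j
    rw [hPm, map_fst_marks]
  have hPlen : ∀ j ∈ s.I, (P j).length = q j := by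
    intro j hj
    have h1 := hlen j hj
    have h2 := hqs j
    rw [hPm, length_marks, List.length_take, List.length_take]
    omega
  have hPnd : ∀ j ∈ s.I, (((L j).take size).take (q j)).Nodup := fun j hj =>
    (hnd j hj).sublist ((List.take_sublist _ _).trans (List.take_sublist _ _))
  set S : Fin ℓ → Finset U := fun j => ((block f ε s h size L j).map Prod.fst).toFinset with hS
  set S' : Fin ℓ → Finset U := fun j =>
    (((block f ε s h size L j).filter fun p => p.2 ≠ some false).map Prod.fst).toFinset with hS'
  have hSL : ∀ j, S j ⊆ (L j).toFinset := by
    intro j x hx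
    rw [hS, List.mem_toFinset, List.mem_map] at hx
    obtain ⟨p, hp, rfl⟩ := hx
    have h1 : p ∈ P j := threePass_subset _ _ hp
    have h2 : p.1 ∈ (P j).map Prod.fst := List.mem_map_of_mem h1
    rw [hPfst] at h2
    exact List.mem_toFinset.2 (List.mem_of_mem_take (List.mem_of_mem_take h2))
  have hS'S : ∀ j, S' j ⊆ S j := by
    intro j x hx
    rw [hS', List.mem_toFinset, List.mem_map] at hx
    obtain ⟨p, hp, rfl⟩ := hx
    exact List.mem_toFinset.2 (List.mem_map_of_mem (List.mem_filter.1 hp).1)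
  have hSo : ∀ j ∈ s.I, S j ⊆ s.outside := fun j hj =>
    (hSL j).trans ((hLV j hj).trans (hp j hj).2.2.1)
  have hSA : ∀ j ∈ s.I, ∀ l, Disjoint (S j) (s.A l) := by
    intro j hj l
    rw [Finset.disjoint_left]
    exact fun x hx => mem_outside.1 (hSo j hj hx) l
  have hScard : ∀ j ∈ s.I, (S j).card = w := by
    intro j hj
    rw [hS, List.toFinset_card_of_nodup, List.length_map]
    · exact length_threePass ((hwq j hj).trans (hPlen j hj).ge)
    · apply nodup_threePass
      rw [show (blockMarks f s size L j).take (prefixLength ε size (blockMarks f s size L j)) = P j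
        from rfl, hPfst]
      exact hPnd j hj
  have hSdis : ∀ i ∈ s.I, ∀ j ∈ s.I, i ≠ j → Disjoint (S i) (S j) := fun i hi j hj hij =>
    Finset.disjoint_of_subset_left (hSL i) (Finset.disjoint_of_subset_right (hSL j)
      (hdis i hi j hj hij))
  have hSS' : ∀ j, f (s.A j ∪ S j) ≤ f (s.A j ∪ S' j) := by
    intro j
    have := le_of_threePass hf (s.A j) (s.τ j) (((L j).take size).take (q j)) w
    rw [← hPm] at this
    exact this
  have hτ : ∀ j ∈ s.I, 0 ≤ s.τ j := fun j hj => hmin.le.trans (hp j hj).2.1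
  have hval : ∀ j ∈ s.I, (1 - ε) * (w * s.τ j) ≤ f (s.A' j ∪ S' j) - f (s.A' j) := by
    intro j hj
    have h1 := mul_min_count_le hf (hτ j hj) (hs.sub j) (hPnd j hj) (fun x hx =>
      mem_outside.1 ((hLV j hj).trans (hp j hj).2.2.1
        (List.mem_toFinset.2 (List.mem_of_mem_take (List.mem_of_mem_take hx)))) j) w
    rw [← hPm] at h1
    refine le_trans ?_ h1
    have h2 := prefixLength_spec ε size (blockMarks f s size L j)
    -- The prefix of length `q j ≥ w` has at least `(1 - ε) * q j` true marks, even when `w` is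
    -- smaller than `q j`.
    have h3 : (1 - ε) * (w : ℝ) ≤ (min w ((P j).countP fun p => p.2 = some true) : ℕ) := by
      rw [Nat.cast_min, le_min_iff]
      constructor
      · have : (0 : ℝ) ≤ w := by positivity
        nlinarith
      · refine le_trans ?_ h2
        apply mul_le_mul_of_nonneg_left _ hη
        exact_mod_cast hwq j hj
    have := mul_le_mul_of_nonneg_left h3 (hτ j hj)
    linarith
  set t := blockStep f ε s h size L with ht
  have hA : ∀ j ∈ s.I, t.A j = s.A j ∪ S j := by
    intro j hj
    simp only [ht, blockStep, hj, if_true, hS]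
  have hA' : ∀ j ∈ s.I, t.A' j = s.A' j ∪ S' j := by
    intro j hj
    simp only [ht, blockStep, hj, if_true, hS']
  have hAn : ∀ j, j ∉ s.I → t.A j = s.A j := by
    intro j hj
    simp only [ht, blockStep, hj, if_false]
  have hAn' : ∀ j, j ∉ s.I → t.A' j = s.A' j := by
    intro j hj
    simp only [ht, blockStep, hj, if_false]
  have hAsub : ∀ l, s.A l ⊆ t.A l := by
    intro l
    by_cases hl : l ∈ s.I
    · rw [hA l hl]; exact Finset.subset_union_left
    · rw [hAn l hl]
  have hcard : ∀ l ∈ s.I, (t.A l).card = (s.A l).card + w := by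
    intro l hl
    rw [hA l hl, Finset.card_union_of_disjoint (hSA l hl l).symm, hScard l hl]
  have hgain' : ∀ l ∈ s.I, gain f (s.A' l) ∅ + (1 - ε) * (w * s.τ l) ≤ gain f (t.A' l) ∅ := by
    intro l hl
    rw [hA' l hl]
    have := hval l hl
    simp only [gain, Finset.union_empty]
    linarith
  have hout : t.outside ⊆ s.outside := outside_subset_of_A_sub hAsub
  have hanti : ∀ l, ∀ x ∈ t.outside, gain f {x} (t.A l) ≤ gain f {x} (s.A l) := fun l x hx =>
    hf.gain_singleton_anti (hAsub l) (mem_outside.1 hx l)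
  refine ⟨⟨?_, ?_, ?_, hs.frozen, ?_, ?_, ?_⟩, hw1, ?_, subset_rfl, fun l hl => (hp l hl).2.1,
    fun _ => le_rfl, hAsub, ?_, hcard, fun l hl => ⟨hAn l hl, hAn' l hl⟩, hgain', Or.inl hs.thr⟩
  · intro i j hij
    by_cases hi : i ∈ s.I
    · rw [hA i hi, Finset.disjoint_union_left]
      by_cases hj : j ∈ s.I
      · rw [hA j hj, Finset.disjoint_union_right, Finset.disjoint_union_right]
        exact ⟨⟨hs.disj i j hij, (hSA j hj i).symm⟩, hSA i hi j, hSdis i hi j hj hij⟩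
      · rw [hAn j hj]
        exact ⟨hs.disj i j hij, hSA i hi j⟩
    · rw [hAn i hi]
      by_cases hj : j ∈ s.I
      · rw [hA j hj, Finset.disjoint_union_right]
        exact ⟨hs.disj i j hij, (hSA j hj i).symm⟩
      · rw [hAn j hj]
        exact hs.disj i j hij
  · intro l
    by_cases hl : l ∈ s.I
    · rw [hA l hl, hA' l hl]
      exact Finset.union_subset_union (hs.sub l) (hS'S l)
    · rw [hAn l hl, hAn' l hl]
      exact hs.sub l
  · intro l
    by_cases hl : l ∈ s.I
    · rw [hA l hl, hA' l hl]
      have h1 := hSS' l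
      have h2 := hs.mono l
      have h3 := hf.gain_anti (S := S' l) (hs.sub l) (by
        have := Finset.disjoint_of_subset_left (hS'S l) (hSA l hl l)
        rw [Finset.disjoint_iff_inter_eq_empty.1 this]
        exact Finset.empty_subset _)
      simp only [gain, Finset.union_empty, Finset.union_comm (S' l)] at h2 h3 ⊢
      linarith
    · rw [hAn l hl, hAn' l hl]
      exact hs.mono l
  · intro l x hx hτ'
    exact hs.cover l x (hout hx) (hτ'.trans (hanti l x hx))
  · intro l x hx
    exact (mul_le_mul_of_nonneg_left (hanti l x hx) hη).trans (hs.thr l x (hout hx))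
  · intro l
    have h0 : t.τ l = s.τ l := rfl
    rw [h0]
    by_cases hl : l ∈ s.I
    · have h1 := hs.val l
      have h2 := hgain' l hl
      rw [max_eq_left (hp l hl).2.1] at h1 ⊢
      rw [hcard l hl]
      push_cast
      linarith
    · rw [hAn l hl, hAn' l hl]
      exact hs.val l
  · simp only [ht, blockStep]
    omega
  · intro l x hx
    rw [Finset.mem_sdiff] at hx
    by_cases hl : l ∈ s.I
    · rw [hA l hl, Finset.mem_union] at hx
      exact hSo l hl (hx.1.resolve_left hx.2)
    · rw [hAn l hl] at hx
      exact absurd hx.1 hx.2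

/-- The data drawn by `addBlocks` from a state after the first phase of an iteration. -/
theorem addBlocks_data {U : Type*} [DecidableEq U] {s : State U ℓ} (hℓ : 1 ≤ ℓ) (hm : s.m₀ ≠ 0)
    (hbig : ∀ i ∈ s.I, 2 * ℓ ≤ (s.V i).card) (h : s.I.Nonempty) {D : Fin ℓ → Finset U}
    (hD : D ∈ (distribute s.V s.I).support) {L : Fin ℓ → List U}
    (hL : L ∈ Fintype.piFinset fun j => orderings (D j)) :
    1 ≤ blockSize s h D ∧ blockSize s h D ≤ s.m₀ ∧ (∀ j ∈ s.I, (L j).Nodup) ∧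
      (∀ j ∈ s.I, (L j).toFinset ⊆ s.V j) ∧ (∀ j ∈ s.I, blockSize s h D ≤ (L j).length) ∧
      (∀ i ∈ s.I, ∀ j ∈ s.I, i ≠ j → Disjoint (L i).toFinset (L j).toFinset) := by
  obtain ⟨h1, h2, h3⟩ := distribute_support hD
  have hL' : ∀ j, (L j).Nodup ∧ (L j).toFinset = D j := fun j =>
    mem_orderings.1 (Fintype.mem_piFinset.1 hL j)
  have hlen : ∀ j, (L j).length = (D j).card := fun j =>
    length_of_mem_orderings (Fintype.mem_piFinset.1 hL j)
  refine ⟨?_, min_le_left _ _, fun j _ => (hL' j).1, fun j hj => ?_, fun j hj => ?_,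
    fun i _ j _ hij => ?_⟩
  · rw [blockSize, le_min_iff, Finset.le_inf'_iff]
    refine ⟨Nat.one_le_iff_ne_zero.2 hm, fun j hj => ?_⟩
    rw [(h1 j hj).2, Nat.le_div_iff_mul_le (by omega)]
    have := hbig j hj
    omega
  · rw [(hL' j).2]
    exact (h1 j hj).1
  · rw [hlen]
    exact (min_le_right _ _).trans (Finset.inf'_le _ hj)
  · rw [(hL' i).2, (hL' j).2]
    exact h3 i j hij

/-- An iteration is the first phase, followed by an extension unless no solution is active. -/
theorem iteration_spec [Nonempty U] (hf : Submodular f) (hℓ : 1 ≤ ℓ) (hε : 0 < ε) (hε1 : ε < 1)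
    (hmin : 0 < τmin) (hm : s.m₀ ≠ 0) (hs : Core f τmin ε s)
    (ht : t ∈ (iteration f τmin ε s).support) :
    ((refresh f τmin ε s).I = ∅ ∧ t = refresh f τmin ε s) ∨
      ∃ w, Extends f τmin ε w (refresh f τmin ε s) t := by
  have hr := hs.refresh hε hε1 hmin
  have hmr : (refresh f τmin ε s).m₀ ≠ 0 := hm
  have hp : ∀ j ∈ (refresh f τmin ε s).I, Pending f τmin (refresh f τmin ε s) j :=
    fun j hj => pending_refresh hj
  unfold iteration at ht
  simp only at ht
  split_ifs at ht with h1 h2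
  · rw [PMF.mem_support_map_iff] at ht
    obtain ⟨u, hu, rfl⟩ := ht
    right
    refine ⟨1, extends_of_turns hε hmin hmr hr ?_⟩
    refine turns_addInTurn hf hε hε1 hmin _ _ _ (Finset.sortedLT_sort _).pairwise hr ?_ hu
    intro j hj
    exact hp j ((Finset.mem_sort _).1 hj)
  · rw [addBlocks_eq, PMF.mem_support_bind_iff] at ht
    obtain ⟨D, hD, ht⟩ := ht
    rw [PMF.mem_support_map_iff] at ht
    obtain ⟨L, hL, rfl⟩ := ht
    rw [mem_support_unif] at hL
    swap
    · exact Fintype.piFinset_nonempty.2 fun j => orderings_nonempty _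
    push Not at h2
    obtain ⟨a1, a2, a3, a4, a5, a6⟩ := addBlocks_data hℓ hmr h2 h1 hD hL
    exact Or.inr ⟨_, extends_blockStep hf hε hε1 hmin hr hp h1 a1 a2 a3 a4 a5 a6⟩
  · rw [PMF.mem_support_pure_iff] at ht
    exact Or.inl ⟨Finset.not_nonempty_iff_eq_empty.1 h1, ht⟩

end Iteration

end PIG
end

/-! ### Charging arguments for the guarantees. -/

noncomputable section
namespace PIG

/-! ### Arithmetic of the payments -/

theorem sq_mul_le_of_le {η φ g : ℝ} (hη : 0 < η) (hη1 : η ≤ 1) (hg : 0 ≤ g) (h : φ ≤ g) :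
    η ^ 2 * φ ≤ g :=
  (mul_le_mul_of_nonneg_left h (sq_nonneg η)).trans
    (mul_le_of_le_one_left hg (pow_le_one₀ hη.le hη1))

/-- `C` is the charge for `x` chosen elements among `w` added, `c` and `c'` are the reserves, `b₀`
and `b` the old and new thresholds. A single element charged at the old threshold is affordable
because `(c - 1) * (b₀ - b) ≥ 0`; this is why a unit of reserve is kept. -/
theorem payment_step {η C x w b b₀ c c' : ℝ} (hη : 0 < η) (hb0 : 0 ≤ b) (hb : b ≤ b₀)
    (hc : 0 ≤ c) (hc' : c' ≤ c + (w - x))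
    (h : η * C ≤ x * b ∨ (1 ≤ c ∧ w = 1 ∧ (x = 0 ∨ x = 1) ∧ η * C ≤ x * b₀)) :
    η ^ 2 * C + η * (c' * b) ≤ η * (c * b₀) + η * (w * b) := by
  have h1 := mul_le_mul_of_nonneg_right hc' hb0
  have h2 := mul_le_mul_of_nonneg_left hb hc
  have h3 : η * C + c' * b ≤ c * b₀ + w * b := by
    rcases h with h | ⟨h1c, rfl, rfl | rfl, h⟩
    · linarith
    · linarith
    · have := mul_nonneg (sub_nonneg.2 h1c) (sub_nonneg.2 hb)
      linarith
  have := mul_le_mul_of_nonneg_left h3 hη.le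
  linarith

/-- For the moment when only the second solution leaves its set; `a` and `b` are the thresholds of
the first and second. There are two ways to pay `φ₁`: entirely by the gain of its own solution,
which leaves `w * b` free and is good when `a ≤ b`, or by charging its increment `C` to `b`, which
leaves `w * a` free and is good when `b < a`. -/
theorem payment_start {η φ₁ φ₂ g₁ g₂ g₁' K₁ K₂ C w x a b : ℝ} (hη : 0 < η)
    (hw : 1 ≤ w)
    (hφ₁ : η ^ 2 * φ₁ ≤ g₁') (hφ₁' : η ^ 2 * φ₁ ≤ g₁ + η ^ 2 * C)
    (hφ₂ : η ^ 2 * φ₂ ≤ g₂ + η * (x * a)) (hK₁ : g₁ + η * (w * a) ≤ K₁)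
    (hK₂ : g₂ + η * (w * b) ≤ K₂) (hg : g₁' ≤ K₁)
    (h : η * C ≤ w * b ∨ (w = 1 ∧ x = 0)) :
    η ^ 2 * (φ₁ + φ₂) + η * (b + (w - x - 1) * a) ≤ K₁ + K₂ := by
  by_cases hab : a ≤ b ∨ (w = 1 ∧ x = 0)
  · have h1 : x * a + (b + (w - x - 1) * a) ≤ w * b := by
      rcases hab with hab | ⟨rfl, rfl⟩
      · have := mul_le_mul_of_nonneg_left hab (sub_nonneg.2 hw)
        linarith
      · linarith
    have := mul_le_mul_of_nonneg_left h1 hη.le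
    linarith
  · rw [not_or, not_le] at hab
    have h1 := mul_le_mul_of_nonneg_left (h.resolve_right hab.2) hη.le
    have h2 := mul_le_mul_of_nonneg_left hab.1.le hη.le
    linarith

section Guarantee

variable {U : Type*} [Fintype U] [DecidableEq U] {ℓ : ℕ}
variable {f : Finset U → ℝ} {τmin ε : ℝ} {s t : State U ℓ} {m : ℕ}

/-- The active solutions have used up the same part of the budget, the others at most that. -/
structure Balanced (m : ℕ) (s : State U ℓ) : Prop where
  le : ∀ l, (s.A l).card + s.m₀ ≤ m
  eq : ∀ l ∈ s.I, (s.A l).card + s.m₀ = m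

theorem Balanced.refresh (h : Balanced m s) : Balanced m (refresh f τmin ε s) :=
  ⟨h.le, fun l hl => h.eq l (refresh_I_subset hl)⟩

theorem Balanced.extends {w : ℕ} (h : Balanced m s) (he : Extends f τmin ε w s t) :
    Balanced m t := by
  have hb := he.budget
  refine ⟨fun l => ?_, fun l hl => ?_⟩
  · by_cases hl : l ∈ t.I
    · have h1 := he.card l hl
      have h2 := h.le l
      omega
    · have h1 := (he.idle l hl).1
      have h2 := h.le l
      rw [h1]
      omega
  · have h1 := he.card l hl
    have h2 := h.eq l (he.I_sub hl)
    omega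

/-- The gain of solution `l`, where an inactive solution is credited with `τmin` for each element
it did not receive. -/
def credit (f : Finset U → ℝ) (τmin ε : ℝ) (m : ℕ) (s : State U ℓ) (l : Fin ℓ) : ℝ :=
  gain f (s.A' l) ∅ + (1 - ε) * (((m : ℝ) - s.m₀ - (s.A l).card) * τmin)

/-- The fictitious `τmin` per missed element lets inactive solutions earn in the same way as active
ones. -/
theorem credit_extends {w : ℕ} (he : Extends f τmin ε w s t) (l : Fin ℓ) :
    credit f τmin ε m s l + (1 - ε) * (w * max (t.τ l) τmin) ≤ credit f τmin ε m t l := by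
  have hb : (s.m₀ : ℝ) = t.m₀ + w := by exact_mod_cast he.budget.symm
  unfold credit
  by_cases hl : l ∈ t.I
  · have h1 := he.val l hl
    have h2 : ((t.A l).card : ℝ) = (s.A l).card + w := by exact_mod_cast he.card l hl
    rw [max_eq_left (he.threshold l hl), hb, h2]
    have e : (m : ℝ) - (t.m₀ + w) - (s.A l).card = m - t.m₀ - ((s.A l).card + w) := by ring
    rw [e]
    linarith
  · rw [(he.idle l hl).1, (he.idle l hl).2, max_eq_right (he.core.frozen l hl).le, hb]
    apply le_of_eq
    ring

/-- Disjointness of the solutions allows passing from the new `A_k` down to the old one, where the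
charges of the new elements are known. -/
theorem gain_inter_extends (hf : Submodular f) {w : ℕ} (he : Extends f τmin ε w s t)
    {i k : Fin ℓ} (hik : i ≠ k) (O : Finset U) :
    gain f (O ∩ t.A i) (t.A k) ≤ gain f (O ∩ s.A i) (s.A k) +
      ∑ x ∈ O ∩ (t.A i \ s.A i), gain f {x} (s.A k) := by
  have h1 : O ∩ t.A i = (O ∩ s.A i) ∪ (O ∩ (t.A i \ s.A i)) := by
    rw [← Finset.inter_union_distrib_left, Finset.union_sdiff_of_subset (he.A_sub i)]
  have hd : O ∩ t.A i ∩ t.A k = ∅ := by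
    rw [Finset.inter_assoc, Finset.disjoint_iff_inter_eq_empty.1 (he.core.disj i k hik),
      Finset.inter_empty]
  refine (hf.gain_anti (he.A_sub k) (by rw [hd]; exact Finset.empty_subset _)).trans ?_
  rw [h1]
  refine (hf.gain_union_le ?_).trans (add_le_add_right (hf.gain_le_sum _ _) _)
  intro x hx
  rw [Finset.mem_inter, Finset.mem_inter, Finset.mem_inter, Finset.mem_sdiff] at hx
  exact absurd hx.1.2 hx.2.2.2

theorem card_inter_extends {w : ℕ} (he : Extends f τmin ε w s t) (i : Fin ℓ) (O : Finset U) :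
    (O ∩ t.A i).card = (O ∩ s.A i).card + (O ∩ (t.A i \ s.A i)).card := by
  have h1 : O ∩ t.A i = (O ∩ s.A i) ∪ (O ∩ (t.A i \ s.A i)) := by
    rw [← Finset.inter_union_distrib_left, Finset.union_sdiff_of_subset (he.A_sub i)]
  rw [h1, Finset.card_union_of_disjoint]
  rw [Finset.disjoint_left]
  intro x hx hx'
  rw [Finset.mem_inter] at hx hx'
  exact (Finset.mem_sdiff.1 hx'.2).2 hx.2

theorem card_new_le {w : ℕ} (he : Extends f τmin ε w s t) (i : Fin ℓ) (O : Finset U) :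
    (O ∩ (t.A i \ s.A i)).card ≤ w := by
  refine (Finset.card_le_card Finset.inter_subset_right).trans ?_
  rw [Finset.card_sdiff_of_subset (he.A_sub i)]
  by_cases hl : i ∈ t.I
  · have := he.card i hl
    omega
  · rw [(he.idle i hl).1]
    omega

/-- The invariant for two solutions and two sets `O₁`, `O₂`: either both solutions are still
contained in these sets, or the gains of the chosen elements of each set over the other solution
are paid for, with a reserve for the elements to come. -/
def PairInv (f : Finset U → ℝ) (τmin ε : ℝ) (m : ℕ) (i k : Fin ℓ) (O₁ O₂ : Finset U)
    (s : State U ℓ) : Prop :=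
  (s.A i ⊆ O₁ ∧ s.A k ⊆ O₂ ∧ (s.A i).card + s.m₀ = m ∧ (s.A k).card + s.m₀ = m) ∨
  (1 - ε) ^ 2 * (gain f (O₁ ∩ s.A i) (s.A k) + gain f (O₂ ∩ s.A k) (s.A i)) +
    (1 - ε) * (max ((m : ℝ) - s.m₀ - (O₁ ∩ s.A i).card) 1 * max (s.τ k) τmin +
      max ((m : ℝ) - s.m₀ - (O₂ ∩ s.A k).card - min ((O₁ ∩ s.A i).card : ℝ) 1) 0 *
        max (s.τ i) τmin) ≤
    credit f τmin ε m s i + credit f τmin ε m s k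

theorem PairInv.refresh (hε : 0 < ε) (hε1 : ε < 1) (hmin : 0 < τmin) {i k : Fin ℓ}
    {O₁ O₂ : Finset U} (h : PairInv f τmin ε m i k O₁ O₂ s) :
    PairInv f τmin ε m i k O₁ O₂ (refresh f τmin ε s) := by
  rcases h with h | h
  · exact Or.inl h
  · refine Or.inr (le_trans ?_ h)
    apply add_le_add_right
    apply mul_le_mul_of_nonneg_left _ (by linarith)
    have hτ : ∀ l, max ((PIG.refresh f τmin ε s).τ l) τmin ≤ max (s.τ l) τmin := fun l =>
      max_le_max_right _ (runUpdate_τ_le hε hε1 hmin s.I l)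
    apply add_le_add
    · exact mul_le_mul_of_nonneg_left (hτ k) (zero_le_one.trans (le_max_right _ _))
    · exact mul_le_mul_of_nonneg_left (hτ i) (le_max_right _ _)

theorem gain_credit_nonneg (hε1 : ε < 1) (hmin : 0 < τmin) (hs : Core f τmin ε s) (l : Fin ℓ) :
    0 ≤ gain f (s.A' l) ∅ := by
  refine le_trans ?_ (hs.val l)
  have : 0 ≤ max (s.τ l) τmin := hmin.le.trans (le_max_right _ _)
  have : 0 ≤ 1 - ε := by linarith
  positivity

/-- A solution contained in its set pays for itself, so no reserve is needed in the first
alternative of `PairInv`. -/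
theorem gain_inter_le_of_subset (hf : Submodular f) (hs : Core f τmin ε s) {i k : Fin ℓ}
    (hik : i ≠ k) {O : Finset U} (h : s.A i ⊆ O) :
    gain f (O ∩ s.A i) (s.A k) ≤ gain f (s.A' i) ∅ := by
  rw [Finset.inter_eq_right.2 h]
  refine (hf.gain_anti (Finset.empty_subset _) ?_).trans (hs.mono i)
  rw [Finset.disjoint_iff_inter_eq_empty.1 (hs.disj i k hik)]

/-- Elements chosen by `k` are still unused at the turn of `i < k`, so `O₂` is always charged at the
new threshold of `i`. Elements chosen by `i` may be charged at the old threshold of `k`, but only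
when `w = 1`, and the unit of reserve covers that. -/
theorem PairInv.extends (hf : Submodular f) (hε : 0 < ε) (hε1 : ε < 1) (hmin : 0 < τmin)
    {i k : Fin ℓ} (hik : i < k) {O₁ O₂ : Finset U} {w : ℕ} (hs : Core f τmin ε s)
    (hbal : Balanced m s) (he : Extends f τmin ε w s t) (h : PairInv f τmin ε m i k O₁ O₂ s) :
    PairInv f τmin ε m i k O₁ O₂ t := by
  have hbalt := hbal.extends he
  have hb : (s.m₀ : ℝ) = t.m₀ + w := by exact_mod_cast he.budget.symm
  have hη : 0 < 1 - ε := by linarith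
  have hη1 : 1 - ε ≤ 1 := by linarith
  have hw1 : (1 : ℝ) ≤ w := by exact_mod_cast he.pos
  have hC1 := credit_extends (m := m) he i
  have hC2 := credit_extends (m := m) he k
  have hφ1 := gain_inter_extends hf he hik.ne O₁
  have hφ2 := gain_inter_extends hf he hik.ne' O₂
  have hX1 := card_inter_extends he i O₁
  have hX2 := card_inter_extends he k O₂
  have hx1w := card_new_le he i O₁
  have hx2w := card_new_le he k O₂
  have hτ : ∀ l, max (t.τ l) τmin ≤ max (s.τ l) τmin := fun l => max_le_max_right _ (he.τ_le l)
  have hτ0 : ∀ l, 0 ≤ max (t.τ l) τmin := fun l => hmin.le.trans (le_max_right _ _)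
  have hsum : ∀ (j l : Fin ℓ) (O : Finset U) (c : ℝ), (∀ x ∈ t.A j \ s.A j,
      (1 - ε) * gain f {x} (s.A l) ≤ c) →
      (1 - ε) * ∑ x ∈ O ∩ (t.A j \ s.A j), gain f {x} (s.A l) ≤
        (O ∩ (t.A j \ s.A j)).card * c := by
    intro j l O c hc
    rw [Finset.mul_sum]
    refine (Finset.sum_le_sum fun x hx => hc x (Finset.mem_inter.1 hx).2).trans ?_
    simp
  have hc2 : (1 - ε) * ∑ x ∈ O₂ ∩ (t.A k \ s.A k), gain f {x} (s.A i) ≤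
      (O₂ ∩ (t.A k \ s.A k)).card * max (t.τ i) τmin := by
    apply hsum
    intro x hx
    rcases he.charge with hc | ⟨-, hc⟩
    · exact hc i x (he.new k hx)
    · refine hc i x (he.new k hx) fun j hj hxj => ?_
      exact Finset.disjoint_left.1 (he.core.disj k j (hj.trans hik).ne')
        (Finset.mem_sdiff.1 hx).1 hxj
  have hc1 : (1 - ε) * ∑ x ∈ O₁ ∩ (t.A i \ s.A i), gain f {x} (s.A k) ≤
        (O₁ ∩ (t.A i \ s.A i)).card * max (t.τ k) τmin ∨
      (w = 1 ∧ (1 - ε) * ∑ x ∈ O₁ ∩ (t.A i \ s.A i), gain f {x} (s.A k) ≤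
        (O₁ ∩ (t.A i \ s.A i)).card * max (s.τ k) τmin) := by
    rcases he.charge with hc | ⟨hw, -⟩
    · exact Or.inl (hsum _ _ _ _ fun x hx => hc k x (he.new i hx))
    · exact Or.inr ⟨hw, hsum _ _ _ _ fun x hx => hs.thr k x (he.new i hx)⟩
  have hηφ1 := mul_le_mul_of_nonneg_left hφ1 (sq_nonneg (1 - ε))
  have hηφ2 := mul_le_mul_of_nonneg_left hφ2 (sq_nonneg (1 - ε))
  rw [mul_add] at hηφ1 hηφ2
  have ha : max (t.τ i) τmin ≤ max (s.τ i) τmin := hτ i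
  have hbb : max (t.τ k) τmin ≤ max (s.τ k) τmin := hτ k
  have ha0 : 0 ≤ max (t.τ i) τmin := hτ0 i
  have hb0 : 0 ≤ max (t.τ k) τmin := hτ0 k
  generalize hdx1 : (O₁ ∩ (t.A i \ s.A i)).card = x₁ at *
  generalize hdx2 : (O₂ ∩ (t.A k \ s.A k)).card = x₂ at *
  generalize ∑ x ∈ O₁ ∩ (t.A i \ s.A i), gain f {x} (s.A k) = c₁ at *
  generalize ∑ x ∈ O₂ ∩ (t.A k \ s.A k), gain f {x} (s.A i) = c₂ at *
  have hx1w' : (x₁ : ℝ) ≤ w := by exact_mod_cast hx1w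
  have hx2w' : (x₂ : ℝ) ≤ w := by exact_mod_cast hx2w
  have hηc2 : (1 - ε) ^ 2 * c₂ ≤ (1 - ε) * (x₂ * max (t.τ i) τmin) := by
    have := mul_le_mul_of_nonneg_left hc2 hη.le
    linarith
  rcases h with ⟨hA1, hA2, hN1, hN2⟩ | hJ
  · have hg1 := sq_mul_le_of_le hη hη1 (gain_credit_nonneg hε1 hmin hs i)
      (gain_inter_le_of_subset hf hs hik.ne hA1)
    have hg2 := sq_mul_le_of_le hη hη1 (gain_credit_nonneg hε1 hmin hs k)
      (gain_inter_le_of_subset hf hs hik.ne' hA2)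
    have hN1' : ((s.A i).card : ℝ) + s.m₀ = m := by exact_mod_cast hN1
    have hN2' : ((s.A k).card : ℝ) + s.m₀ = m := by exact_mod_cast hN2
    have hcr1 : credit f τmin ε m s i = gain f (s.A' i) ∅ := by
      unfold credit
      rw [show (m : ℝ) - s.m₀ - (s.A i).card = 0 by linarith]
      ring
    have hcr2 : credit f τmin ε m s k = gain f (s.A' k) ∅ := by
      unfold credit
      rw [show (m : ℝ) - s.m₀ - (s.A k).card = 0 by linarith]
      ring
    rw [hcr1] at hC1
    rw [hcr2] at hC2
    have hXs1 : (O₁ ∩ s.A i).card = (s.A i).card := by rw [Finset.inter_eq_right.2 hA1]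
    have hXs2 : (O₂ ∩ s.A k).card = (s.A k).card := by rw [Finset.inter_eq_right.2 hA2]
    have hn1 : (m : ℝ) - t.m₀ - (O₁ ∩ t.A i).card = w - x₁ := by
      rw [hX1, hXs1]
      push_cast
      linarith
    have hn2 : (m : ℝ) - t.m₀ - (O₂ ∩ t.A k).card = w - x₂ := by
      rw [hX2, hXs2]
      push_cast
      linarith
    have hbud := he.budget
    have hle1 := hbalt.le i
    have hle2 := hbalt.le k
    have hcle1 := Finset.card_le_card (Finset.inter_subset_right (s₁ := O₁) (s₂ := t.A i))
    have hcle2 := Finset.card_le_card (Finset.inter_subset_right (s₁ := O₂) (s₂ := t.A k))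
    -- The first alternative survives exactly while every new element falls into its set.
    by_cases hall : x₁ = w ∧ x₂ = w
    · left
      have h3 : (t.A i).card ≤ (O₁ ∩ t.A i).card := by omega
      have h4 : (t.A k).card ≤ (O₂ ∩ t.A k).card := by omega
      exact ⟨Finset.inter_eq_right.1
        (Finset.eq_of_subset_of_card_le Finset.inter_subset_right h3),
        Finset.inter_eq_right.1 (Finset.eq_of_subset_of_card_le Finset.inter_subset_right h4),
        by omega, by omega⟩
    right
    rw [hn1, hn2]
    -- If `A_i` stays in `O₁`, the unit reserve for `k` is taken from the surplus of `O₂`, whence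
    -- the subtracted `1`; otherwise `w - x₁ ≥ 1` supplies it.
    by_cases hx1 : x₁ = w
    · have hx2 : x₂ + 1 ≤ w := by
        have : x₂ ≠ w := fun h => hall ⟨hx1, h⟩
        omega
      have hx2c : (x₂ : ℝ) + 1 ≤ w := by exact_mod_cast hx2
      have hXt : (1 : ℝ) ≤ (O₁ ∩ t.A i).card := by
        have := he.pos
        exact_mod_cast (by omega : 1 ≤ (O₁ ∩ t.A i).card)
      have hx1c : (x₁ : ℝ) = w := by exact_mod_cast hx1
      rw [min_eq_right hXt, max_eq_right (by rw [hx1c]; linarith : (w : ℝ) - x₁ ≤ 1),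
        max_eq_left (by linarith : (0 : ℝ) ≤ w - x₂ - 1), one_mul]
      have hAt : t.A i ⊆ O₁ := Finset.inter_eq_right.1
        (Finset.eq_of_subset_of_card_le Finset.inter_subset_right (by omega))
      have hct : gain f (t.A' i) ∅ ≤ credit f τmin ε m t i := by
        unfold credit
        have : ((t.A i).card : ℝ) + t.m₀ ≤ m := by exact_mod_cast hbalt.le i
        have : 0 ≤ (1 - ε) * (((m : ℝ) - t.m₀ - (t.A i).card) * τmin) :=
          mul_nonneg hη.le (mul_nonneg (by linarith) hmin.le)
        linarith
      refine payment_start (C := c₁) hη hw1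
        (sq_mul_le_of_le hη hη1 (gain_credit_nonneg hε1 hmin he.core i)
          (gain_inter_le_of_subset hf he.core hik.ne hAt)) (by linarith) (by linarith)
        hC1 hC2 hct ?_
      rcases hc1 with hc1 | ⟨hw, -⟩
      · left
        rwa [hx1c] at hc1
      · right
        have : x₂ = 0 := by omega
        rw [this, hw]
        simp
    · have hx1 : x₁ + 1 ≤ w := by omega
      have hx1c : (x₁ : ℝ) + 1 ≤ w := by exact_mod_cast hx1
      rw [max_eq_left (by linarith : (1 : ℝ) ≤ w - x₁)]
      have hc : (1 - ε) * c₁ ≤ x₁ * max (t.τ k) τmin := by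
        rcases hc1 with hc1 | ⟨hw, hc1⟩
        · exact hc1
        -- With `w = 1`, an element missing `O₁` means that nothing was charged at the old
        -- threshold.
        · have : x₁ = 0 := by omega
          rw [this] at hc1 ⊢
          simpa using hc1
      have hmx : max ((w : ℝ) - x₂ - min ((O₁ ∩ t.A i).card : ℝ) 1) 0 ≤ 0 + (w - x₂) := by
        apply max_le
        · have : (0 : ℝ) ≤ min ((O₁ ∩ t.A i).card : ℝ) 1 := le_min (by positivity) zero_le_one
          linarith
        · linarith
      have s1 := payment_step (w := (w : ℝ)) (c := 0) (c' := (w : ℝ) - x₁) hη hb0 le_rfl le_rfl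
        (by linarith) (Or.inl hc)
      have s2 := payment_step hη ha0 le_rfl le_rfl hmx (Or.inl hc2)
      linarith
  · right
    have hn1 : (m : ℝ) - t.m₀ - (O₁ ∩ t.A i).card =
        (m - s.m₀ - (O₁ ∩ s.A i).card) + (w - x₁) := by
      rw [hX1, hb]
      push_cast
      ring
    have hn2 : (m : ℝ) - t.m₀ - (O₂ ∩ t.A k).card =
        (m - s.m₀ - (O₂ ∩ s.A k).card) + (w - x₂) := by
      rw [hX2, hb]
      push_cast
      ring
    have hδ : min ((O₁ ∩ s.A i).card : ℝ) 1 ≤ min ((O₁ ∩ t.A i).card : ℝ) 1 := by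
      apply min_le_min_right
      exact_mod_cast (by omega : (O₁ ∩ s.A i).card ≤ (O₁ ∩ t.A i).card)
    rw [hn1, hn2]
    generalize (m : ℝ) - s.m₀ - (O₁ ∩ s.A i).card = n₁ at *
    generalize (m : ℝ) - s.m₀ - (O₂ ∩ s.A k).card = n₂ at *
    generalize min ((O₁ ∩ s.A i).card : ℝ) 1 = δ at *
    generalize min ((O₁ ∩ t.A i).card : ℝ) 1 = δ' at *
    have hcc : max (n₁ + (w - x₁)) 1 ≤ max n₁ 1 + (w - x₁) := by
      apply max_le
      · linarith [le_max_left n₁ 1]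
      · linarith [le_max_right n₁ 1]
    have hee : max (n₂ + (w - x₂) - δ') 0 ≤ max (n₂ - δ) 0 + (w - x₂) := by
      apply max_le
      · linarith [le_max_left (n₂ - δ) 0]
      · linarith [le_max_right (n₂ - δ) 0]
    have hc0 : 1 ≤ max n₁ 1 := le_max_right _ _
    have s1 := payment_step hη hb0 hbb (zero_le_one.trans hc0) hcc (hc1.imp_right fun h =>
      ⟨hc0, by exact_mod_cast h.1, by
        have : x₁ = 0 ∨ x₁ = 1 := by omega
        exact_mod_cast this, h.2⟩)
    have s2 := payment_step hη ha0 ha (le_max_right _ _) hee (Or.inl hc2)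
    linarith

/-- The gain of a set of at most `m` elements that avoids the other solutions, in terms of the
part of it that was chosen. -/
theorem mul_gain_le (hf : Submodular f) (hε1 : ε < 1) (hs : Core f τmin ε s) {i k : Fin ℓ}
    {O : Finset U} (hO : ∀ j, j ≠ i → Disjoint O (s.A j)) :
    (1 - ε) * gain f O (s.A k) ≤ (1 - ε) * gain f (O ∩ s.A i) (s.A k) +
      ((O.card : ℝ) - (O ∩ s.A i).card) * max (s.τ k) τmin := by
  have hη : 0 < 1 - ε := by linarith
  have h1 : O = (O ∩ s.A i) ∪ (O \ s.A i) := by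
    rw [Finset.union_comm, Finset.sdiff_union_inter]
  have h2 : gain f O (s.A k) ≤ gain f (O ∩ s.A i) (s.A k) + gain f (O \ s.A i) (s.A k) := by
    conv_lhs => rw [h1]
    apply hf.gain_union_le
    rw [Finset.disjoint_iff_inter_eq_empty.1 (Finset.disjoint_sdiff_inter O (s.A i)).symm]
    exact Finset.empty_subset _
  have h3 : (1 - ε) * gain f (O \ s.A i) (s.A k) ≤
      (O \ s.A i).card * max (s.τ k) τmin := by
    have := mul_le_mul_of_nonneg_left (hf.gain_le_sum (O \ s.A i) (s.A k)) hη.le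
    refine this.trans ?_
    rw [Finset.mul_sum]
    refine (Finset.sum_le_sum fun x hx => hs.thr k x ?_).trans (by simp)
    rw [mem_outside]
    intro l
    rw [Finset.mem_sdiff] at hx
    by_cases hl : l = i
    · rw [hl]; exact hx.2
    · exact Finset.disjoint_left.1 (hO l hl) hx.1
  have h4 : ((O \ s.A i).card : ℝ) = O.card - (O ∩ s.A i).card := by
    have := Finset.card_inter_add_card_sdiff O (s.A i)
    rw [← this]
    push_cast
    ring
  rw [h4] at h3
  have := mul_le_mul_of_nonneg_left h2 hη.le
  linarith

/-- At exit either no budget is left or all thresholds are below `τmin`; either way unspent budget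
is priced at `τmin`. -/
theorem Core.max_eq_of_halted (hs : Core f τmin ε s) (hh : s.Halted) (l : Fin ℓ) :
    (s.m₀ : ℝ) * max (s.τ l) τmin = s.m₀ * τmin := by
  rcases hh with h | h
  · rw [max_eq_right (hs.frozen l (by rw [h]; exact Finset.notMem_empty l)).le]
  · rw [h]
    simp

/-- The unchosen parts of the sets are paid by the reserves, up to `m₀` elements of each at price
`τmin` and a deficit `d` at the threshold of `i`. The deficit comes from the unit that `PairInv`
withholds from the reserve for `O₂` once `O₁` meets `A_i`. -/
theorem pair_bound (hf : Submodular f) (hε : 0 < ε) (hε1 : ε < 1) (hmin : 0 < τmin)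
    (hs : Core f τmin ε s) (hh : s.Halted) {i k : Fin ℓ} (hik : i < k)
    {O₁ O₂ : Finset U} (hinv : PairInv f τmin ε m i k O₁ O₂ s)
    (hO1 : ∀ j, j ≠ i → Disjoint O₁ (s.A j)) (hO2 : ∀ j, j ≠ k → Disjoint O₂ (s.A j))
    (hc1 : O₁.card ≤ m) (hc2 : O₂.card ≤ m) {d : ℝ} (hd : 0 ≤ d)
    (hd2 : (O₂.card : ℝ) + min ((O₁ ∩ s.A i).card : ℝ) 1 ≤ m + d) :
    (1 - ε) ^ 2 * (gain f O₁ (s.A k) + gain f O₂ (s.A i)) ≤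
      gain f (s.A' i) ∅ + gain f (s.A' k) ∅ +
        (1 - ε) * ((2 * m - (s.A i).card - (s.A k).card) * τmin + d * max (s.τ i) τmin) := by
  have hη : 0 < 1 - ε := by linarith
  have h1 := mul_le_mul_of_nonneg_left (mul_gain_le (k := k) hf hε1 hs hO1) hη.le
  have h2 := mul_le_mul_of_nonneg_left (mul_gain_le (k := i) hf hε1 hs hO2) hη.le
  have hm1 := hs.max_eq_of_halted hh i
  have hm2 := hs.max_eq_of_halted hh k
  have ha0 : 0 ≤ max (s.τ i) τmin := hmin.le.trans (le_max_right _ _)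
  have hb0 : 0 ≤ max (s.τ k) τmin := hmin.le.trans (le_max_right _ _)
  have hc1' : (O₁.card : ℝ) ≤ m := by exact_mod_cast hc1
  have hc2' : (O₂.card : ℝ) ≤ m := by exact_mod_cast hc2
  set a := max (s.τ i) τmin
  set b := max (s.τ k) τmin
  rcases hinv with ⟨hA1, hA2, hN1, hN2⟩ | hJ
  · have hηg1 := sq_mul_le_of_le hη (by linarith) (gain_credit_nonneg hε1 hmin hs i)
      (gain_inter_le_of_subset hf hs hik.ne hA1)
    have hηg2 := sq_mul_le_of_le hη (by linarith) (gain_credit_nonneg hε1 hmin hs k)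
      (gain_inter_le_of_subset hf hs hik.ne' hA2)
    have hN1' : ((s.A i).card : ℝ) + s.m₀ = m := by exact_mod_cast hN1
    have hN2' : ((s.A k).card : ℝ) + s.m₀ = m := by exact_mod_cast hN2
    have hX1 : (O₁ ∩ s.A i).card = (s.A i).card := by rw [Finset.inter_eq_right.2 hA1]
    have hX2 : (O₂ ∩ s.A k).card = (s.A k).card := by rw [Finset.inter_eq_right.2 hA2]
    have h3 : ((O₁.card : ℝ) - (O₁ ∩ s.A i).card) * b ≤ s.m₀ * τmin := by
      rw [← hm2, hX1]
      exact mul_le_mul_of_nonneg_right (by linarith) hb0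
    have h4 : ((O₂.card : ℝ) - (O₂ ∩ s.A k).card) * a ≤ s.m₀ * τmin := by
      rw [← hm1, hX2]
      exact mul_le_mul_of_nonneg_right (by linarith) ha0
    have h5 : (2 * (m : ℝ) - (s.A i).card - (s.A k).card) = 2 * s.m₀ := by linarith
    rw [h5]
    have h6 := mul_le_mul_of_nonneg_left (add_le_add h3 h4) hη.le
    have h7 : 0 ≤ (1 - ε) * (d * a) := by positivity
    linarith
  · unfold credit at hJ
    have h3 : ((O₁.card : ℝ) - (O₁ ∩ s.A i).card) * b ≤
        max ((m : ℝ) - s.m₀ - (O₁ ∩ s.A i).card) 1 * b + s.m₀ * τmin := by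
      rw [← hm2, ← add_mul]
      apply mul_le_mul_of_nonneg_right _ hb0
      linarith [le_max_left ((m : ℝ) - s.m₀ - (O₁ ∩ s.A i).card) 1]
    have h4 : ((O₂.card : ℝ) - (O₂ ∩ s.A k).card) * a ≤
        max ((m : ℝ) - s.m₀ - (O₂ ∩ s.A k).card - min ((O₁ ∩ s.A i).card : ℝ) 1) 0 * a +
          s.m₀ * τmin + d * a := by
      rw [← hm1, ← add_mul, ← add_mul]
      apply mul_le_mul_of_nonneg_right _ ha0
      linarith [le_max_left
        ((m : ℝ) - s.m₀ - (O₂ ∩ s.A k).card - min ((O₁ ∩ s.A i).card : ℝ) 1) 0]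
    have h6 := mul_le_mul_of_nonneg_left (add_le_add h3 h4) hη.le
    linarith

/-- If `l` is active, the budget is spent, `|A_l| = m`, and `val` dominates `m` thresholds;
otherwise the threshold is below `τmin`. -/
theorem gain_le_of_outcome (hf : Submodular f) (hε1 : ε < 1) (hmin : 0 < τmin)
    {s : State U ℓ} (hs : Core f τmin ε s) (hbal : Balanced m s) (hh : s.Halted) {l : Fin ℓ}
    {O : Finset U} (hO : O.card ≤ m) (hdis : ∀ j, j ≠ l → Disjoint O (s.A j)) :
    gain f O (s.A l) ≤ gain f (s.A' l) ∅ / (1 - ε) ^ 2 + m * τmin / (1 - ε) := by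
  have hη : 0 < 1 - ε := by linarith
  have h1 := mul_gain_le (k := l) hf hε1 hs hdis
  rw [gain_of_subset Finset.inter_subset_right, mul_zero, zero_add] at h1
  have h0 : 0 ≤ max (s.τ l) τmin := hmin.le.trans (le_max_right _ _)
  have hO' : (O.card : ℝ) ≤ m := by exact_mod_cast hO
  have h2 : (1 - ε) * gain f O (s.A l) ≤ m * max (s.τ l) τmin := by
    refine h1.trans (mul_le_mul_of_nonneg_right ?_ h0)
    have : (0 : ℝ) ≤ (O ∩ s.A l).card := by positivity
    linarith
  have hg := gain_credit_nonneg hε1 hmin hs l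
  by_cases hl : l ∈ s.I
  · have hm : s.m₀ = 0 := by
      rcases hh with h | h
      · rw [h] at hl
        simp at hl
      · exact h
    have hcard := hbal.eq l hl
    rw [hm, add_zero] at hcard
    have h3 := hs.val l
    rw [hcard] at h3
    have h4 : gain f O (s.A l) ≤ gain f (s.A' l) ∅ / (1 - ε) ^ 2 := by
      rw [le_div_iff₀ (by positivity)]
      have := mul_le_mul_of_nonneg_left h2 hη.le
      linarith
    have : 0 ≤ m * τmin / (1 - ε) := by positivity
    linarith
  · rw [max_eq_right (hs.frozen l hl).le] at h2
    have h4 : gain f O (s.A l) ≤ m * τmin / (1 - ε) := by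
      rw [le_div_iff₀ hη]
      linarith
    have : 0 ≤ gain f (s.A' l) ∅ / (1 - ε) ^ 2 := by positivity
    linarith

/-- The deficit is at most one threshold of `i`. If `i` is active, `val` with `|A_i| = m` bounds
that by a share `1/m` of its gain; otherwise the price is `τmin` and `d ≤ |A_i|` fits into the
credit left over. -/
theorem gain_add_gain_le_of_outcome (hf : Submodular f) (hε : 0 < ε) (hε1 : ε < 1)
    (hmin : 0 < τmin) (hm : 1 ≤ m) {s : State U ℓ} (hs : Core f τmin ε s)
    (hbal : Balanced m s) (hh : s.Halted) {i k : Fin ℓ} (hik : i < k) {O₁ O₂ : Finset U}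
    (hinv : PairInv f τmin ε m i k O₁ O₂ s)
    (hO1 : ∀ j, j ≠ i → Disjoint O₁ (s.A j)) (hO2 : ∀ j, j ≠ k → Disjoint O₂ (s.A j))
    (hc1 : O₁.card ≤ m) (hc2 : O₂.card ≤ m) :
    gain f O₂ (s.A i) + gain f O₁ (s.A k) ≤ (1 + 1 / (m : ℝ)) / (1 - ε) ^ 2 *
      (gain f (s.A' i) ∅ + gain f (s.A' k) ∅) + 2 * m * τmin / (1 - ε) := by
  have hη : 0 < 1 - ε := by linarith
  have hm0 : (0 : ℝ) < m := by exact_mod_cast hm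
  have hd : 0 ≤ min ((O₁ ∩ s.A i).card : ℝ) 1 := le_min (by positivity) zero_le_one
  have hd1 : min ((O₁ ∩ s.A i).card : ℝ) 1 ≤ 1 := min_le_right _ _
  have hdA : min ((O₁ ∩ s.A i).card : ℝ) 1 ≤ (s.A i).card :=
    (min_le_left _ _).trans (by exact_mod_cast Finset.card_le_card Finset.inter_subset_right)
  have hc2' : (O₂.card : ℝ) ≤ m := by exact_mod_cast hc2
  have h1 := pair_bound hf hε hε1 hmin hs hh hik hinv hO1 hO2 hc1 hc2 hd (by linarith)
  generalize min ((O₁ ∩ s.A i).card : ℝ) 1 = d at *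
  have hg1 := gain_credit_nonneg hε1 hmin hs i
  have hg2 := gain_credit_nonneg hε1 hmin hs k
  have hA2 : (0 : ℝ) ≤ (s.A k).card := by positivity
  have ha0 : 0 ≤ max (s.τ i) τmin := hmin.le.trans (le_max_right _ _)
  have h2 : (1 - ε) * ((2 * m - (s.A i).card - (s.A k).card) * τmin + d * max (s.τ i) τmin) ≤
      (1 - ε) * (2 * m * τmin) + gain f (s.A' i) ∅ / m := by
    by_cases hi : i ∈ s.I
    · have hm0' : s.m₀ = 0 := by
        rcases hh with h | h
        · rw [h] at hi
          simp at hi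
        · exact h
      have hcard := hbal.eq i hi
      rw [hm0', add_zero] at hcard
      have h3 := hs.val i
      rw [hcard] at h3
      have h4 : (1 - ε) * max (s.τ i) τmin ≤ gain f (s.A' i) ∅ / m := by
        rw [le_div_iff₀ hm0]
        linarith
      have h5 : (1 - ε) * (d * max (s.τ i) τmin) ≤ (1 - ε) * max (s.τ i) τmin :=
        mul_le_mul_of_nonneg_left (mul_le_of_le_one_left ha0 hd1) hη.le
      have h6 : (1 - ε) * ((2 * m - (s.A i).card - (s.A k).card) * τmin) ≤
          (1 - ε) * (2 * m * τmin) :=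
        mul_le_mul_of_nonneg_left (mul_le_mul_of_nonneg_right (by linarith) hmin.le) hη.le
      linarith
    · rw [max_eq_right (hs.frozen i hi).le]
      have h3 : 0 ≤ gain f (s.A' i) ∅ / m := by positivity
      have h4 : (1 - ε) * ((2 * m - (s.A i).card - (s.A k).card) * τmin + d * τmin) ≤
          (1 - ε) * (2 * m * τmin) := by
        rw [← add_mul]
        exact mul_le_mul_of_nonneg_left (mul_le_mul_of_nonneg_right (by linarith) hmin.le) hη.le
      linarith
  have h3 : gain f (s.A' i) ∅ / m ≤ (gain f (s.A' i) ∅ + gain f (s.A' k) ∅) / m :=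
    div_le_div_of_nonneg_right (by linarith) hm0.le
  have h4 : (1 - ε) ^ 2 * (gain f O₁ (s.A k) + gain f O₂ (s.A i)) ≤
      (1 + 1 / (m : ℝ)) * (gain f (s.A' i) ∅ + gain f (s.A' k) ∅) +
        (1 - ε) * (2 * m * τmin) := by
    rw [add_mul, one_mul, one_div_mul_eq_div]
    linarith
  have h5 : (1 + 1 / (m : ℝ)) / (1 - ε) ^ 2 * (gain f (s.A' i) ∅ + gain f (s.A' k) ∅) +
      2 * m * τmin / (1 - ε) = ((1 + 1 / (m : ℝ)) * (gain f (s.A' i) ∅ + gain f (s.A' k) ∅) +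
        (1 - ε) * (2 * m * τmin)) / (1 - ε) ^ 2 := by
    field_simp
  rw [h5, le_div_iff₀ (by positivity)]
  linarith

/-- The sets `S \ A_k` and `S \ A_i` depend on the outcome, which is harmless because `PairInv` is
available for all pairs of sets. As `|S \ A_i| + |S ∩ A_i| ≤ m`, the deficit is zero. -/
theorem gain_add_gain_le_of_two (hf : Submodular f) (hε : 0 < ε) (hε1 : ε < 1)
    (hmin : 0 < τmin) {s : State U ℓ} (hs : Core f τmin ε s) (hh : s.Halted) {i k : Fin ℓ}
    (hik : i < k) (htwo : ∀ j, j = i ∨ j = k) {S : Finset U} (hS : S.card ≤ m)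
    (hinv : PairInv f τmin ε m i k (S \ s.A k) (S \ s.A i) s) :
    gain f S (s.A i) + gain f S (s.A k) ≤ 1 / (1 - ε) ^ 2 *
      (gain f (s.A' i) ∅ + gain f (s.A' k) ∅) + 2 * m * τmin / (1 - ε) := by
  have hη : 0 < 1 - ε := by linarith
  have hX : (S \ s.A k) ∩ s.A i = S ∩ s.A i := by
    ext x
    simp only [Finset.mem_inter, Finset.mem_sdiff]
    constructor
    · tauto
    · rintro ⟨h1, h2⟩
      exact ⟨⟨h1, Finset.disjoint_left.1 (hs.disj i k hik.ne) h2⟩, h2⟩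
  have hc : ((S \ s.A i).card : ℝ) + min ((((S \ s.A k) ∩ s.A i).card : ℕ) : ℝ) 1 ≤ m + 0 := by
    rw [hX, add_zero]
    have h1 : ((S ∩ s.A i).card : ℝ) + (S \ s.A i).card = S.card := by
      exact_mod_cast Finset.card_inter_add_card_sdiff S (s.A i)
    have h2 : (S.card : ℝ) ≤ m := by exact_mod_cast hS
    have h3 := min_le_left ((S ∩ s.A i).card : ℝ) 1
    linarith
  have h1 := pair_bound hf hε hε1 hmin hs hh hik hinv
    (fun j hj => by
      rw [(htwo j).resolve_left hj]
      exact Finset.sdiff_disjoint)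
    (fun j hj => by
      rw [(htwo j).resolve_right hj]
      exact Finset.sdiff_disjoint)
    ((Finset.card_le_card Finset.sdiff_subset).trans hS)
    ((Finset.card_le_card Finset.sdiff_subset).trans hS) le_rfl hc
  rw [gain_sdiff, gain_sdiff, zero_mul, add_zero] at h1
  have h2 : (1 - ε) * ((2 * m - (s.A i).card - (s.A k).card) * τmin) ≤
      (1 - ε) * (2 * m * τmin) := by
    apply mul_le_mul_of_nonneg_left (mul_le_mul_of_nonneg_right _ hmin.le) hη.le
    have h1 : (0 : ℝ) ≤ (s.A i).card := by positivity
    have h2 : (0 : ℝ) ≤ (s.A k).card := by positivity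
    linarith
  have h5 : 1 / (1 - ε) ^ 2 * (gain f (s.A' i) ∅ + gain f (s.A' k) ∅) +
      2 * m * τmin / (1 - ε) = ((gain f (s.A' i) ∅ + gain f (s.A' k) ∅) +
        (1 - ε) * (2 * m * τmin)) / (1 - ε) ^ 2 := by
    field_simp
  rw [h5, le_div_iff₀ (by positivity)]
  linarith

end Guarantee

end PIG
end

/-! ### From invariants to outcomes of the loop. -/

noncomputable section
namespace PIG

section Main

variable {U : Type*} [Fintype U] [DecidableEq U] [Nonempty U] {ℓ : ℕ}
variable {f : Finset U → ℝ} {τmin ε : ℝ} {m : ℕ}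

/-- Induction over the iterations of the loop. -/
theorem whileLoop_induction {P : State U ℓ → Prop}
    (hP : ∀ s t : State U ℓ, P s → ¬ s.Halted → t ∈ (iteration f τmin ε s).support →
      P t ∧ (t.m₀ < s.m₀ ∨ t.Halted)) (k : ℕ) :
    ∀ s t : State U ℓ, P s → (s.m₀ ≤ k ∨ s.Halted) → t ∈ (whileLoop f τmin ε k s).support →
      P t ∧ t.Halted := by
  induction k with
  | zero =>
    intro s t hs hk ht
    rw [whileLoop, PMF.mem_support_pure_iff] at ht
    subst ht
    exact ⟨hs, hk.elim (fun h => Or.inr (Nat.le_zero.1 h)) id⟩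
  | succ k ih =>
    intro s t hs hk ht
    rw [whileLoop] at ht
    split_ifs at ht with hh
    · rw [PMF.mem_support_pure_iff] at ht
      subst ht
      exact ⟨hs, hh⟩
    · rw [PMF.mem_support_bind_iff] at ht
      obtain ⟨u, hu, ht⟩ := ht
      obtain ⟨h1, h2⟩ := hP s u hs hh hu
      refine ih u t h1 (h2.imp (fun h => ?_) id) ht
      have := hk.resolve_right hh
      omega

theorem core_initial (hε : 0 < ε) (hε1 : ε < 1) (hmin : 0 < τmin) (f : Finset U → ℝ) (m ℓ : ℕ) :
    Core f τmin ε (initial f m ℓ) := by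
  refine ⟨?_, ?_, ?_, ?_, ?_, ?_, ?_⟩
  · intro i j _
    simp [initial]
  · intro l
    simp [initial]
  · intro l
    simp [initial]
  · intro l hl
    simp [initial] at hl
  · intro l x _ _
    simp [initial]
  · intro l x _
    simp only [initial]
    have h1 := gain_singleton_le_maxGain f x
    rcases le_or_gt 0 (gain f {x} ∅) with h | h
    · have h2 : 0 ≤ ε * gain f {x} ∅ := mul_nonneg hε.le h
      exact le_trans (by linarith) (le_max_left _ _)
    · exact le_trans (by nlinarith) (hmin.le.trans (le_max_right (maxGain f) τmin))
  · intro l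
    simp [initial, gain]

theorem balanced_initial (f : Finset U → ℝ) (m ℓ : ℕ) : Balanced m (initial f m ℓ) := by
  constructor <;> simp [initial]

/-- The invariants hold in every outcome, and every outcome is halted. -/
theorem outcome_spec (hf : Submodular f) (hℓ : 1 ≤ ℓ) (hε : 0 < ε) (hε1 : ε < 1)
    (hmin : 0 < τmin) {s : State U ℓ}
    (hs : s ∈ (parallelInterlaceGreedy f m ℓ τmin ε).support) :
    (Core f τmin ε s ∧ Balanced m s ∧ ∀ (i k : Fin ℓ) (O₁ O₂ : Finset U), i < k →
      PairInv f τmin ε m i k O₁ O₂ s) ∧ s.Halted := by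
  refine whileLoop_induction (P := fun s => Core f τmin ε s ∧ Balanced m s ∧
    ∀ (i k : Fin ℓ) (O₁ O₂ : Finset U), i < k → PairInv f τmin ε m i k O₁ O₂ s) ?_ m
    (initial f m ℓ) s ⟨core_initial hε hε1 hmin f m ℓ, balanced_initial f m ℓ, ?_⟩
    (Or.inl le_rfl) hs
  · rintro s t ⟨h1, h2, h3⟩ hh ht
    have hm : s.m₀ ≠ 0 := fun h => hh (Or.inr h)
    have h1r := h1.refresh hε hε1 hmin
    have h2r := h2.refresh (f := f) (τmin := τmin) (ε := ε)
    have h3r : ∀ (i k : Fin ℓ) (O₁ O₂ : Finset U), i < k →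
      PairInv f τmin ε m i k O₁ O₂ (refresh f τmin ε s) := fun i k O₁ O₂ hik =>
        (h3 i k O₁ O₂ hik).refresh hε hε1 hmin
    rcases iteration_spec hf hℓ hε hε1 hmin hm h1 ht with ⟨h, rfl⟩ | ⟨w, he⟩
    · exact ⟨⟨h1r, h2r, h3r⟩, Or.inr (Or.inl h)⟩
    · refine ⟨⟨he.core, h2r.extends he, fun i k O₁ O₂ hik =>
        (h3r i k O₁ O₂ hik).extends hf hε hε1 hmin hik h1r h2r he⟩, Or.inl ?_⟩
      have h4 := he.budget
      have h5 := he.pos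
      have h6 : (refresh f τmin ε s).m₀ = s.m₀ := rfl
      omega
  · intro i k O₁ O₂ _
    left
    simp [initial]

/-- The guarantees for every possible outcome. -/
theorem outcome_guarantees (hf : Submodular f) (hm : 1 ≤ m) (hℓ : 1 ≤ ℓ) (hε : 0 < ε)
    (hε1 : ε < 1) (hmin : 0 < τmin) {s : State U ℓ}
    (hs : s ∈ (parallelInterlaceGreedy f m ℓ τmin ε).support) :
    s.Halted ∧
    (∀ l, s.A' l ⊆ s.A l ∧ gain f (s.A l) ∅ ≤ gain f (s.A' l) ∅) ∧
    (∀ l₁ l₂, l₁ ≠ l₂ → Disjoint (s.A l₁) (s.A l₂)) ∧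
    (∀ O : Fin ℓ → Finset U, (∀ l, (O l).card ≤ m) →
      (∀ l j, j ≠ l → Disjoint (O l) (s.A j)) →
      (∀ l, gain f (O l) (s.A l) ≤
        gain f (s.A' l) ∅ / (1 - ε) ^ 2 + m * τmin / (1 - ε)) ∧
      (∀ l₁ l₂, l₁ < l₂ →
        gain f (O l₂) (s.A l₁) + gain f (O l₁) (s.A l₂) ≤
          (1 + 1 / (m : ℝ)) / (1 - ε) ^ 2 *
            (gain f (s.A' l₁) ∅ + gain f (s.A' l₂) ∅) +
          2 * m * τmin / (1 - ε))) ∧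
    (ℓ = 2 → ∀ l₁ l₂, l₁ < l₂ → ∀ S : Finset U, S.card ≤ m →
      gain f S (s.A l₁) + gain f S (s.A l₂) ≤
        1 / (1 - ε) ^ 2 * (gain f (s.A' l₁) ∅ + gain f (s.A' l₂) ∅) +
        2 * m * τmin / (1 - ε)) := by
  obtain ⟨⟨h1, h2, h3⟩, hh⟩ := outcome_spec hf hℓ hε hε1 hmin hs
  refine ⟨hh, fun l => ⟨h1.sub l, h1.mono l⟩, h1.disj, fun O hO hdis => ⟨fun l => ?_,
    fun i k hik => ?_⟩, fun htwo i k hik S hS => ?_⟩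
  · exact gain_le_of_outcome hf hε1 hmin h1 h2 hh (hO l) (hdis l)
  · exact gain_add_gain_le_of_outcome hf hε hε1 hmin hm h1 h2 hh hik (h3 i k _ _ hik) (hdis i)
      (hdis k) (hO i) (hO k)
  · refine gain_add_gain_le_of_two hf hε hε1 hmin h1 hh hik ?_ hS (h3 i k _ _ hik)
    subst htwo
    intro j
    have := hik
    rw [Fin.lt_def] at this
    rw [Fin.ext_iff, Fin.ext_iff]
    omega

end Main

end PIG
end

/-! ### Expectations, and a potential that pays for the rounds. -/

noncomputable section
namespace PIG

open scoped ENNReal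

/-! ### Expectations -/

section Expectation

variable {α β : Type*}

/-- The expectation of a nonnegative function. -/
def expect (p : PMF α) (g : α → ℝ≥0∞) : ℝ≥0∞ := ∑' a, p a * g a

theorem expect_pure (a : α) (g : α → ℝ≥0∞) : expect (PMF.pure a) g = g a := by
  unfold expect
  rw [tsum_eq_single a]
  · simp
  · intro b hb
    simp [hb]

theorem expect_bind (p : PMF α) (q : α → PMF β) (g : β → ℝ≥0∞) :
    expect (p.bind q) g = expect p fun a => expect (q a) g := by
  unfold expect
  simp only [PMF.bind_apply, ← ENNReal.tsum_mul_right, ← ENNReal.tsum_mul_left]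
  rw [ENNReal.tsum_comm]
  simp only [mul_assoc]

theorem expect_map (p : PMF α) (h : α → β) (g : β → ℝ≥0∞) :
    expect (p.map h) g = expect p fun a => g (h a) := by
  rw [← PMF.bind_pure_comp, expect_bind]
  simp only [Function.comp_apply, expect_pure]

theorem expect_mono {p : PMF α} {g h : α → ℝ≥0∞} (hle : ∀ a ∈ p.support, g a ≤ h a) :
    expect p g ≤ expect p h := by
  apply ENNReal.tsum_le_tsum
  intro a
  by_cases ha : a ∈ p.support
  · exact mul_le_mul_right (hle a ha) _
  · rw [PMF.mem_support_iff, not_not] at ha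
    simp [ha]

theorem expect_const (p : PMF α) (c : ℝ≥0∞) : expect p (fun _ => c) = c := by
  unfold expect
  rw [ENNReal.tsum_mul_right, p.tsum_coe, one_mul]

theorem expect_le_of_forall {p : PMF α} {g : α → ℝ≥0∞} {c : ℝ≥0∞}
    (hle : ∀ a ∈ p.support, g a ≤ c) : expect p g ≤ c :=
  (expect_mono hle).trans (expect_const p c).le

theorem expect_unif [Nonempty α] {s : Finset α} (hs : s.Nonempty) (g : α → ℝ≥0∞) :
    expect (unif s) g = (∑ a ∈ s, g a) / s.card := by
  classical
  unfold expect unif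
  rw [dif_pos hs, tsum_eq_sum (s := s)]
  · rw [ENNReal.div_eq_inv_mul, Finset.mul_sum]
    apply Finset.sum_congr rfl
    intro a ha
    rw [PMF.uniformOfFinset_apply, if_pos ha]
  · intro a ha
    rw [PMF.uniformOfFinset_apply, if_neg ha, zero_mul]

/-- Markov's inequality for the complement of `S`. -/
theorem one_sub_le_toOuterMeasure (p : PMF α) (g : α → ℝ≥0∞) (S : Set α) {δ : ℝ≥0∞}
    (hS : ∀ a ∉ S, 1 ≤ δ * g a) {G : ℝ≥0∞} (hg : expect p g ≤ G) :
    1 - δ * G ≤ p.toOuterMeasure S := by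
  rw [tsub_le_iff_right, ← p.tsum_coe, PMF.toOuterMeasure_apply]
  calc ∑' a, p a ≤ ∑' a, (S.indicator p a + δ * (p a * g a)) := by
        apply ENNReal.tsum_le_tsum
        intro a
        by_cases ha : a ∈ S
        · rw [Set.indicator_of_mem ha]
          exact le_self_add
        · rw [Set.indicator_of_notMem ha, zero_add]
          calc p a = p a * 1 := (mul_one _).symm
            _ ≤ p a * (δ * g a) := mul_le_mul_right (hS a ha) _
            _ = δ * (p a * g a) := by ring
    _ = ∑' a, S.indicator p a + δ * expect p g := by
        rw [ENNReal.tsum_add, ENNReal.tsum_mul_left, expect]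
    _ ≤ _ := add_le_add_right (mul_le_mul_right hg _) _

end Expectation

/-! ### The potential -/

section Potential

variable {U : Type*} [Fintype U] [DecidableEq U] {ℓ : ℕ}
variable {f : Finset U → ℝ} {τmin ε : ℝ} {s t : State U ℓ}

/-- The number of times a threshold can be lowered before it falls below `τmin`. -/
def levels (τmin ε τ : ℝ) : ℕ := sInf {k : ℕ | (1 - ε) ^ k * τ < τmin}

/-- Passes start only at thresholds of at least `τmin`, so each uses up a level. -/
theorem levels_add_le (hε : 0 < ε) (hmin : 0 < τmin) {τ : ℝ} {K : ℕ}
    (hK : ∀ k < K, τmin ≤ (1 - ε) ^ k * τ) :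
    levels τmin ε ((1 - ε) ^ K * τ) + K ≤ levels τmin ε τ := by
  have h1 : (1 - ε) ^ levels τmin ε τ * τ < τmin :=
    Nat.sInf_mem (s := {k : ℕ | (1 - ε) ^ k * τ < τmin}) (exists_pow_mul_lt hε hmin τ)
  have h2 : K ≤ levels τmin ε τ := by
    by_contra hc
    exact absurd (hK _ (not_le.1 hc)) (not_le.2 h1)
  have h3 : levels τmin ε ((1 - ε) ^ K * τ) ≤ levels τmin ε τ - K := by
    apply Nat.sInf_le
    rw [Set.mem_ofPred_eq, ← mul_assoc, ← pow_add, Nat.sub_add_cancel h2]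
    exact h1
  omega

theorem levels_le (hε : 0 < ε) (hε1 : ε < 1) (hmin : 0 < τmin) {τ : ℝ} (hτ : τmin ≤ τ) :
    (levels τmin ε τ : ℝ) ≤ Real.log (τ / τmin) / ε + 1 := by
  by_contra hc
  rw [not_le] at hc
  have h0 : 0 ≤ Real.log (τ / τmin) / ε :=
    div_nonneg (Real.log_nonneg ((one_le_div hmin).2 hτ)) hε.le
  obtain ⟨k, hk⟩ : ∃ k, levels τmin ε τ = k + 1 := by
    apply Nat.exists_eq_succ_of_ne_zero
    rintro h
    rw [h] at hc
    norm_num at hc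
    linarith
  have h1 : k ∉ {k : ℕ | (1 - ε) ^ k * τ < τmin} := by
    apply Nat.notMem_of_lt_sInf
    change k < levels τmin ε τ
    omega
  rw [Set.mem_ofPred_eq, not_lt] at h1
  rw [hk] at hc
  push_cast at hc
  have h2 : Real.log (τ / τmin) / ε < k := by linarith
  rw [div_lt_iff₀ hε] at h2
  have hτ0 : 0 < τ := hmin.trans_le hτ
  have h3 : (1 - ε) ^ k ≤ Real.exp (-(k * ε)) := by
    have : 1 - ε ≤ Real.exp (-ε) := by
      have := Real.add_one_le_exp (-ε)
      linarith
    calc (1 - ε) ^ k ≤ Real.exp (-ε) ^ k := pow_le_pow_left₀ (by linarith) this k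
      _ = Real.exp (-(k * ε)) := by
        rw [← Real.exp_nat_mul]
        congr 1
        ring
  have h4 : Real.exp (-(k * ε)) < τmin / τ := by
    rw [← Real.exp_log (div_pos hmin hτ0), Real.exp_lt_exp, Real.log_div hmin.ne' hτ0.ne']
    rw [Real.log_div hτ0.ne' hmin.ne'] at h2
    linarith
  rw [lt_div_iff₀ hτ0] at h4
  have := mul_le_mul_of_nonneg_right h3 hτ0.le
  linarith

/-- The candidates that remain after filtering. -/
def live (f : Finset U → ℝ) (s : State U ℓ) (j : Fin ℓ) : Finset U :=
  (s.V j ∩ s.outside).filter fun x => s.τ j ≤ gain f {x} (s.A j)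

/-- The price of a level. -/
def levelPrice (U : Type*) [Fintype U] : ℝ := Real.log (1 + Fintype.card U) + 1

theorem log_card_nonneg (n : ℕ) : 0 ≤ Real.log (1 + (n : ℝ)) :=
  Real.log_nonneg (by linarith [(Nat.cast_nonneg n : (0 : ℝ) ≤ n)])

/-- The contribution of solution `j` to the potential. -/
def share (f : Finset U → ℝ) (τmin ε : ℝ) (s : State U ℓ) (j : Fin ℓ) : ℝ :=
  Real.log (1 + ((live f s j).card : ℝ)) + levels τmin ε (s.τ j) * levelPrice U

theorem share_nonneg (f : Finset U → ℝ) (τmin ε : ℝ) (s : State U ℓ) (j : Fin ℓ) :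
    0 ≤ share f τmin ε s j := by
  have h1 := log_card_nonneg (live f s j).card
  have h2 := log_card_nonneg (Fintype.card U)
  unfold share levelPrice
  positivity

/-- From `log x ≤ x - 1`; it turns a removed fraction of candidates into a drop of potential. -/
theorem log_sub_log_ge {v v' : ℕ} : ((v : ℝ) - v') / (1 + v) ≤
    Real.log (1 + (v : ℝ)) - Real.log (1 + (v' : ℝ)) := by
  have h0 : (0 : ℝ) < 1 + v := by positivity
  have h0' : (0 : ℝ) < 1 + v' := by positivity
  have h1 := Real.log_le_sub_one_of_pos (div_pos h0' h0)
  rw [Real.log_div h0'.ne' h0.ne'] at h1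
  have h2 : ((v : ℝ) - v') / (1 + v) = -((1 + (v' : ℝ)) / (1 + v) - 1) := by
    field_simp
    ring
  rw [h2]
  linarith

theorem share_le_of_live_subset (h : live f t j ⊆ live f s j) (hτ : t.τ j = s.τ j) :
    share f τmin ε t j ≤ share f τmin ε s j := by
  unfold share
  rw [hτ]
  apply add_le_add_left
  apply Real.log_le_log (by positivity)
  have : ((live f t j).card : ℝ) ≤ (live f s j).card := by
    exact_mod_cast Finset.card_le_card h
  linarith

/-- The number of passes of Update in the parallel execution. -/
def passes (f : Finset U → ℝ) (τmin ε : ℝ) (s : State U ℓ) (j : Fin ℓ) : ℕ :=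
  updateSteps f (s.A j) s.outside (s.V j) (s.τ j) τmin ε

/-- A pass may refill the candidate set up to the whole ground set; the level price `log (1 + n) +
1` covers that and one unit more per pass. -/
theorem share_runUpdate_add_le (hε : 0 < ε) (hmin : 0 < τmin) (J : Finset (Fin ℓ)) {j : Fin ℓ}
    (hj : j ∈ J) :
    share f τmin ε (runUpdate f τmin ε J s) j + passes f τmin ε s j ≤ share f τmin ε s j := by
  have hτ : (runUpdate f τmin ε J s).τ j = (1 - ε) ^ passes f τmin ε s j * s.τ j := by
    simp only [runUpdate, hj, if_true]
    rfl
  rcases Nat.eq_zero_or_pos (passes f τmin ε s j) with h0 | h0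
  · rw [h0, Nat.cast_zero, add_zero]
    rw [h0, pow_zero, one_mul] at hτ
    refine share_le_of_live_subset ?_ hτ
    intro x hx
    have h1 := Finset.mem_filter.1 hx
    rw [hτ] at h1
    refine Finset.mem_filter.2 ⟨?_, h1.2⟩
    have h2 : x ∈ (runUpdate f τmin ε J s).V j := (Finset.mem_inter.1 h1.1).1
    simp only [runUpdate, hj, if_true] at h2
    rw [show updateSteps f (s.A j) s.outside (s.V j) (s.τ j) τmin ε = 0 from h0,
      updateSet, if_pos rfl] at h2
    exact (Finset.mem_filter.1 h2).1
  · have h1 := levels_add_le (τ := s.τ j) (K := passes f τmin ε s j) hε hmin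
      (fun k hk => (of_lt_updateSteps hk).2)
    unfold share
    rw [hτ]
    have h2 : Real.log (1 + ((live f (runUpdate f τmin ε J s) j).card : ℝ)) ≤
        Real.log (1 + Fintype.card U) := by
      apply Real.log_le_log (by positivity)
      have : ((live f (runUpdate f τmin ε J s) j).card : ℝ) ≤ Fintype.card U := by
        exact_mod_cast Finset.card_le_univ _
      linarith
    have h3 := log_card_nonneg (live f s j).card
    have h4 := log_card_nonneg (Fintype.card U)
    have h5 : (levels τmin ε ((1 - ε) ^ passes f τmin ε s j * s.τ j) : ℝ) +
        passes f τmin ε s j ≤ levels τmin ε (s.τ j) := by exact_mod_cast h1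
    have h6 : (1 : ℝ) ≤ passes f τmin ε s j := by exact_mod_cast h0
    have h7 : (0 : ℝ) ≤ levelPrice U := by unfold levelPrice; linarith
    have h8 := mul_le_mul_of_nonneg_right h5 h7
    have h9 : Real.log (1 + Fintype.card U) + passes f τmin ε s j ≤
        passes f τmin ε s j * levelPrice U := by
      unfold levelPrice
      have := mul_le_mul_of_nonneg_right h6 h4
      linarith
    linarith

theorem share_runUpdate_of_notMem (J : Finset (Fin ℓ)) {j : Fin ℓ} (hj : j ∉ J) :
    share f τmin ε (runUpdate f τmin ε J s) j = share f τmin ε s j := by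
  have h1 : (runUpdate f τmin ε J s).τ j = s.τ j := by simp only [runUpdate, hj, if_false]
  have h2 : (runUpdate f τmin ε J s).V j = s.V j := by simp only [runUpdate, hj, if_false]
  have h3 : live f (runUpdate f τmin ε J s) j = live f s j := by
    unfold live
    rw [h1, h2]
    rfl
  unfold share
  rw [h1, h3]

/-- The weight of the shares in the potential. -/
def unit (ℓ : ℕ) (ε : ℝ) : ℝ := 24 * ℓ / ε

theorem le_unit (hℓ : 1 ≤ ℓ) (hε : 0 < ε) (hε1 : ε < 1) : 24 ≤ unit ℓ ε := by
  unfold unit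
  rw [le_div_iff₀ hε]
  have : (1 : ℝ) ≤ ℓ := by exact_mod_cast hℓ
  nlinarith

/-- The potential of a state. -/
def potential (f : Finset U → ℝ) (τmin ε : ℝ) (s : State U ℓ) : ℝ :=
  unit ℓ ε * ∑ j ∈ s.I, share f τmin ε s j + if s.m₀ = 0 then 0 else 1

/-- The rounds used so far and the potential. -/
def total (f : Finset U → ℝ) (τmin ε : ℝ) (s : State U ℓ) : ℝ :=
  s.log.rounds / 8 + potential f τmin ε s

theorem potential_le (hℓ : 1 ≤ ℓ) (hε : 0 < ε) (hε1 : ε < 1) (hI : t.I ⊆ s.I)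
    (hm : t.m₀ ≤ s.m₀) {δ : Fin ℓ → ℝ}
    (hsh : ∀ j ∈ s.I, share f τmin ε t j + δ j ≤ share f τmin ε s j) :
    potential f τmin ε t + unit ℓ ε * ∑ j ∈ s.I, δ j ≤ potential f τmin ε s := by
  have hu : 0 ≤ unit ℓ ε := by linarith [le_unit hℓ hε hε1]
  have h1 : ∑ j ∈ t.I, share f τmin ε t j ≤ ∑ j ∈ s.I, share f τmin ε t j :=
    Finset.sum_le_sum_of_subset_of_nonneg hI fun j _ _ => share_nonneg _ _ _ _ _
  have h2 := Finset.sum_le_sum hsh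
  rw [Finset.sum_add_distrib] at h2
  have h3 : (if t.m₀ = 0 then (0 : ℝ) else 1) ≤ if s.m₀ = 0 then 0 else 1 := by
    split_ifs <;> first | omega | norm_num
  have h4 := mul_le_mul_of_nonneg_left (h1.trans (by linarith : _ ≤
    ∑ j ∈ s.I, share f τmin ε s j - ∑ j ∈ s.I, δ j)) hu
  unfold potential
  linarith

theorem length_parallel {U : Type*} (J : Finset (Fin ℓ)) (T : Fin ℓ → Transcript U) :
    (parallel J T).length = J.sup fun j => (T j).length := by
  simp [parallel]

theorem rounds_runUpdate (J : Finset (Fin ℓ)) :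
    ((runUpdate f τmin ε J s).log.rounds : ℝ) ≤
      s.log.rounds + (1 + ∑ j ∈ J, (passes f τmin ε s j : ℝ)) := by
  have : (runUpdate f τmin ε J s).log.rounds ≤
      s.log.rounds + (1 + ∑ j ∈ J, passes f τmin ε s j) := by
    unfold Transcript.rounds
    simp only [runUpdate]
    rw [List.length_append, length_parallel]
    apply Nat.add_le_add_left
    apply Finset.sup_le
    intro j hj
    have h1 := Finset.single_le_sum (f := fun j => passes f τmin ε s j)
      (fun j _ => Nat.zero_le _) hj
    simp only [updateTranscript, List.length_cons, List.length_replicate]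
    rw [add_comm]
    exact Nat.add_le_add_left h1 1
  exact_mod_cast this

/-- The filtering round costs `1/8`. Each pass costs at most another `1/8` but releases at least
`24`, so a surplus of `23` per pass is safe. -/
theorem total_runUpdate_le (hℓ : 1 ≤ ℓ) (hε : 0 < ε) (hε1 : ε < 1) (hmin : 0 < τmin)
    {J : Finset (Fin ℓ)} (hJ : J ⊆ s.I) :
    total f τmin ε (runUpdate f τmin ε J s) +
      23 * ∑ j ∈ J, (passes f τmin ε s j : ℝ) ≤ total f τmin ε s + 1 / 8 := by
  have h1 := rounds_runUpdate (f := f) (τmin := τmin) (ε := ε) (s := s) J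
  have h2 := potential_le (f := f) (τmin := τmin) (s := s) (t := runUpdate f τmin ε J s)
    (δ := fun j => if j ∈ J then (passes f τmin ε s j : ℝ) else 0) hℓ hε hε1 subset_rfl le_rfl
    (fun j _ => by
      split_ifs with hj
      · exact share_runUpdate_add_le hε hmin J hj
      · rw [share_runUpdate_of_notMem J hj, add_zero])
  rw [← Finset.sum_filter, Finset.filter_mem_eq_inter, Finset.inter_eq_right.2 hJ] at h2
  have h3 : 0 ≤ ∑ j ∈ J, (passes f τmin ε s j : ℝ) := by positivity
  have h4 := mul_le_mul_of_nonneg_right (le_unit hℓ hε hε1) h3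
  unfold total
  linarith

theorem potential_restrict_le (hℓ : 1 ≤ ℓ) (hε : 0 < ε) (hε1 : ε < 1) {I' : Finset (Fin ℓ)}
    (hI : I' ⊆ s.I) : potential f τmin ε { s with I := I' } ≤ potential f τmin ε s := by
  have := potential_le (f := f) (τmin := τmin) (s := s) (t := { s with I := I' })
    (δ := fun _ => 0) hℓ hε hε1 hI le_rfl (fun j _ => (add_zero _).le)
  simpa using this

theorem total_refresh_le (hℓ : 1 ≤ ℓ) (hε : 0 < ε) (hε1 : ε < 1) (hmin : 0 < τmin) :
    total f τmin ε (refresh f τmin ε s) + 23 * ∑ j ∈ s.I, (passes f τmin ε s j : ℝ) ≤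
      total f τmin ε s + 1 / 8 := by
  refine le_trans ?_ (total_runUpdate_le (f := f) (s := s) hℓ hε hε1 hmin subset_rfl)
  apply add_le_add_left
  unfold total
  exact add_le_add_right (potential_restrict_le hℓ hε hε1 (Finset.filter_subset _ _)) _

theorem live_push_subset (hf : Submodular f) {j : Fin ℓ} {x : U} (l : Fin ℓ) :
    live f (push j x s) l ⊆ live f s l := by
  intro y hy
  have h1 := Finset.mem_filter.1 hy
  have h2 := Finset.mem_inter.1 h1.1
  have h3 : y ∈ (s.V l).erase x := h2.1
  have h4 := mem_outside_push.1 h2.2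
  refine Finset.mem_filter.2 ⟨Finset.mem_inter.2 ⟨Finset.mem_of_mem_erase h3, h4.1⟩,
    h1.2.trans ?_⟩
  refine hf.gain_singleton_anti ?_ (mem_outside.1 h2.2 l)
  simp only [push]
  by_cases hl : l = j
  · subst hl
    rw [Function.update_self]
    exact Finset.subset_insert _ _
  · rw [Function.update_of_ne hl]

theorem potential_push_le (hf : Submodular f) (hℓ : 1 ≤ ℓ) (hε : 0 < ε) (hε1 : ε < 1)
    (j : Fin ℓ) (x : U) : potential f τmin ε (push j x s) ≤ potential f τmin ε s := by
  have := potential_le (f := f) (τmin := τmin) (s := s) (t := push j x s)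
    (δ := fun _ => 0) hℓ hε hε1 subset_rfl le_rfl
    (fun l _ => (add_zero _).le.trans (share_le_of_live_subset (live_push_subset hf l) rfl))
  simpa using this

/-- Among fewer than `2ℓ` candidates, losing one lowers the logarithm by at least `1/(2ℓ)`, and
`unit` magnifies this to `12/ε`. -/
theorem potential_push_add_le (hf : Submodular f) (hℓ : 1 ≤ ℓ) (hε : 0 < ε) (hε1 : ε < 1)
    {j : Fin ℓ} {x : U} (hj : Pending f τmin s j) (hx : x ∈ s.V j)
    (hV : (s.V j).card < 2 * ℓ) :
    potential f τmin ε (push j x s) + 1 ≤ potential f τmin ε s := by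
  have hℓ0 : (0 : ℝ) < ℓ := by exact_mod_cast hℓ
  have hxl : x ∈ live f s j := Finset.mem_filter.2
    ⟨Finset.mem_inter.2 ⟨hx, hj.2.2.1 hx⟩, hj.2.2.2 x hx⟩
  have hlt : (live f (push j x s) j).card + 1 ≤ (live f s j).card := by
    apply Finset.card_lt_card
    refine ⟨live_push_subset hf j, fun h => ?_⟩
    have h1 := h hxl
    have h2 : x ∈ (s.V j).erase x := (Finset.mem_inter.1 (Finset.mem_filter.1 h1).1).1
    simp at h2
  have hle : (live f s j).card + 1 ≤ 2 * ℓ := by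
    have : (live f s j).card ≤ (s.V j).card :=
      Finset.card_le_card ((Finset.filter_subset _ _).trans Finset.inter_subset_left)
    omega
  have h := potential_le (f := f) (τmin := τmin) (s := s) (t := push j x s)
    (δ := fun l => if l = j then 1 / (2 * ℓ : ℝ) else 0) hℓ hε hε1 subset_rfl le_rfl
    (fun l _ => by
      split_ifs with hl
      · subst hl
        have h1 := log_sub_log_ge (v := (live f s l).card) (v' := (live f (push l x s) l).card)
        have h2 : 1 / (2 * ℓ : ℝ) ≤ (((live f s l).card : ℝ) - (live f (push l x s) l).card) /
            (1 + (live f s l).card) := by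
          have h3 : ((live f (push l x s) l).card : ℝ) + 1 ≤ (live f s l).card := by
            exact_mod_cast hlt
          have h4 : ((live f s l).card : ℝ) + 1 ≤ 2 * ℓ := by exact_mod_cast hle
          apply div_le_div₀ <;> linarith
        have h3 : (push l x s).τ l = s.τ l := rfl
        unfold share
        rw [h3]
        linarith
      · rw [add_zero]
        exact share_le_of_live_subset (live_push_subset hf l) rfl)
  rw [Finset.sum_ite_eq' s.I j, if_pos hj.1] at h
  have h5 : 1 ≤ unit ℓ ε * (1 / (2 * ℓ : ℝ)) := by
    unfold unit
    rw [div_mul_div_comm, one_le_div (by positivity)]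
    nlinarith
  linarith

/-- An empty `V_j` forces a pass of Update, whose surplus pays for the filtering round. Otherwise
the turn makes no query, and with few candidates the choice of `x` lowers the potential. -/
theorem total_addOne_le [Nonempty U] (hf : Submodular f) (hℓ : 1 ≤ ℓ) (hε : 0 < ε) (hε1 : ε < 1)
    (hmin : 0 < τmin) {j : Fin ℓ} (hj : Pending f τmin s j)
    (ht : t ∈ (addOne f τmin ε j s).support) :
    total f τmin ε t + (if (s.V j).card < 2 * ℓ then 1 / 8 else 0) ≤ total f τmin ε s := by
  have hlast : total f τmin ε t ≤ total f τmin ε (turnUpdate f τmin ε j s) := by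
    unfold total
    rcases mem_support_addOne hε hmin ht with ⟨-, rfl⟩ | ⟨-, x, -, rfl⟩
    · exact add_le_add_right (potential_restrict_le hℓ hε hε1 (Finset.erase_subset _ _)) _
    · exact add_le_add_right (potential_push_le hf hℓ hε hε1 j x) _
  by_cases hV : s.V j = ∅
  · have h1 := total_runUpdate_le (f := f) (s := s) hℓ hε hε1 hmin
      (Finset.singleton_subset_iff.2 hj.1)
    rw [turnUpdate, if_pos hV] at hlast
    rw [Finset.sum_singleton] at h1
    have h2 : 1 ≤ passes f τmin ε s j := by
      rw [Nat.one_le_iff_ne_zero]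
      intro h0
      have h3 := updateSteps_spec f (s.A j) s.outside (s.V j) (s.τ j) hε hmin
      rw [show updateSteps f (s.A j) s.outside (s.V j) (s.τ j) τmin ε = 0 from h0] at h3
      apply h3
      refine ⟨?_, by simpa using hj.2.1⟩
      rw [updateSet, if_pos rfl, hV, Finset.empty_inter, Finset.filter_empty]
    have h3 : (1 : ℝ) ≤ passes f τmin ε s j := by exact_mod_cast h2
    split_ifs <;> linarith
  · have hs : turnUpdate f τmin ε j s = s := by rw [turnUpdate, if_neg hV]
    split_ifs with hc
    · rcases mem_support_addOne hε hmin ht with ⟨h1, -⟩ | ⟨-, x, hx, rfl⟩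
      · rw [hs] at h1
        exact absurd hj.2.1 (not_le.2 h1)
      · rw [hs] at hx ⊢
        have := potential_push_add_le (τmin := τmin) hf hℓ hε hε1 hj hx hc
        unfold total
        simp only [push] at this ⊢
        linarith
    · rw [hs] at hlast
      linarith

theorem card_V_addOne_le [Nonempty U] (hε : 0 < ε) (hmin : 0 < τmin) {j l : Fin ℓ} (hl : l ≠ j)
    (ht : t ∈ (addOne f τmin ε j s).support) : (t.V l).card ≤ (s.V l).card := by
  rcases mem_support_addOne hε hmin ht with ⟨-, rfl⟩ | ⟨-, x, -, rfl⟩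
  · simp only [turnUpdate_V_of_ne hl, le_refl]
  · simp only [push, turnUpdate_V_of_ne hl]
    exact Finset.card_le_card (Finset.erase_subset _ _)

/-- The drop of `1/8` repays the filtering round of the first phase. A solution with few candidates
still has few at its own turn, since earlier turns only delete from its set. -/
theorem total_addInTurn_le [Nonempty U] (hf : Submodular f) (hℓ : 1 ≤ ℓ) (hε : 0 < ε)
    (hε1 : ε < 1) (hmin : 0 < τmin) (js : List (Fin ℓ)) : ∀ (s t : State U ℓ), js.Nodup →
      Core f τmin ε s → (∀ j ∈ js, Pending f τmin s j) →
      t ∈ (addInTurn f τmin ε js s).support →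
      total f τmin ε t + (if ∃ j ∈ js, (s.V j).card < 2 * ℓ then 1 / 8 else 0) ≤
        total f τmin ε s := by
  induction js with
  | nil =>
    intro s t _ _ _ ht
    rw [addInTurn, PMF.mem_support_pure_iff] at ht
    subst ht
    simp
  | cons j js ih =>
    intro s t hnd hs hp ht
    rw [addInTurn, PMF.mem_support_bind_iff] at ht
    obtain ⟨u, hu, ht⟩ := ht
    rw [List.nodup_cons] at hnd
    obtain ⟨h1, hpu⟩ := turns_addOne hf hε hε1 hmin hs (hp j (by simp)) hu
    have h2 := ih u t hnd.2 h1.core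
      (fun k hk => hpu k (ne_of_mem_of_not_mem hk hnd.1) (hp k (by simp [hk]))) ht
    have h3 := total_addOne_le hf hℓ hε hε1 hmin (hp j (by simp)) hu
    by_cases hj : (s.V j).card < 2 * ℓ
    · rw [if_pos hj] at h3
      rw [if_pos ⟨j, by simp, hj⟩]
      have : (0 : ℝ) ≤ if ∃ j ∈ js, (u.V j).card < 2 * ℓ then 1 / 8 else 0 := by
        split_ifs <;> norm_num
      linarith
    · rw [if_neg hj] at h3
      have h4 : (∃ i ∈ j :: js, (s.V i).card < 2 * ℓ) → ∃ i ∈ js, (u.V i).card < 2 * ℓ := by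
        rintro ⟨i, hi, hc⟩
        rcases List.mem_cons.1 hi with rfl | hi
        · exact absurd hc hj
        · exact ⟨i, hi, (card_V_addOne_le hε hmin (ne_of_mem_of_not_mem hi hnd.1) hu).trans_lt hc⟩
      by_cases hex : ∃ i ∈ j :: js, (s.V i).card < 2 * ℓ
      · rw [if_pos (h4 hex)] at h2
        rw [if_pos hex]
        linarith
      · rw [if_neg hex]
        have : (0 : ℝ) ≤ if ∃ j ∈ js, (u.V j).card < 2 * ℓ then 1 / 8 else 0 := by
          split_ifs <;> norm_num
        linarith

end Potential

end PIG
end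

noncomputable section
namespace PIG

open scoped ENNReal

section Blocks

variable {U : Type*} [DecidableEq U] {ℓ : ℕ}
variable {f : Finset U → ℝ} {τmin ε : ℝ} {s : State U ℓ}

/-! ### Progress by adding blocks -/

/-- After `T` is added to `A_j`, the element `x` no longer passes the threshold. -/
def Below (f : Finset U → ℝ) (s : State U ℓ) (j : Fin ℓ) (T : Finset U) (x : U) : Prop :=
  gain f {x} (s.A j ∪ T) < s.τ j

/-- Being below the threshold after a prefix is the negation of being marked true, which links the
random-ordering estimates to prefix selection. -/
theorem badCount_add_countP_marks (f : Finset U → ℝ) (A : Finset U)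
    (τ : ℝ) (L : List U) : ∀ T, badCount (fun T x => gain f {x} (A ∪ T) < τ) T L +
      (marks f (A ∪ T) τ L).countP (fun p => p.2 = some true) = L.length := by
  induction L with
  | nil => intro T; simp [badCount, marks_nil]
  | cons x L ih =>
    intro T
    have h1 := ih (insert x T)
    have h2 : A ∪ insert x T = A ∪ T ∪ {x} := by
      rw [Finset.insert_eq, Finset.union_comm {x} T, Finset.union_assoc]
    rw [h2] at h1
    rw [badCount, marks_cons, List.countP_cons, List.length_cons]
    by_cases h : gain f {x} (A ∪ T) < τ
    · have h3 : mark f (A ∪ T) τ x ≠ some true := fun h' =>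
        absurd h (not_lt.2 (mark_eq_true_iff.1 h'))
      simp only [h, h3, if_true, decide_false, Bool.false_eq_true, if_false]
      omega
    · have h3 : mark f (A ∪ T) τ x = some true := mark_eq_true_iff.2 (not_lt.1 h)
      simp only [h, h3, if_false, decide_true, if_true]
      omega

theorem badCount_below_add_countP_marks (f : Finset U → ℝ) (s : State U ℓ) (j : Fin ℓ)
    (L : List U) : badCount (Below f s j) ∅ L +
      (marks f (s.A j) (s.τ j) L).countP (fun p => p.2 = some true) = L.length := by
  have := badCount_add_countP_marks f (s.A j) (s.τ j) L ∅
  rwa [Finset.union_empty] at this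

/-- The elements of the block that is added to solution `j`. -/
def blockSet (f : Finset U → ℝ) (ε : ℝ) (s : State U ℓ) (h : s.I.Nonempty) (size : ℕ)
    (L : Fin ℓ → List U) (j : Fin ℓ) : Finset U :=
  ((block f ε s h size L j).map Prod.fst).toFinset

/-- Elements of `D` that fall below the threshold stop being live. Since `|D| = ⌊|V_j|/ℓ⌋ ≥ 2`, one
has `1 + |V_j| ≤ 2ℓ |D|`, so a proportion of `D` counts for at least `1/(2ℓ)` of it in `V_j`. -/
theorem share_blockStep_add_le [Fintype U] (h : s.I.Nonempty) {size : ℕ}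
    {L : Fin ℓ → List U} {j : Fin ℓ} (hj : Pending f τmin s j) {D : Finset U} (hD : D ⊆ s.V j)
    (hcard : D.card = (s.V j).card / ℓ) (hV : 2 * ℓ ≤ (s.V j).card) (hℓ : 1 ≤ ℓ) :
    share f τmin ε (blockStep f ε s h size L) j +
      badRatio (Below f s j) D (blockSet f ε s h size L j) / (2 * ℓ) ≤ share f τmin ε s j := by
  classical
  set t := blockStep f ε s h size L with ht
  set S := blockSet f ε s h size L j with hS
  set B := D.filter (Below f s j S) with hB
  have hlive : live f s j = s.V j := by
    apply Finset.Subset.antisymm ((Finset.filter_subset _ _).trans Finset.inter_subset_left)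
    intro x hx
    exact Finset.mem_filter.2 ⟨Finset.mem_inter.2 ⟨hx, hj.2.2.1 hx⟩, hj.2.2.2 x hx⟩
  have hsub : live f t j ⊆ s.V j \ B := by
    intro x hx
    have h1 := Finset.mem_filter.1 hx
    refine Finset.mem_sdiff.2 ⟨(Finset.mem_inter.1 h1.1).1, fun hxB => ?_⟩
    have h2 : gain f {x} (s.A j ∪ S) < s.τ j := (Finset.mem_filter.1 hxB).2
    have h3 : t.A j = s.A j ∪ S := by
      simp only [ht, blockStep, hj.1, if_true, hS, blockSet]
    have h4 := h1.2
    rw [h3] at h4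
    exact absurd h2 (not_lt.2 h4)
  have hBV : B ⊆ s.V j := (Finset.filter_subset _ _).trans hD
  have h1 : ((live f t j).card : ℝ) + B.card ≤ (s.V j).card := by
    have := Finset.card_le_card hsub
    rw [Finset.card_sdiff_of_subset hBV] at this
    have h2 := Finset.card_le_card hBV
    have : (live f t j).card + B.card ≤ (s.V j).card := by omega
    exact_mod_cast this
  have hD1 : 2 ≤ D.card := by
    rw [hcard, Nat.le_div_iff_mul_le (by omega)]
    exact hV
  have h2 : (1 : ℝ) + (s.V j).card ≤ D.card * (2 * ℓ) := by
    have h3 := Nat.lt_mul_div_succ (s.V j).card (show 0 < ℓ by omega)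
    rw [← hcard] at h3
    have : 1 + (s.V j).card ≤ D.card * (2 * ℓ) := by nlinarith
    exact_mod_cast this
  have h3 := log_sub_log_ge (v := (s.V j).card) (v' := (live f t j).card)
  have h4 : badRatio (Below f s j) D S / (2 * ℓ) ≤
      (((s.V j).card : ℝ) - (live f t j).card) / (1 + (s.V j).card) := by
    have : badRatio (Below f s j) D S = (B.card : ℝ) / D.card := by
      rw [badRatio, hB]
    rw [this, div_div]
    apply div_le_div₀
    · linarith [(Nat.cast_nonneg B.card : (0 : ℝ) ≤ B.card)]
    · linarith
    · positivity
    · exact h2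
  have h5 : t.τ j = s.τ j := rfl
  unfold share
  rw [h5, hlive]
  linarith

variable {L : Fin ℓ → List U} {D : Fin ℓ → Finset U} {size : ℕ}

/-- The clean part carries only true marks and is chosen first. The block need not contain the first
`w` elements of the ordering, which is why `Fails` measures the solutions at their clean parts. -/
theorem take_cleanLength_subset_blockSet (h : s.I.Nonempty) {j : Fin ℓ} (hj : j ∈ s.I) :
    ((L j).take (cleanLength (Below f s j) (blockLength f ε s h size L) (L j))).toFinset ⊆
      blockSet f ε s h size L j := by
  set w := blockLength f ε s h size L with hw
  set c := cleanLength (Below f s j) w (L j) with hc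
  set q := prefixLength ε size (blockMarks f s size L j) with hq
  have hwq : w ≤ q := Finset.inf'_le _ hj
  have hqs : q ≤ size := prefixLength_le _ _ _
  have hcw : c ≤ w := Nat.findGreatest_le _
  have hc0 : badCount (Below f s j) ∅ ((L j).take c) = 0 :=
    Nat.findGreatest_spec (P := fun t => badCount (Below f s j) ∅ ((L j).take t) = 0)
      (Nat.zero_le w) (by simp [badCount])
  have hP : ((blockMarks f s size L j).take q).take c =
      marks f (s.A j) (s.τ j) ((L j).take c) := by
    rw [List.take_take, blockMarks, take_marks, List.take_take]
    congr 2
    omega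
  have htrue : ∀ p ∈ ((blockMarks f s size L j).take q).take c, p.2 = some true := by
    have h1 := badCount_below_add_countP_marks f s j ((L j).take c)
    rw [hc0, zero_add, ← length_marks (f := f) (s.A j) (s.τ j) ((L j).take c),
      List.countP_eq_length] at h1
    rw [hP]
    simpa using h1
  have hsub := take_subset_threePass hcw htrue
  intro x hx
  rw [List.mem_toFinset, ← map_fst_marks (f := f) (s.τ j) ((L j).take c) (s.A j), ← hP,
    List.mem_map] at hx
  obtain ⟨p, hp, rfl⟩ := hx
  exact List.mem_toFinset.2 (List.mem_map_of_mem (hsub hp))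

theorem badRatio_below_mono (hf : Submodular f) {j : Fin ℓ} (hτ : 0 < s.τ j) (D : Finset U)
    {T T' : Finset U} (h : T ⊆ T') :
    badRatio (Below f s j) D T ≤ badRatio (Below f s j) D T' := by
  refine badRatio_mono ?_ D h
  intro T T' x hT hx
  unfold Below at hx ⊢
  exact hf.gain_lt_mono hτ (Finset.union_subset_union_right hT) hx

/-- Unless the orderings fail, the block exhausts the budget or many elements leave. -/
theorem budget_or_sum_badRatio (hf : Submodular f) (hε : 0 < ε) (hε1 : ε < 1) {a : ℝ} (ha : a ≤ 1)
    (hτ : ∀ j ∈ s.I, 0 < s.τ j) (h : s.I.Nonempty)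
    (hD : ∀ j ∈ s.I, (D j).Nonempty) (hL : L ∈ Fintype.piFinset fun j => orderings (D j))
    (hF : ¬ Fails s.I D (Below f s) ε a (blockSize s h D) L) :
    blockLength f ε s h (blockSize s h D) L = s.m₀ ∨
      a * ε ≤ ∑ k ∈ s.I, badRatio (Below f s k) (D k) (blockSet f ε s h (blockSize s h D) L k) := by
  classical
  set size := blockSize s h D with hsize
  set w := blockLength f ε s h size L with hw
  have hord : ∀ j, (L j).Nodup ∧ (L j).toFinset = D j := fun j =>
    mem_orderings.1 (Fintype.mem_piFinset.1 hL j)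
  have hlenD : ∀ j, (L j).length = (D j).card := fun j =>
    length_of_mem_orderings (Fintype.mem_piFinset.1 hL j)
  have hlen : ∀ j ∈ s.I, size ≤ (L j).length := by
    intro j hj
    rw [hlenD]
    exact (min_le_right _ _).trans (Finset.inf'_le _ hj)
  have hws : w ≤ size := by
    obtain ⟨j, hj⟩ := h
    exact (Finset.inf'_le _ hj).trans (prefixLength_le ε size (blockMarks f s size L j))
  have hsingle : ∀ j ∈ s.I, badRatio (Below f s j) (D j) (blockSet f ε s h size L j) ≤
      ∑ k ∈ s.I, badRatio (Below f s k) (D k) (blockSet f ε s h size L k) := fun j hj =>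
    Finset.single_le_sum (f := fun k => badRatio (Below f s k) (D k) (blockSet f ε s h size L k))
      (fun k _ => badRatio_nonneg _ _ _) hj
  have hfst : ∀ j, ((blockMarks f s size L j).take
      (prefixLength ε size (blockMarks f s size L j))).map Prod.fst =
      (L j).take (prefixLength ε size (blockMarks f s size L j)) := by
    intro j
    rw [List.map_take, show (blockMarks f s size L j).map Prod.fst = (L j).take size from
      map_fst_marks _ _ _, List.take_take, min_eq_left]
    exact prefixLength_le _ _ _
  have hlenP : ∀ j ∈ s.I, ((blockMarks f s size L j).take
      (prefixLength ε size (blockMarks f s size L j))).length =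
      prefixLength ε size (blockMarks f s size L j) := by
    intro j hj
    have h1 := hlen j hj
    have h2 := prefixLength_le ε size (blockMarks f s size L j)
    rw [← List.length_map (f := Prod.fst), hfst, List.length_take]
    omega
  have hScard : ∀ j ∈ s.I, (blockSet f ε s h size L j).card = w := by
    intro j hj
    rw [blockSet, List.toFinset_card_of_nodup, List.length_map]
    · exact length_threePass ((Finset.inf'_le _ hj).trans (hlenP j hj).ge)
    · apply nodup_threePass
      rw [hfst]
      exact (hord j).1.sublist (List.take_sublist _ _)
  have hSD : ∀ j, blockSet f ε s h size L j ⊆ D j := by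
    intro j x hx
    rw [blockSet, List.mem_toFinset, List.mem_map] at hx
    obtain ⟨p, hp, rfl⟩ := hx
    have h1 := List.mem_map_of_mem (f := Prod.fst) (threePass_subset _ _ hp)
    rw [hfst] at h1
    rw [← (hord j).2]
    exact List.mem_toFinset.2 (List.mem_of_mem_take h1)
  -- If `w < size`, a solution attaining the minimum could not extend its prefix: its first `w + 1`
  -- elements have too many bad ones, and its block is its whole prefix. If `w = size`, the size
  -- comes from the budget, or from some `D_j` that is then added entirely and has bad ratio one.
  rcases hws.lt_or_eq with hlt | heq
  · right
    obtain ⟨j, hj, hjw⟩ := Finset.exists_mem_eq_inf' h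
      fun j => prefixLength ε size (blockMarks f s size L j)
    replace hjw : w = prefixLength ε size (blockMarks f s size L j) := hjw
    have hcount : ε * ((w : ℝ) + 1) < badCount (Below f s j) ∅ ((L j).take (w + 1)) := by
      have h1 := Nat.findGreatest_is_greatest (P := fun i => (1 - ε) * (i : ℝ) ≤
        ((((blockMarks f s size L j).take i).countP fun p => p.2 = some true : ℕ) : ℝ))
        (n := size) (k := w + 1) (by
          change prefixLength ε size (blockMarks f s size L j) < w + 1
          omega) hlt
      rw [not_le, blockMarks, take_marks, List.take_take, min_eq_left (show w + 1 ≤ size from hlt)]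
        at h1
      have h2 := badCount_below_add_countP_marks f s j ((L j).take (w + 1))
      rw [List.length_take, min_eq_left ((show w + 1 ≤ size from hlt).trans (hlen j hj))] at h2
      have h3 : ((badCount (Below f s j) ∅ ((L j).take (w + 1)) : ℕ) : ℝ) +
          ((marks f (s.A j) (s.τ j) ((L j).take (w + 1))).countP fun p => p.2 = some true : ℕ) =
          (w : ℝ) + 1 := by exact_mod_cast h2
      push_cast at h1
      linarith
    have hSj : ((L j).take w).toFinset ⊆ blockSet f ε s h size L j := by
      intro x hx
      rw [List.mem_toFinset, hjw, ← hfst, List.mem_map] at hx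
      obtain ⟨p, hp, rfl⟩ := hx
      apply List.mem_toFinset.2
      apply List.mem_map_of_mem
      have h1 := threePass_length_perm ((blockMarks f s size L j).take
        (prefixLength ε size (blockMarks f s size L j)))
      rw [hlenP j hj, ← hjw] at h1
      rw [block, ← hw, ← hjw]
      rw [← hjw] at hp
      exact h1.mem_iff.2 hp
    by_contra hc
    rw [not_le] at hc
    refine hF ⟨j, hj, w, hlt, ?_, hcount, ?_⟩
    · exact ((badRatio_below_mono hf (hτ j hj) _ hSj).trans (hsingle j hj)).trans_lt hc
    · refine lt_of_le_of_lt (Finset.sum_le_sum fun k hk => ?_) hc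
      exact badRatio_below_mono hf (hτ k hk) _
        (take_cleanLength_subset_blockSet h hk)
  · rcases min_choice s.m₀ (s.I.inf' h fun l => (D l).card) with hm | hm
    · exact Or.inl (heq.trans hm)
    · right
      obtain ⟨j, hj, hjw⟩ := Finset.exists_mem_eq_inf' h fun l => (D l).card
      have h1 : blockSet f ε s h size L j = D j := by
        apply Finset.eq_of_subset_of_card_le (hSD j)
        rw [hScard j hj, heq, ← hjw]
        exact hm.ge
      refine le_trans ?_ (hsingle j hj)
      rw [h1, badRatio, Finset.filter_true_of_mem, div_self]
      · nlinarith
      · exact_mod_cast (Finset.card_pos.2 (hD j hj)).ne'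
      · intro x hx
        rw [Below, gain_of_subset (Finset.singleton_subset_iff.2 (Finset.mem_union_right _ hx))]
        exact hτ j hj

theorem potential_blockStep_le [Fintype U] (hf : Submodular f) (hℓ : 1 ≤ ℓ) (hε : 0 < ε) (hε1 : ε < 1)
    (hmin : 0 < τmin) (hm : s.m₀ ≠ 0) (hp : ∀ j ∈ s.I, Pending f τmin s j)
    (hbig : ∀ j ∈ s.I, 2 * ℓ ≤ (s.V j).card) (h : s.I.Nonempty)
    (hD : D ∈ (distribute s.V s.I).support) (hL : L ∈ Fintype.piFinset fun j => orderings (D j)) :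
    potential f τmin ε (blockStep f ε s h (blockSize s h D) L) ≤ potential f τmin ε s ∧
      (¬ Fails s.I D (Below f s) ε (1 / 6) (blockSize s h D) L →
        potential f τmin ε (blockStep f ε s h (blockSize s h D) L) + 1 ≤
          potential f τmin ε s) := by
  obtain ⟨hD1, -, -⟩ := distribute_support hD
  set t := blockStep f ε s h (blockSize s h D) L with ht
  have hτ : ∀ j ∈ s.I, 0 < s.τ j := fun j hj => hmin.trans_le (hp j hj).2.1
  have hℓ0 : (0 : ℝ) < ℓ := by exact_mod_cast hℓ
  have hshare := fun j (hj : j ∈ s.I) => share_blockStep_add_le (ε := ε) (L := L) h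
    (size := blockSize s h D) (hp j hj) (hD1 j hj).1 (hD1 j hj).2 (hbig j hj) hℓ
  have hpot := potential_le (f := f) (τmin := τmin) (s := s) (t := t) hℓ hε hε1 subset_rfl
    (Nat.sub_le _ _) hshare
  rw [← Finset.sum_div, unit] at hpot
  set b := ∑ j ∈ s.I, badRatio (Below f s j) (D j) (blockSet f ε s h (blockSize s h D) L j)
    with hb
  have h0 : 0 ≤ b := Finset.sum_nonneg fun j _ => badRatio_nonneg _ _ _
  have h1 : 24 * ℓ / ε * (b / (2 * ℓ)) = 12 * b / ε := by
    field_simp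
    ring
  rw [h1] at hpot
  have h2 : 0 ≤ 12 * b / ε := by positivity
  refine ⟨by linarith, fun hF => ?_⟩
  have hDne : ∀ j ∈ s.I, (D j).Nonempty := by
    intro j hj
    rw [← Finset.card_pos, (hD1 j hj).2]
    have := hbig j hj
    exact Nat.div_pos (by omega) (by omega)
  -- A spent budget removes the summand `1` from the potential; otherwise `b ≥ ε/6` makes the drop
  -- `12 * b / ε` at least `2`.
  rcases budget_or_sum_badRatio hf hε hε1 (by norm_num) hτ h hDne hL hF with hbm | hbm
  · have h3 : t.m₀ = 0 := by
      simp only [ht, blockStep]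
      omega
    have h4 : ∑ j ∈ t.I, share f τmin ε t j ≤ ∑ j ∈ s.I, share f τmin ε s j := by
      apply Finset.sum_le_sum
      intro j hj
      have h5 := hshare j hj
      have h6 : 0 ≤ badRatio (Below f s j) (D j)
        (blockSet f ε s h (blockSize s h D) L j) / (2 * ℓ) :=
        div_nonneg (badRatio_nonneg _ _ _) (by positivity)
      linarith
    unfold potential
    rw [if_pos h3, if_neg hm, add_zero]
    apply add_le_add_left
    exact mul_le_mul_of_nonneg_left h4 (by linarith [le_unit hℓ hε hε1])
  · have h3 : 1 ≤ 12 * b / ε := by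
      rw [le_div_iff₀ hε]
      linarith
    linarith

end Blocks

end PIG
end

noncomputable section
namespace PIG

open scoped ENNReal

section Rounds

variable {U : Type*} [Fintype U] [DecidableEq U] {ℓ : ℕ}
variable {f : Finset U → ℝ} {τmin ε : ℝ} {s t : State U ℓ}

/-! ### The exponential supermartingale -/

/-- The weight of a state. -/
def weight (f : Finset U → ℝ) (τmin ε : ℝ) (s : State U ℓ) : ℝ≥0∞ :=
  ENNReal.ofReal (Real.exp (total f τmin ε s))

theorem weight_le_of_total_le (h : total f τmin ε t ≤ total f τmin ε s) :
    weight f τmin ε t ≤ weight f τmin ε s :=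
  ENNReal.ofReal_le_ofReal (Real.exp_le_exp.2 h)

/-- Two rounds at weight `1/8` cost the factor `exp (1/4)`. The potential drops by one except with
probability at most `e/6`, and the average factor stays below one; this fixes `a = 1/6`. -/
theorem exp_quarter_mul_le :
    Real.exp (1 / 4) * (Real.exp (-1) + (1 - Real.exp (-1)) * (1 / 6 * Real.exp 1)) ≤ 1 := by
  have h1 := Real.exp_one_lt_d9
  have h2 : Real.exp (1 / 4) ≤ 1.3 := by
    by_contra hc
    rw [not_le] at hc
    have h3 : (1.3 : ℝ) ^ 4 < Real.exp (1 / 4) ^ 4 :=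
      pow_lt_pow_left₀ hc (by norm_num) (by norm_num)
    rw [← Real.exp_nat_mul] at h3
    norm_num at h3
    norm_num at h1
    linarith
  have h3 : Real.exp (-1) < 0.3679 := by
    have := Real.exp_neg_one_lt_d9
    norm_num at this ⊢
    linarith
  have h4 : Real.exp (-1) * Real.exp 1 = 1 := by rw [← Real.exp_add]; simp
  have h5 : Real.exp (-1) + (1 - Real.exp (-1)) * (1 / 6 * Real.exp 1) ≤ 0.66 := by
    norm_num at h1 h3 ⊢
    nlinarith
  have h6 := Real.exp_pos (1 / 4)
  have h7 := mul_le_mul_of_nonneg_left h5 h6.le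
  norm_num at h2 h7 ⊢
  linarith

/-- Here `y` stands for the total before the iteration: `1/8` was spent on the filtering round and
`1/8` goes to the round of the blocks. -/
theorem expect_addBlocks_le (hf : Submodular f) (hℓ : 1 ≤ ℓ) (hε : 0 < ε) (hε1 : ε < 1)
    (hmin : 0 < τmin) (hm : s.m₀ ≠ 0) (hp : ∀ j ∈ s.I, Pending f τmin s j)
    (hbig : ∀ j ∈ s.I, 2 * ℓ ≤ (s.V j).card) (h : s.I.Nonempty) {y : ℝ}
    (hy : total f τmin ε s + 1 / 8 ≤ y + 1 / 4) :
    expect (addBlocks f ε s h) (weight f τmin ε) ≤ ENNReal.ofReal (Real.exp y) := by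
  classical
  have hτ : ∀ j ∈ s.I, 0 < s.τ j := fun j hj => hmin.trans_le (hp j hj).2.1
  rw [addBlocks_eq, expect_bind]
  refine expect_le_of_forall fun D hD => ?_
  set Ω := Fintype.piFinset fun j => orderings (D j) with hΩ
  have hne : Ω.Nonempty := Fintype.piFinset_nonempty.2 fun j => orderings_nonempty _
  have hcard : (0 : ℝ) < Ω.card := by exact_mod_cast Finset.card_pos.2 hne
  rw [expect_map, expect_unif hne]
  apply ENNReal.div_le_of_le_mul
  simp only [weight]
  rw [← ENNReal.ofReal_sum_of_nonneg fun _ _ => (Real.exp_pos _).le, ← ENNReal.ofReal_natCast,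
    ← ENNReal.ofReal_mul (Real.exp_pos _).le]
  apply ENNReal.ofReal_le_ofReal
  set n := blockSize s h D with hn
  set e := Real.exp (-1) with he
  have he1 : e ≤ 1 := Real.exp_le_one_iff.2 (by norm_num)
  -- The last factor equals `1` on failure and `exp (-1)` otherwise.
  have hstep : ∀ L ∈ Ω, Real.exp (total f τmin ε (blockStep f ε s h n L)) ≤
      Real.exp (y + 1 / 4) *
        (e + (1 - e) * if Fails s.I D (Below f s) ε (1 / 6) n L then (1 : ℝ) else 0) := by
    intro L hL
    obtain ⟨h1, h2⟩ := potential_blockStep_le hf hℓ hε hε1 hmin hm hp hbig h hD hL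
    have h3 : ((blockStep f ε s h n L).log.rounds : ℝ) = s.log.rounds + 1 := by
      simp [blockStep, Transcript.rounds]
    unfold total at hy ⊢
    rw [h3]
    split_ifs with hF
    · rw [mul_one, add_sub_cancel, mul_one]
      apply Real.exp_le_exp.2
      linarith
    · rw [mul_zero, add_zero, he, ← Real.exp_add]
      apply Real.exp_le_exp.2
      have := h2 hF
      linarith
  refine (Finset.sum_le_sum hstep).trans ?_
  have hfail := sum_fails_le s.I D (Below f s) (ε := ε) (a := 1 / 6) hε (by norm_num)
    (by have := Real.exp_one_lt_d9; norm_num at this; linarith) ?_ ?_ n ?_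
  · rw [← Finset.mul_sum, Finset.sum_add_distrib, ← Finset.mul_sum, Finset.sum_const,
      nsmul_eq_mul, Real.exp_add, mul_assoc]
    apply mul_le_mul_of_nonneg_left _ (Real.exp_pos _).le
    have h1 : (Ω.card : ℝ) * e + (1 - e) * ∑ L ∈ Ω,
        (if Fails s.I D (Below f s) ε (1 / 6) n L then (1 : ℝ) else 0) ≤
        (e + (1 - e) * (1 / 6 * Real.exp 1)) * Ω.card := by
      have := mul_le_mul_of_nonneg_left hfail (sub_nonneg.2 he1)
      linarith
    have h2 := mul_le_mul_of_nonneg_left h1 (Real.exp_pos (1 / 4)).le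
    refine h2.trans ?_
    rw [← mul_assoc]
    have := mul_le_mul_of_nonneg_right exp_quarter_mul_le hcard.le
    rwa [one_mul] at this
  · intro j hj T x hx
    rw [Below, gain_of_subset (Finset.singleton_subset_iff.2 (Finset.mem_union_right _ hx))]
    exact hτ j hj
  · intro j hj T T' x hT hx
    unfold Below at hx ⊢
    exact hf.gain_lt_mono (hτ j hj) (Finset.union_subset_union_right hT) hx
  · intro j hj
    exact (min_le_right _ _).trans (Finset.inf'_le _ hj)

/-- The thresholds of the active solutions are at least `τmin`. -/
def Active (τmin : ℝ) (s : State U ℓ) : Prop := ∀ j ∈ s.I, τmin ≤ s.τ j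

/-- Only blocks need averaging; turns never raise the total. If the first phase deactivates
everything, `Active` forces at least one pass, whose surplus pays for the round. -/
theorem expect_iteration_le [Nonempty U] (hf : Submodular f) (hℓ : 1 ≤ ℓ) (hε : 0 < ε)
    (hε1 : ε < 1) (hmin : 0 < τmin) (hs : Core f τmin ε s) (ha : Active τmin s)
    (hh : ¬ s.Halted) :
    expect (iteration f τmin ε s) (weight f τmin ε) ≤ weight f τmin ε s := by
  have hr := hs.refresh hε hε1 hmin
  have hp : ∀ j ∈ (refresh f τmin ε s).I, Pending f τmin (refresh f τmin ε s) j :=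
    fun j hj => pending_refresh hj
  have hm : (refresh f τmin ε s).m₀ ≠ 0 := fun h => hh (Or.inr h)
  have htot := total_refresh_le (f := f) (s := s) hℓ hε hε1 hmin
  have hsum : 0 ≤ ∑ j ∈ s.I, (passes f τmin ε s j : ℝ) := by positivity
  unfold iteration
  simp only
  split_ifs with h1 h2
  · rw [expect_map]
    refine expect_le_of_forall fun t ht => ?_
    have h3 := total_addInTurn_le hf hℓ hε hε1 hmin (refresh f τmin ε s).I.sort _ t
      (Finset.sort_nodup _ _) hr (fun j hj => hp j ((Finset.mem_sort _).1 hj)) ht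
    rw [if_pos (by simpa only [Finset.mem_sort] using h2)] at h3
    apply weight_le_of_total_le
    have h4 : potential f τmin ε { t with m₀ := t.m₀ - 1 } ≤ potential f τmin ε t := by
      have := potential_le (f := f) (τmin := τmin) (s := t) (t := { t with m₀ := t.m₀ - 1 })
        (δ := fun _ => 0) hℓ hε hε1 subset_rfl (Nat.sub_le _ _) (fun j _ => (add_zero _).le)
      simpa using this
    unfold total at h3 htot ⊢
    simp only at h4 ⊢
    linarith
  · push Not at h2
    exact expect_addBlocks_le hf hℓ hε hε1 hmin hm hp h2 h1 (by linarith)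
  · rw [expect_pure]
    apply weight_le_of_total_le
    rw [Finset.not_nonempty_iff_eq_empty] at h1
    obtain ⟨j, hj⟩ : s.I.Nonempty := Finset.nonempty_iff_ne_empty.2 fun h => hh (Or.inl h)
    have h3 : passes f τmin ε s j ≠ 0 := by
      intro h0
      have h4 : j ∈ (refresh f τmin ε s).I := by
        refine Finset.mem_filter.2 ⟨hj, ?_⟩
        have h5 : (runUpdate f τmin ε s.I s).τ j = (1 - ε) ^ passes f τmin ε s j * s.τ j := by
          simp only [runUpdate, hj, if_true]
          rfl
        rw [h5, h0, pow_zero, one_mul]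
        exact ha j hj
      rw [h1] at h4
      simp at h4
    have h4 : (1 : ℝ) ≤ passes f τmin ε s j := by
      exact_mod_cast Nat.one_le_iff_ne_zero.2 h3
    have h5 := Finset.single_le_sum (f := fun j => (passes f τmin ε s j : ℝ))
      (fun j _ => Nat.cast_nonneg _) hj
    linarith

theorem expect_whileLoop_le [Nonempty U] (hf : Submodular f) (hℓ : 1 ≤ ℓ) (hε : 0 < ε)
    (hε1 : ε < 1) (hmin : 0 < τmin) (k : ℕ) : ∀ s : State U ℓ, Core f τmin ε s → Active τmin s →
      expect (whileLoop f τmin ε k s) (weight f τmin ε) ≤ weight f τmin ε s := by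
  induction k with
  | zero =>
    intro s _ _
    rw [whileLoop, expect_pure]
  | succ k ih =>
    intro s hs ha
    rw [whileLoop]
    split_ifs with hh
    · rw [expect_pure]
    · rw [expect_bind]
      refine (expect_mono fun t ht => ?_).trans (expect_iteration_le hf hℓ hε hε1 hmin hs ha hh)
      rcases iteration_spec hf hℓ hε hε1 hmin (fun h => hh (Or.inr h)) hs ht with
        ⟨h, rfl⟩ | ⟨w, he⟩
      · exact ih _ (hs.refresh hε hε1 hmin) (by simp [Active, h])
      · exact ih t he.core he.threshold

/-! ### The number of queries -/

/-- Every round of the transcript has at most `b` queries. -/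
def RoundsLe {U : Type*} (b : ℕ) (T : Transcript U) : Prop := ∀ q ∈ T, Multiset.card q ≤ b

theorem RoundsLe.queries_le {U : Type*} {b : ℕ} {T : Transcript U} (h : RoundsLe b T) :
    T.queries ≤ T.rounds * b := by
  unfold Transcript.queries Transcript.rounds
  rw [← List.length_map (f := Multiset.card) (as := T), ← smul_eq_mul]
  apply List.sum_le_card_nsmul
  intro q hq
  obtain ⟨p, hp, rfl⟩ := List.mem_map.1 hq
  exact h p hp

theorem RoundsLe.append {U : Type*} {b : ℕ} {T T' : Transcript U} (h : RoundsLe b T)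
    (h' : RoundsLe b T') : RoundsLe b (T ++ T') := by
  intro q hq
  rcases List.mem_append.1 hq with hq | hq
  · exact h q hq
  · exact h' q hq

theorem card_sum_le {U : Type*} {J : Finset (Fin ℓ)} {g : Fin ℓ → Multiset (Finset U)} {b : ℕ}
    (h : ∀ j ∈ J, Multiset.card (g j) ≤ b) : Multiset.card (∑ j ∈ J, g j) ≤ ℓ * b := by
  rw [Multiset.card_sum]
  refine (Finset.sum_le_card_nsmul J _ b h).trans ?_
  rw [smul_eq_mul]
  apply Nat.mul_le_mul_right
  simpa using Finset.card_le_univ J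

theorem roundsLe_parallel {U : Type*} {b : ℕ} {J : Finset (Fin ℓ)} {T : Fin ℓ → Transcript U}
    (h : ∀ j ∈ J, RoundsLe b (T j)) : RoundsLe (ℓ * b) (parallel J T) := by
  intro q hq
  unfold parallel at hq
  obtain ⟨r, -, rfl⟩ := List.mem_map.1 hq
  apply card_sum_le
  intro j hj
  rw [List.getD_eq_getElem?_getD]
  by_cases hr : r < (T j).length
  · rw [List.getElem?_eq_getElem hr, Option.getD_some]
    exact h j hj _ (List.getElem_mem hr)
  · rw [List.getElem?_eq_none (not_lt.1 hr), Option.getD_none]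
    simp

theorem card_gainQueries_le (A W : Finset U) :
    Multiset.card (gainQueries A W) ≤ Fintype.card U + 1 := by
  simp only [gainQueries, Multiset.card_cons, Multiset.card_map, Finset.card_val]
  exact Nat.succ_le_succ (Finset.card_le_univ W)

theorem roundsLe_runUpdate {J : Finset (Fin ℓ)}
    (h : RoundsLe (ℓ * (Fintype.card U + 1)) s.log) :
    RoundsLe (ℓ * (Fintype.card U + 1)) (runUpdate f τmin ε J s).log := by
  simp only [runUpdate]
  apply h.append
  apply roundsLe_parallel
  intro j _ q hq
  unfold updateTranscript at hq
  rcases List.mem_cons.1 hq with rfl | hq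
  · exact card_gainQueries_le _ _
  · rw [(List.mem_replicate.1 hq).2]
    exact card_gainQueries_le _ _

theorem roundsLe_addInTurn [Nonempty U] (hε : 0 < ε) (hmin : 0 < τmin) (js : List (Fin ℓ)) :
    ∀ s t : State U ℓ, RoundsLe (ℓ * (Fintype.card U + 1)) s.log →
      t ∈ (addInTurn f τmin ε js s).support → RoundsLe (ℓ * (Fintype.card U + 1)) t.log := by
  induction js with
  | nil =>
    intro s t hs ht
    rw [addInTurn, PMF.mem_support_pure_iff] at ht
    rwa [ht]
  | cons j js ih =>
    intro s t hs ht
    rw [addInTurn, PMF.mem_support_bind_iff] at ht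
    obtain ⟨u, hu, ht⟩ := ht
    refine ih u t ?_ ht
    have h1 : RoundsLe (ℓ * (Fintype.card U + 1)) (turnUpdate f τmin ε j s).log := by
      unfold turnUpdate
      split_ifs
      · exact roundsLe_runUpdate hs
      · exact hs
    rcases mem_support_addOne hε hmin hu with ⟨-, rfl⟩ | ⟨-, x, -, rfl⟩
    · exact h1
    · exact h1

theorem roundsLe_iteration [Nonempty U] (hε : 0 < ε) (hmin : 0 < τmin)
    (hs : RoundsLe (ℓ * (Fintype.card U + 1)) s.log)
    (ht : t ∈ (iteration f τmin ε s).support) :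
    RoundsLe (ℓ * (Fintype.card U + 1)) t.log := by
  have hr : RoundsLe (ℓ * (Fintype.card U + 1)) (refresh f τmin ε s).log :=
    roundsLe_runUpdate (f := f) (τmin := τmin) (ε := ε) (J := s.I) hs
  unfold iteration at ht
  simp only at ht
  split_ifs at ht with h1 h2
  · rw [PMF.mem_support_map_iff] at ht
    obtain ⟨u, hu, rfl⟩ := ht
    exact roundsLe_addInTurn hε hmin _ _ u hr hu
  · rw [addBlocks_eq, PMF.mem_support_bind_iff] at ht
    obtain ⟨D, hD, ht⟩ := ht
    rw [PMF.mem_support_map_iff] at ht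
    obtain ⟨L, hL, rfl⟩ := ht
    apply hr.append
    intro q hq
    rw [List.mem_singleton.1 hq]
    apply card_sum_le
    intro j hj
    simp only [prefixQueries, Multiset.card_map, Multiset.card_range, add_le_add_iff_right]
    exact (min_le_right _ _).trans ((Finset.inf'_le _ hj).trans (Finset.card_le_univ _))
  · rw [PMF.mem_support_pure_iff] at ht
    rwa [ht]

theorem roundsLe_outcome [Nonempty U] (hf : Submodular f) {m : ℕ} (hℓ : 1 ≤ ℓ) (hε : 0 < ε)
    (hε1 : ε < 1) (hmin : 0 < τmin)
    (hs : s ∈ (parallelInterlaceGreedy f m ℓ τmin ε).support) :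
    RoundsLe (ℓ * (Fintype.card U + 1)) s.log := by
  refine (whileLoop_induction (f := f) (τmin := τmin) (ε := ε)
    (P := fun s => Core f τmin ε s ∧ RoundsLe (ℓ * (Fintype.card U + 1)) s.log) ?_ m
    (initial f m ℓ) s ⟨core_initial hε hε1 hmin f m ℓ, ?_⟩ (Or.inl le_rfl) hs).1.2
  · rintro s t ⟨h1, h2⟩ hh ht
    have hm : s.m₀ ≠ 0 := fun h => hh (Or.inr h)
    have h3 := roundsLe_iteration hε hmin h2 ht
    rcases iteration_spec hf hℓ hε hε1 hmin hm h1 ht with ⟨h, rfl⟩ | ⟨w, he⟩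
    · exact ⟨⟨h1.refresh hε hε1 hmin, h3⟩, Or.inr (Or.inl h)⟩
    · refine ⟨⟨he.core, h3⟩, Or.inl ?_⟩
      have h4 := he.budget
      have h5 := he.pos
      have h6 : (refresh f τmin ε s).m₀ = s.m₀ := rfl
      omega
  · intro q hq
    rw [List.mem_singleton.1 hq]
    refine (card_gainQueries_le _ _).trans ?_
    exact Nat.le_mul_of_pos_left _ hℓ

end Rounds

end PIG
end

/-! ### The tail bound and the constants. -/

noncomputable section
namespace PIG

open scoped ENNReal

section Complexity

variable {U : Type*} [Fintype U] [DecidableEq U] [Nonempty U] {ℓ : ℕ}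
variable {f : Finset U → ℝ} {τmin ε : ℝ}

theorem levelPrice_le {U : Type*} [Fintype U] (hn : 2 ≤ Fintype.card U) :
    levelPrice U ≤ 4 * Real.log (Fintype.card U) := by
  have hn' : (2 : ℝ) ≤ Fintype.card U := by exact_mod_cast hn
  have h1 : Real.log (1 + Fintype.card U) ≤ 2 * Real.log (Fintype.card U) := by
    have : Real.log ((Fintype.card U : ℝ) ^ 2) = 2 * Real.log (Fintype.card U) := by
      rw [Real.log_pow]
      norm_num
    rw [← this]
    apply Real.log_le_log (by positivity)
    nlinarith
  have h2 := Real.log_le_log (by norm_num) hn'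
  have h3 := Real.log_two_gt_d9
  norm_num at h3
  unfold levelPrice
  linarith

/-- The additive `9/8` is the round that computes `M` plus the budget term of the potential. -/
theorem total_initial_le (hε : 0 < ε) (hε1 : ε < 1) (hmin : 0 < τmin) (m ℓ : ℕ)
    (hM : τmin ≤ maxGain f) :
    total f τmin ε (initial f m ℓ) ≤
      24 * (ℓ : ℝ) ^ 2 / ε * (levelPrice U * (Real.log (maxGain f / τmin) / ε + 2)) + 9 / 8 := by
  have hB := log_card_nonneg (Fintype.card U)
  have hsh : ∀ j, share f τmin ε (initial f m ℓ) j ≤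
      levelPrice U * (Real.log (maxGain f / τmin) / ε + 2) := by
    intro j
    have h1 : Real.log (1 + ((live f (initial f m ℓ) j).card : ℝ)) ≤ levelPrice U := by
      have : Real.log (1 + ((live f (initial f m ℓ) j).card : ℝ)) ≤
          Real.log (1 + Fintype.card U) := by
        apply Real.log_le_log (by positivity)
        have : ((live f (initial f m ℓ) j).card : ℝ) ≤ Fintype.card U := by
          exact_mod_cast Finset.card_le_univ _
        linarith
      unfold levelPrice
      linarith
    have h2 := levels_le hε hε1 hmin hM
    have h3 : 0 ≤ levelPrice U := by unfold levelPrice; linarith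
    have h4 := mul_le_mul_of_nonneg_right h2 h3
    have h5 : (initial f m ℓ).τ j = maxGain f := rfl
    unfold share
    rw [h5]
    linarith
  have h1 : ∑ j ∈ (initial f m ℓ).I, share f τmin ε (initial f m ℓ) j ≤
      ℓ * (levelPrice U * (Real.log (maxGain f / τmin) / ε + 2)) := by
    refine (Finset.sum_le_card_nsmul _ _ _ fun j _ => hsh j).trans (le_of_eq ?_)
    simp [initial]
  have h2 : ((initial f m ℓ).log.rounds : ℝ) = 1 := by simp [initial, Transcript.rounds]
  have h3 : (if (initial f m ℓ).m₀ = 0 then (0 : ℝ) else 1) ≤ 1 := by split_ifs <;> norm_num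
  have h4 : 0 ≤ unit ℓ ε := by unfold unit; positivity
  have h5 := mul_le_mul_of_nonneg_left h1 h4
  have h6 : unit ℓ ε * (ℓ * (levelPrice U * (Real.log (maxGain f / τmin) / ε + 2))) =
      24 * (ℓ : ℝ) ^ 2 / ε * (levelPrice U * (Real.log (maxGain f / τmin) / ε + 2)) := by
    unfold unit
    ring
  unfold total potential
  rw [h2]
  linarith

/-- The tail bound for the number of rounds. -/
theorem one_sub_exp_le_rounds (hf : Submodular f) {m : ℕ} (hℓ : 1 ≤ ℓ) (hε : 0 < ε) (hε1 : ε < 1)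
    (hmin : 0 < τmin) (hM : τmin ≤ maxGain f) (N : ℝ) :
    ENNReal.ofReal (1 - Real.exp (total f τmin ε (initial f m ℓ) - N / 8)) ≤
      (parallelInterlaceGreedy f m ℓ τmin ε).toOuterMeasure {s | (s.log.rounds : ℝ) ≤ N} := by
  have h := one_sub_le_toOuterMeasure (parallelInterlaceGreedy f m ℓ τmin ε) (weight f τmin ε)
    {s | (s.log.rounds : ℝ) ≤ N} (δ := ENNReal.ofReal (Real.exp (-(N / 8)))) ?_
    (expect_whileLoop_le hf hℓ hε hε1 hmin m (initial f m ℓ)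
      (core_initial hε hε1 hmin f m ℓ) fun _ _ => hM)
  · refine le_trans (le_of_eq ?_) h
    rw [weight, ← ENNReal.ofReal_mul (Real.exp_pos _).le, ← Real.exp_add,
      ENNReal.ofReal_sub _ (Real.exp_pos _).le, ENNReal.ofReal_one]
    ring_nf
  · intro s hs
    have h1 : N < s.log.rounds := not_le.1 hs
    rw [weight, ← ENNReal.ofReal_mul (Real.exp_pos _).le, ← Real.exp_add, ← ENNReal.ofReal_one]
    apply ENNReal.ofReal_le_ofReal
    apply Real.one_le_exp
    have h2 : 0 ≤ potential f τmin ε s := by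
      have h3 : 0 ≤ ∑ j ∈ s.I, share f τmin ε s j :=
        Finset.sum_nonneg fun j _ => share_nonneg _ _ _ _ _
      have h4 : 0 ≤ unit ℓ ε := by unfold unit; positivity
      unfold potential
      split_ifs <;> positivity
    unfold total
    linarith

/-- The bounds on rounds and queries, where `ρ` bounds the logarithm of `M / τmin` from below. -/
theorem complexity_bound (hf : Submodular f) {m : ℕ} (hℓ : 1 ≤ ℓ) (hε : 0 < ε) (hε1 : ε < 1)
    (hmin : 0 < τmin) {ρ : ℝ} (hρ : 0 < ρ) (hM : τmin ≤ maxGain f)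
    (hΛ : ρ ≤ Real.log (maxGain f / τmin)) :
    ENNReal.ofReal (1 - 1 / (Fintype.card U : ℝ)) ≤
      (parallelInterlaceGreedy f m ℓ τmin ε).toOuterMeasure
        {s | (s.log.rounds : ℝ) ≤ (1536 + 3136 / ρ) * ((ℓ : ℝ) ^ 2 * (ε ^ 2)⁻¹ *
                Real.log (Fintype.card U) * Real.log (maxGain f / τmin)) ∧
             (s.log.queries : ℝ) ≤ (1536 + 3136 / ρ) * ((ℓ : ℝ) ^ 3 * (ε ^ 2)⁻¹ *
                (Fintype.card U : ℝ) *
                Real.log (Fintype.card U) * Real.log (maxGain f / τmin))} := by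
  set n : ℝ := (Fintype.card U : ℝ) with hn
  set Λ := Real.log (maxGain f / τmin) with hΛd
  have hℓ0 : (1 : ℝ) ≤ ℓ := by exact_mod_cast hℓ
  have hn1 : (1 : ℝ) ≤ n := by
    rw [hn]
    exact_mod_cast (Fintype.card_pos : 0 < Fintype.card U)
  -- For `n = 1` the required probability is zero.
  rcases (show 1 ≤ Fintype.card U from Fintype.card_pos).eq_or_lt with h1 | h1
  · have : n = 1 := by rw [hn, ← h1, Nat.cast_one]
    rw [this]
    simp
  have h2 : (2 : ℝ) ≤ n := by
    rw [hn]
    exact_mod_cast h1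
  have hlog : 1 / 2 ≤ Real.log n := by
    have h3 := Real.log_le_log (by norm_num) h2
    have h4 := Real.log_two_gt_d9
    norm_num at h4
    linarith
  set T := (ℓ : ℝ) ^ 2 * (ε ^ 2)⁻¹ * Real.log n * Λ with hT
  have hΛ0 : 0 < Λ := hρ.trans_le hΛ
  have hℓε : 1 ≤ (ℓ : ℝ) ^ 2 * (ε ^ 2)⁻¹ := by
    apply one_le_mul_of_one_le_of_one_le (one_le_pow₀ hℓ0)
    exact (one_le_inv₀ (by positivity)).2 (pow_le_one₀ hε.le hε1.le)
  have hlogT : ρ * Real.log n ≤ T := by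
    have h3 : 1 * (Real.log n * ρ) ≤ (ℓ : ℝ) ^ 2 * (ε ^ 2)⁻¹ * (Real.log n * Λ) := by
      apply mul_le_mul hℓε _ (by positivity) (by positivity)
      exact mul_le_mul_of_nonneg_left hΛ (by linarith)
    rw [hT]
    linarith
  have hlogT' : Real.log n ≤ T / ρ := by
    rw [le_div_iff₀ hρ]
    linarith
  have htotal : total f τmin ε (initial f m ℓ) ≤ 96 * (1 + 2 / ρ) * T + 9 / 8 := by
    refine (total_initial_le hε hε1 hmin m ℓ hM).trans (add_le_add_left ?_ _)
    have h3 := levelPrice_le (U := U) h1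
    have h4 : Λ / ε + 2 ≤ Λ / ε * (1 + 2 / ρ) := by
      have h5 : ρ ≤ Λ / ε := by
        rw [le_div_iff₀ hε]
        nlinarith
      have h6 : 1 ≤ Λ / ε / ρ := (one_le_div hρ).2 h5
      have h7 : Λ / ε * (1 + 2 / ρ) = Λ / ε + 2 * (Λ / ε / ρ) := by ring
      linarith
    calc 24 * (ℓ : ℝ) ^ 2 / ε * (levelPrice U * (Λ / ε + 2)) ≤
          24 * (ℓ : ℝ) ^ 2 / ε * (4 * Real.log n * (Λ / ε * (1 + 2 / ρ))) := by
          apply mul_le_mul_of_nonneg_left _ (by positivity)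
          exact mul_le_mul h3 h4 (by positivity) (by linarith)
      _ = 96 * (1 + 2 / ρ) * T := by
          rw [hT]
          field_simp
          ring
  -- Besides the main terms there remains `4 * (T / ρ) ≥ 4 * log n`, which covers `log n + 9/8`
  -- because `log n ≥ 1/2`.
  have hsmall : Real.exp (total f τmin ε (initial f m ℓ) - (768 + 1568 / ρ) * T / 8) ≤ 1 / n := by
    have h3 : 1 / n = Real.exp (-Real.log n) := by
      rw [Real.exp_neg, Real.exp_log (by linarith), one_div]
    rw [h3]
    apply Real.exp_le_exp.2
    have h4 : 96 * (1 + 2 / ρ) * T = 96 * T + 192 * (T / ρ) := by ring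
    have h5 : (768 + 1568 / ρ) * T / 8 = 96 * T + 196 * (T / ρ) := by ring
    rw [h5]
    linarith
  refine le_trans (ENNReal.ofReal_le_ofReal (sub_le_sub_left hsmall 1))
    ((one_sub_exp_le_rounds hf hℓ hε hε1 hmin hM ((768 + 1568 / ρ) * T)).trans
      (PMF.toOuterMeasure_mono _ ?_))
  -- The comparison of events is needed only on the support, where the bound on queries per round is
  -- known.
  rintro s ⟨hs, hsupp⟩
  rw [Set.mem_ofPred_eq] at hs
  have hT0 : 0 ≤ T := by
    have : 0 ≤ ρ * Real.log n := by positivity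
    linarith
  have hq := (roundsLe_outcome hf hℓ hε hε1 hmin hsupp).queries_le
  have hq' : (s.log.queries : ℝ) ≤ s.log.rounds * (ℓ * (n + 1)) := by
    rw [hn]
    exact_mod_cast hq
  have hC : 0 ≤ (768 + 1568 / ρ) * T := by positivity
  constructor
  · have : (1536 + 3136 / ρ) * T = 2 * ((768 + 1568 / ρ) * T) := by ring
    rw [this]
    linarith
  -- Bounding `n + 1` by `2 * n` is what doubles the constant.
  · calc (s.log.queries : ℝ) ≤ s.log.rounds * (ℓ * (n + 1)) := hq'
      _ ≤ (768 + 1568 / ρ) * T * (ℓ * (2 * n)) := by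
        apply mul_le_mul hs _ (by positivity) hC
        exact mul_le_mul_of_nonneg_left (by linarith) (by positivity)
      _ = _ := by
        rw [hT]
        ring

end Complexity

end PIG
end

theorem mainTheorem7 :
    -- adaptivity and query complexity, with probability at least `1 - 1/n`
    (∀ R : ℝ, 1 < R → ∃ C : ℝ, 0 < C ∧
      ∀ (U : Type*) [Fintype U] [DecidableEq U] [Nonempty U]
        (f : Finset U → ℝ) (m ℓ : ℕ) (τmin ε : ℝ),
        (∀ S, 0 ≤ f S) → PIG.Submodular f → 1 ≤ m → 1 ≤ ℓ → 0 < ε → ε < 1 → 0 < τmin →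
        R * τmin ≤ PIG.maxGain f →
        ENNReal.ofReal (1 - 1 / (Fintype.card U : ℝ)) ≤
          (PIG.parallelInterlaceGreedy f m ℓ τmin ε).toOuterMeasure
            {s | (s.log.rounds : ℝ) ≤ C * ((ℓ : ℝ) ^ 2 * (ε ^ 2)⁻¹ *
                    Real.log (Fintype.card U) * Real.log (PIG.maxGain f / τmin)) ∧
                 (s.log.queries : ℝ) ≤ C * ((ℓ : ℝ) ^ 3 * (ε ^ 2)⁻¹ * (Fintype.card U : ℝ) *
                    Real.log (Fintype.card U) * Real.log (PIG.maxGain f / τmin))}) ∧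
    -- guarantees for every possible outcome
    (∀ (U : Type*) [Fintype U] [DecidableEq U] [Nonempty U]
        (f : Finset U → ℝ) (m ℓ : ℕ) (τmin ε : ℝ),
        (∀ S, 0 ≤ f S) → PIG.Submodular f → 1 ≤ m → 1 ≤ ℓ → 0 < ε → ε < 1 → 0 < τmin →
        ∀ s ∈ (PIG.parallelInterlaceGreedy f m ℓ τmin ε).support,
          s.Halted ∧
          (∀ l, s.A' l ⊆ s.A l ∧ PIG.gain f (s.A l) ∅ ≤ PIG.gain f (s.A' l) ∅) ∧
          (∀ l₁ l₂, l₁ ≠ l₂ → Disjoint (s.A l₁) (s.A l₂)) ∧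
          (∀ O : Fin ℓ → Finset U, (∀ l, (O l).card ≤ m) →
            (∀ l j, j ≠ l → Disjoint (O l) (s.A j)) →
            (∀ l, PIG.gain f (O l) (s.A l) ≤
              PIG.gain f (s.A' l) ∅ / (1 - ε) ^ 2 + m * τmin / (1 - ε)) ∧
            (∀ l₁ l₂, l₁ < l₂ →
              PIG.gain f (O l₂) (s.A l₁) + PIG.gain f (O l₁) (s.A l₂) ≤
                (1 + 1 / (m : ℝ)) / (1 - ε) ^ 2 *
                  (PIG.gain f (s.A' l₁) ∅ + PIG.gain f (s.A' l₂) ∅) +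
                2 * m * τmin / (1 - ε))) ∧
          (ℓ = 2 → ∀ l₁ l₂, l₁ < l₂ → ∀ S : Finset U, S.card ≤ m →
            PIG.gain f S (s.A l₁) + PIG.gain f S (s.A l₂) ≤
              1 / (1 - ε) ^ 2 * (PIG.gain f (s.A' l₁) ∅ + PIG.gain f (s.A' l₂) ∅) +
              2 * m * τmin / (1 - ε))) := by
  -- `log R` bounds `log (M / τmin)` away from zero, which absorbs the additive terms of the
  -- estimate.
  refine ⟨fun R hR => ⟨1536 + 3136 / Real.log R, ?_, ?_⟩, ?_⟩
  · have := Real.log_pos hR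
    positivity
  · intro U _ _ _ f m ℓ τmin ε _ hf _ hℓ hε hε1 hmin hM
    have hM' : R ≤ PIG.maxGain f / τmin := (le_div_iff₀ hmin).2 hM
    exact PIG.complexity_bound hf hℓ hε hε1 hmin (Real.log_pos hR) (by nlinarith)
      (Real.log_le_log (by linarith) hM')
  · intro U _ _ _ f m ℓ τmin ε _ hf hm hℓ hε hε1 hmin s hs
    exact PIG.outcome_guarantees hf hm hℓ hε hε1 hmin hs
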